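/- **Model.** A source S and a destination D have one antenna each, an energy-harvesting relay R has $L\ge 1$ antennas, and P is a primary receiver. All channel coefficients are independent: $h_{sr}^i\sim\mathcal{CN}(0,\lambda_{sr}^{-1})$, $h_{rd}^j\sim\mathcal{CN}(0,\lambda_{rd}^{-1})$, $g_{rp}^j\sim\mathcal{CN}(0,\lambda_{rp}^{-1})$ $(1\le i,j\le L)$, $h_{sd}\sim\mathcal{CN}(0,\lambda_{sd}^{-1})$, $g_{sp}\sim\mathcal{CN}(0,\lambda_{sp}^{-1})$. Let $I,N_o,R_s,\xi,\beta>0$ ($\xi=1-\rho$, $\beta=\eta\rho$ for power splitting; $\xi=1$, $\beta=2\eta\rho/(1-\rho)$ for time switching), $\gamma_{th}=2^{2R_s}-1$, $\psi=\gamma_{th}N_o/I$, $S=\|h_{sr}\|^2$, $P_s=I/|g_{sp}|^2$, ${}^hP_r=\beta P_sS$, and $$\Gamma_r=\frac{\xi P_sS}{N_o},\qquad \Gamma_d=\max_{1\le j\le L}\Big(\frac{1}{N_o}\min\big({}^hP_r,I/|g_{rp}^j|^2\big)|h_{rd}^j|^2+\frac{P_s|h_{sd}|^2}{N_o}\Big).$$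 The outage probability is $p=\Pr[\min(\Gamma_r,\Gamma_d)<\gamma_{th}]$; put $p_1=\Pr[\Gamma_r<\gamma_{th}]$, $p_2=\Pr[\Gamma_d<\gamma_{th},\Gamma_r\ge\gamma_{th}]$, $\mathcal C=\{\Gamma_r\ge\gamma_{th},\ P_s|h_{sd}|^2/N_o<\gamma_{th}\}$ and $u(y)=1-\big(1+\frac{\lambda_{rd}}{I\lambda_{rp}}(\gamma_{th}N_o-y)\big)^{-1}$. **Notation.** $E_n(z)=\int_1^\infty e^{-zs}s^{-n}ds$, $\mathrm{Ei}(x)=\mathrm{PV}\!\int_{-\infty}^x e^s s^{-1}ds$ for $x>0$. Let $a=\lambda_{rp}/\beta$, $b=\psi\lambda_{rd}/\beta$, $c=\psi\lambda_{sd}$, $d=\lambda_{rd}/(\beta\lambda_{sd})$, $g=\xi/\psi$, $B_1=\lambda_{sr}+g(c+\lambda_{sp})$, $B_2=\lambda_{sr}+g\lambda_{sp}$, $A_{ij}=aj+bi$, $D_{ij}=aj+bi+d\lambda_{sp}i$. A product with a factor $i^2$, $j^2$ or $A_{ij}$ equal to $0$ is read as $0$, even when another factor is undefined there; $0^0=1$.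 **Statement.** 1. $p=p_1+p_2$ and $p_1=\Big(1+\dfrac{\lambda_{sp}\xi}{\lambda_{sr}\psi}\Big)^{-L}$, exactly. 2. Exactly, $$p_2=\sum_{i=0}^L\sum_{j=0}^i\binom Li\binom ij(-1)^{i+j}\,\mathbb E\Big[\mathbf 1_{\mathcal C}\,e^{-\frac{i\lambda_{rd}(\gamma_{th}N_o-P_s|h_{sd}|^2)}{{}^hP_r}}e^{-\frac{j\lambda_{rp}I}{{}^hP_r}}\,u(P_s|h_{sd}|^2)^j\Big].$$ 3. If in this formula the random variable $u(P_s|h_{sd}|^2)$ is replaced by the constant $t=u(m)$, for any $m\in\mathbb R$, the resulting approximation of $p_2$ equals $Q(t)$, where $$Q(t)=\sum_{i=0}^L\sum_{j=0}^i\binom Li\binom ij(-1)^{i+j}t^j\Big(T^{\mathrm{Ei}}_{ij}+T^{(1)}_{ij}-T^{(2)}_{ij}-\Big(\tfrac{\lambda_{sr}}{B_2}\Big)^Le^{-gA_{ij}}+\tfrac{\lambda_{sp}}{c+\lambda_{sp}}e^{-agj}\Big(\tfrac{\lambda_{sr}}{B_1}\Big)^L+\tfrac{c}{c+\lambda_{sp}}\Big),$$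 $$T^{\mathrm{Ei}}_{ij}=\tfrac{\lambda_{sr}^L\lambda_{sp}(di)^2}{(L-1)!\,D_{ij}}\Big(\sum_{k=0}^{L-2}\Gamma(L-1-k)(di)^k\big(e^{-agj}B_1^{k-L+1}-e^{-gA_{ij}}B_2^{k-L+1}\big)+(di)^{L-1}e^{-gA_{ij}-diB_2}\big(\mathrm{Ei}(diB_2)-\mathrm{Ei}(diB_1)\big)\Big),$$ $$T^{(1)}_{ij}=\tfrac{\lambda_{sp}\lambda_{sr}}{D_{ij}}\Big(\tfrac{aj}{c+\lambda_{sp}}\Big)^2e^{\frac{aj\lambda_{sr}}{c+\lambda_{sp}}}\Big(E_L\big(\tfrac{aj\lambda_{sr}}{c+\lambda_{sp}}\big)-\big(\tfrac{\lambda_{sr}}{B_1}\big)^{L-1}E_L\big(\tfrac{ajB_1}{c+\lambda_{sp}}\big)\Big),$$ $$T^{(2)}_{ij}=\tfrac{\lambda_{sr}A_{ij}^2}{\lambda_{sp}D_{ij}}e^{\frac{A_{ij}\lambda_{sr}}{\lambda_{sp}}}\Big(E_L\big(\tfrac{A_{ij}\lambda_{sr}}{\lambda_{sp}}\big)-\big(\tfrac{\lambda_{sr}}{B_2}\big)^{L-1}E_L\big(\tfrac{A_{ij}B_2}{\lambda_{sp}}\big)\Big).$$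 4. The mean of $P_s|h_{sd}|^2$ truncated to the outage event of the direct link is $$m_0=\mathbb E\big[P_s|h_{sd}|^2\mathbf 1_{P_s|h_{sd}|^2/N_o<\gamma_{th}}\big]=\frac{I\lambda_{sp}}{\lambda_{sd}}\Big(\log\Big(\frac{\psi\lambda_{sd}}{\lambda_{sp}}+1\Big)-\frac{\psi\lambda_{sd}}{\psi\lambda_{sd}+\lambda_{sp}}\Big),$$ so that $u(m_0)=1-\Big(1+\frac{\lambda_{rd}}{\lambda_{rp}}\Big(\psi-\frac{\lambda_{sp}}{\lambda_{sd}}\Big(\log\big(\frac{\psi\lambda_{sd}}{\lambda_{sp}}+1\big)-\frac{\psi\lambda_{sd}}{\psi\lambda_{sd}+\lambda_{sp}}\Big)\Big)\Big)^{-1}$. With $\mu=\lambda_{sr}/g$, the conditional mean is $$m_1=\mathbb E\big[P_s|h_{sd}|^2\,\big|\,\mathcal C\big]=\frac{I\lambda_{sp}}{\lambda_{sd}}\cdot\frac{\log\big(1+\frac c{\lambda_{sp}+\mu}\big)+\sum_{k=1}^{L-1}\frac{\mu^k}{k}\big((\lambda_{sp}+\mu)^{-k}-(\lambda_{sp}+\mu+c)^{-k}\big)-\frac{c}{c+\lambda_{sp}}\big(1-(\lambda_{sr}/B_1)^L\big)}{1-(\lambda_{sr}/B_2)^L-\frac{\lambda_{sp}}{c+\lambda_{sp}}\big(1-(\lambda_{sr}/B_1)^L\big)}.$$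 5. As $\lambda_{rp}\to\infty$ (other parameters and $m$ fixed), $u(m)\to0$ and $Q(u(m))\to\tilde p_2$; also the true $p_2\to\tilde p_2$; and $\tilde p_2$ equals $p_2$ for the system in which the relay transmits with power ${}^hP_r$ instead of $\min({}^hP_r,I/|g^j_{rp}|^2)$. Here, with $F=\lambda_{rd}\lambda_{sp}/\lambda_{sd}+\lambda_{rd}\psi$ and $w_i=\frac{\lambda_{rd}i\psi}{\beta\lambda_{sp}}$, $$\tilde p_2=\sum_{i=1}^L(-1)^i\binom Li\Big(\tfrac{\lambda_{rd}^2\lambda_{sp}\lambda_{sr}^L}{\beta\lambda_{sd}^2(L-1)!F}\Big(\sum_{k=0}^{L-2}i\,\Gamma(L-k-1)(di)^k\big(B_1^{k-L+1}-e^{-\frac{\lambda_{rd}i\xi}{\beta}}B_2^{k-L+1}\big)+i(di)^{L-1}e^{-diB_2-\frac{\lambda_{rd}i\xi}\beta}\big(\mathrm{Ei}(diB_2)-\mathrm{Ei}(diB_1)\big)\Big)$$ $$\qquad-\tfrac{\lambda_{rd}^2\lambda_{sr}i\psi^2}{\beta\lambda_{sp}F}e^{w_i\lambda_{sr}}\Big(E_L(w_i\lambda_{sr})-\big(\tfrac{\lambda_{sr}}{B_2}\big)^{L-1}E_L(w_iB_2)\Big)-e^{-\frac{\lambda_{rd}i\xi}{\beta}}\big(\tfrac{\lambda_{sr}}{B_2}\big)^L\Big)-\big(\tfrac{\lambda_{sr}}{B_2}\big)^L.$$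 6. As $\lambda_{sd}\to\infty$ (other parameters fixed), for $m=m_0$ and for $m=m_1$ one has $u(m)\to t_{nd}=1-(1+\lambda_{rd}\psi/\lambda_{rp})^{-1}$ and $Q(u(m))\to p_{2\text{-}nd}$; also the true $p_2\to p_{2\text{-}nd}$; and $p_{2\text{-}nd}$ equals $p_2$ for the system without direct link, in which $\Gamma_d=\max_j\min({}^hP_r,I/|g_{rp}^j|^2)|h_{rd}^j|^2/N_o$. Here $$p_{2\text{-}nd}=\sum_{i=0}^L\sum_{j=0}^i\binom Li\binom ij(-1)^{i+j}t_{nd}^j\Big(1-\tfrac{\lambda_{sr}A_{ij}}{\lambda_{sp}}e^{\frac{A_{ij}\lambda_{sr}}{\lambda_{sp}}}\Big(E_L\big(\tfrac{A_{ij}\lambda_{sr}}{\lambda_{sp}}\big)-\big(\tfrac{\lambda_{sr}}{B_2}\big)^{L-1}E_L\big(\tfrac{A_{ij}B_2}{\lambda_{sp}}\big)\Big)-\big(\tfrac{\lambda_{sr}}{B_2}\big)^Le^{-gA_{ij}}\Big).$$ -/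

import Mathlib

open MeasureTheory ProbabilityTheory Filter Topology
open scoped NNReal

noncomputable section

/-- The generalized exponential integral `E_n(z) = ∫_1^∞ e^{-zt} / t^n dt`. -/
def genExpIntegral (n : ℕ) (z : ℝ) : ℝ :=
  ∫ t in Set.Ioi (1 : ℝ), Real.exp (-z * t) / t ^ n

/-- The exponential integral `Ei(x) = PV ∫_{-∞}^x e^t / t dt` for `x > 0`, as a Cauchy principal
value at `t = 0`. -/
def expIntegralEi (x : ℝ) : ℝ :=
  limUnder (𝓝[>] (0 : ℝ)) fun ε =>
    (∫ t in Set.Iic (-ε), Real.exp t / t) + ∫ t in ε..x, Real.exp t / t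

/-- The circular complex normal law `CN(0, v)`: real and imaginary parts are independent
and normal with mean `0` and variance `v / 2`. -/
def circularNormal (v : ℝ≥0) : Measure ℂ :=
  ((gaussianReal 0 (v / 2)).prod (gaussianReal 0 (v / 2))).map
    fun p : ℝ × ℝ => (⟨p.1, p.2⟩ : ℂ)

/-- A realization of all channel coefficients, in the order
`(h_sr, h_rd, g_rp, h_sd, g_sp)`; `L` is the number of antennas at the relay. -/
abbrev Channels (L : ℕ) : Type :=
  (Fin L → ℂ) × (Fin L → ℂ) × (Fin L → ℂ) × ℂ × ℂ

/-- `|g_sp|²` -/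
def Channels.gainSP {L : ℕ} (h : Channels L) : ℝ := ‖h.2.2.2.2‖ ^ 2

/-- `|h_sd|²` -/
def Channels.gainSD {L : ℕ} (h : Channels L) : ℝ := ‖h.2.2.2.1‖ ^ 2

/-- `‖h_sr‖²`, the squared Euclidean norm of the vector channel from S to R. -/
def Channels.gainSR {L : ℕ} (h : Channels L) : ℝ := ∑ i, ‖h.1 i‖ ^ 2

/-- `|h_rd^j|²` -/
def Channels.gainRD {L : ℕ} (h : Channels L) (j : Fin L) : ℝ := ‖h.2.1 j‖ ^ 2

/-- `|g_rp^j|²` -/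
def Channels.gainRP {L : ℕ} (h : Channels L) (j : Fin L) : ℝ := ‖h.2.2.1 j‖ ^ 2

/-- Parameters of the network with an `L`-antenna energy harvesting relay. -/
structure Network (L : ℕ) where
  /-- `λ_sr` -/
  lsr : ℝ
  /-- `λ_rd` -/
  lrd : ℝ
  /-- `λ_rp` -/
  lrp : ℝ
  /-- `λ_sd` -/
  lsd : ℝ
  /-- `λ_sp` -/
  lsp : ℝ
  /-- interference temperature limit `I` -/
  Itemp : ℝ
  /-- noise power `N_o` -/
  No : ℝ
  /-- target rate `R_s` -/
  Rs : ℝ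
  /-- `ξ`: equal to `1 - ρ` with power splitting and to `1` with time switching -/
  xi : ℝ
  /-- `β`: equal to `η ρ` with power splitting and to `2 η ρ / (1 - ρ)` with time switching -/
  beta : ℝ

namespace Network

variable {L : ℕ}

/-- All parameters are positive and there is at least one relay antenna. -/
structure Valid (N : Network L) : Prop where
  one_le_L : 1 ≤ L
  lsr_pos : 0 < N.lsr
  lrd_pos : 0 < N.lrd
  lrp_pos : 0 < N.lrp
  lsd_pos : 0 < N.lsd
  lsp_pos : 0 < N.lsp
  Itemp_pos : 0 < N.Itemp
  No_pos : 0 < N.No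
  Rs_pos : 0 < N.Rs
  xi_pos : 0 < N.xi
  beta_pos : 0 < N.beta

/-- The joint law of the channels: all coefficients are independent, and a coefficient with
parameter `λ` has law `CN(0, λ⁻¹)`. -/
def law (N : Network L) : Measure (Channels L) :=
  (Measure.pi fun _ => circularNormal (N.lsr⁻¹).toNNReal).prod
    ((Measure.pi fun _ => circularNormal (N.lrd⁻¹).toNNReal).prod
      ((Measure.pi fun _ => circularNormal (N.lrp⁻¹).toNNReal).prod
        ((circularNormal (N.lsd⁻¹).toNNReal).prod (circularNormal (N.lsp⁻¹).toNNReal))))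

/-- `γ_th = 2^{2 R_s} - 1` -/
def gammaTh (N : Network L) : ℝ := (2 : ℝ) ^ (2 * N.Rs) - 1

/-- `ψ = γ_th / (I / N_o)` -/
def psi (N : Network L) : ℝ := N.gammaTh / (N.Itemp / N.No)

/-- Transmit power of the source, `P_s = I / |g_sp|²`. -/
def Ps (N : Network L) (h : Channels L) : ℝ := N.Itemp / h.gainSP

/-- Harvested power at the relay, `β P_s ‖h_sr‖²`. -/
def harvested (N : Network L) (h : Channels L) : ℝ := N.beta * N.Ps h * h.gainSR

/-- Transmit power of the relay on antenna `j`. -/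
def Pr (N : Network L) (h : Channels L) (j : Fin L) : ℝ :=
  min (N.harvested h) (N.Itemp / h.gainRP j)

/-- SNR at the relay in the first hop. -/
def snrR (N : Network L) (h : Channels L) : ℝ := N.xi * N.Ps h * h.gainSR / N.No

/-- SNR at D after maximal ratio combining, if the relay uses its antenna `j`. -/
def snrDAntenna (N : Network L) (h : Channels L) (j : Fin L) : ℝ :=
  N.Pr h j * h.gainRD j / N.No + N.Ps h * h.gainSD / N.No

/-- SNR at D with transmit antenna selection: the best antenna is used. -/
def snrD (N : Network L) (h : Channels L) : ℝ := ⨆ j, N.snrDAntenna h j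

/-- SNR at D with antenna selection if the relay always uses all the harvested power. -/
def snrDUnconstrained (N : Network L) (h : Channels L) : ℝ :=
  ⨆ j, (N.harvested h * h.gainRD j / N.No + N.Ps h * h.gainSD / N.No)

/-- SNR at D with antenna selection if D does not use the direct link. -/
def snrDNoDirect (N : Network L) (h : Channels L) : ℝ :=
  ⨆ j, N.Pr h j * h.gainRD j / N.No

/-- Overall outage probability. -/
def outage (N : Network L) : ℝ := N.law.real {h | min (N.snrR h) (N.snrD h) < N.gammaTh}

/-- First-hop outage probability. -/
def p1 (N : Network L) : ℝ := N.law.real {h | N.snrR h < N.gammaTh}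

/-- Probability that the relay decodes and D is in outage. -/
def p2 (N : Network L) : ℝ :=
  N.law.real {h | N.snrD h < N.gammaTh ∧ N.gammaTh ≤ N.snrR h}

/-- `p₂` for the system without interference constraint at the relay. -/
def p2Unconstrained (N : Network L) : ℝ :=
  N.law.real {h | N.snrDUnconstrained h < N.gammaTh ∧ N.gammaTh ≤ N.snrR h}

/-- `p₂` for the system without direct link. -/
def p2NoDirect (N : Network L) : ℝ :=
  N.law.real {h | N.snrDNoDirect h < N.gammaTh ∧ N.gammaTh ≤ N.snrR h}

/-- The event that the relay decodes and the direct link alone is in outage. -/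
def condEvent (N : Network L) : Set (Channels L) :=
  {h | N.gammaTh ≤ N.snrR h ∧ N.Ps h * h.gainSD / N.No < N.gammaTh}

/-- `1 - 1 / (1 + λ_rd / (I λ_rp) * (γ_th N_o - y))`; in the exact expansion of `p₂` the argument
`y` is the random variable `P_s |h_sd|²`, in the approximation it is a constant. -/
def innerTerm (N : Network L) (y : ℝ) : ℝ :=
  1 - 1 / (1 + N.lrd / (N.Itemp * N.lrp) * (N.gammaTh * N.No - y))

/-- The double sum obtained by expanding the `L`-th power of the conditional distribution function
of the relayed signal power, with `u` in the place of the inner random term. -/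
def expansion (N : Network L) (u : Channels L → ℝ) : ℝ :=
  ∑ i ∈ Finset.range (L + 1), ∑ j ∈ Finset.range (i + 1),
    (L.choose i : ℝ) * (i.choose j : ℝ) * (-1) ^ (i + j) *
      ∫ h in N.condEvent,
        Real.exp (-(i * N.lrd * (N.gammaTh * N.No - N.Ps h * h.gainSD)) / N.harvested h) *
          Real.exp (-(j * N.lrp * N.Itemp) / N.harvested h) * u h ^ j ∂N.law

/-- The approximation of `p₂`: in the inner term the random variable `P_s |h_sd|²` is replaced by
the constant `m`. -/
def p2Approx (N : Network L) (m : ℝ) : ℝ := N.expansion fun _ => N.innerTerm m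

/-- The mean of `P_s |h_sd|²` truncated to the outage event of the direct link. -/
def truncMean (N : Network L) : ℝ :=
  ∫ h in {h | N.Ps h * h.gainSD / N.No < N.gammaTh}, N.Ps h * h.gainSD ∂N.law

/-- The conditional mean of `P_s |h_sd|²`, given that the relay decodes and the direct link is in
outage. -/
def condMean (N : Network L) : ℝ :=
  ∫ h, N.Ps h * h.gainSD ∂(ProbabilityTheory.cond N.law N.condEvent)

/-- `a = λ_rp / β` -/
def a (N : Network L) : ℝ := N.lrp / N.beta
/-- `b = ψ λ_rd / β` -/
def b (N : Network L) : ℝ := N.psi * N.lrd / N.beta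
/-- `c = ψ λ_sd` -/
def c (N : Network L) : ℝ := N.psi * N.lsd
/-- `d = λ_rd / (β λ_sd)` -/
def d (N : Network L) : ℝ := N.lrd / (N.beta * N.lsd)
/-- `g = ξ / ψ` -/
def g (N : Network L) : ℝ := N.xi / N.psi
/-- `B₁ = λ_sr + g (c + λ_sp)` -/
def B1 (N : Network L) : ℝ := N.lsr + N.g * (N.c + N.lsp)
/-- `B₂ = λ_sr + g λ_sp` -/
def B2 (N : Network L) : ℝ := N.lsr + N.g * N.lsp

/-- The part of the `(i, j)` summand with the exponential integral `Ei`
(equal to `0` for `i = 0`). -/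
def termEi (N : Network L) (i j : ℕ) : ℝ :=
  N.lsr ^ L * N.lsp * (N.d * i) ^ 2 /
      ((L - 1).factorial * (N.a * j + N.b * i + N.d * N.lsp * i)) *
    ((∑ k ∈ Finset.range (L - 1), Real.Gamma ((L : ℝ) - 1 - k) * (N.d * i) ^ k *
        (Real.exp (-N.a * N.g * j) * N.B1 ^ ((k : ℤ) - L + 1)
          - Real.exp (-N.g * (N.a * j + N.b * i)) * N.B2 ^ ((k : ℤ) - L + 1)))
      + (N.d * i) ^ (L - 1) * Real.exp (-N.g * (N.a * j + N.b * i)) *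
        Real.exp (-(N.d * i * N.B2)) *
          (expIntegralEi (N.d * i * N.B2) - expIntegralEi (N.d * i * N.B1)))

/-- The first part of the `(i, j)` summand with `E_L` (equal to `0` for `j = 0`). -/
def termE1 (N : Network L) (i j : ℕ) : ℝ :=
  N.lsp * N.lsr / (N.a * j + N.b * i + N.d * N.lsp * i) * (N.a * j / (N.c + N.lsp)) ^ 2 *
    Real.exp (N.a * j / (N.c + N.lsp) * N.lsr) *
      (genExpIntegral L (N.a * j / (N.c + N.lsp) * N.lsr)
        - (N.lsr / N.B1) ^ (L - 1) * genExpIntegral L (N.a * j / (N.c + N.lsp) * N.B1))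

/-- The second part of the `(i, j)` summand with `E_L` (equal to `0` for `i = j = 0`). -/
def termE2 (N : Network L) (i j : ℕ) : ℝ :=
  N.lsr * (N.a * j + N.b * i) ^ 2 / (N.lsp * (N.a * j + N.b * i + N.d * N.lsp * i)) *
    Real.exp ((N.a * j + N.b * i) / N.lsp * N.lsr) *
      (genExpIntegral L ((N.a * j + N.b * i) / N.lsp * N.lsr)
        - (N.lsr / N.B2) ^ (L - 1) * genExpIntegral L ((N.a * j + N.b * i) / N.lsp * N.B2))

/-- The closed-form approximation of `p₂` as a function of `t`. -/
def p2Closed (N : Network L) (t : ℝ) : ℝ :=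
  ∑ i ∈ Finset.range (L + 1), ∑ j ∈ Finset.range (i + 1),
    (L.choose i : ℝ) * (i.choose j : ℝ) * (-1) ^ (i + j) * t ^ j *
      (N.termEi i j + N.termE1 i j - N.termE2 i j
        - (N.lsr / N.B2) ^ L * Real.exp (-N.g * (N.a * j + N.b * i))
        + N.lsp / (N.c + N.lsp) * Real.exp (-N.a * N.g * j) * (N.lsr / N.B1) ^ L
        + N.c / (N.c + N.lsp))

/-- The simplified closed form without interference constraint at the relay. -/
def p2ClosedUnconstrained (N : Network L) : ℝ :=
  (∑ i ∈ Finset.Icc 1 L, (-1 : ℝ) ^ i * (L.choose i : ℝ) *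
    (N.lsr ^ L * N.lrd ^ 2 * N.lsp /
        (N.beta * N.lsd ^ 2 * (L - 1).factorial * (N.lrd * N.lsp / N.lsd + N.lrd * N.psi)) *
      ((∑ k ∈ Finset.range (L - 1), i * Real.Gamma ((L : ℝ) - 1 - k) * (N.d * i) ^ k *
          (N.B1 ^ ((k : ℤ) - L + 1)
            - Real.exp (-(N.lrd * i * N.xi) / N.beta) * N.B2 ^ ((k : ℤ) - L + 1)))
        + i * (N.d * i) ^ (L - 1) *
          Real.exp (-(N.d * i * N.B2) - N.lrd * i * N.xi / N.beta) *
            (expIntegralEi (N.d * i * N.B2) - expIntegralEi (N.d * i * N.B1)))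
      - N.lrd ^ 2 * N.lsr * i * N.psi ^ 2 /
          (N.beta * N.lsp * (N.lrd * N.lsp / N.lsd + N.lrd * N.psi)) *
        Real.exp (N.lrd * N.lsr * i * N.psi / (N.beta * N.lsp)) *
          (genExpIntegral L (N.lrd * N.lsr * i * N.psi / (N.beta * N.lsp))
            - (N.lsr / N.B2) ^ (L - 1) *
              genExpIntegral L (N.lrd * i * N.psi / (N.beta * N.lsp) * N.B2))
      - Real.exp (-(N.lrd * i * N.xi) / N.beta) * (N.lsr / N.B2) ^ L))
    - (N.lsr / N.B2) ^ L

/-- `t_nd = 1 - (1 + λ_rd ψ / λ_rp)⁻¹` -/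
def tNoDirect (N : Network L) : ℝ := 1 - (1 + N.lrd * N.psi / N.lrp)⁻¹

/-- The closed form without direct link. -/
def p2ClosedNoDirect (N : Network L) : ℝ :=
  ∑ i ∈ Finset.range (L + 1), ∑ j ∈ Finset.range (i + 1),
    (L.choose i : ℝ) * (i.choose j : ℝ) * (-1) ^ (i + j) * N.tNoDirect ^ j *
      (1 - N.lsr * (N.a * j + N.b * i) / N.lsp *
          Real.exp ((N.a * j + N.b * i) / N.lsp * N.lsr) *
            (genExpIntegral L ((N.a * j + N.b * i) / N.lsp * N.lsr)
              - (N.lsr / N.B2) ^ (L - 1) *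
                genExpIntegral L ((N.a * j + N.b * i) / N.lsp * N.B2))
        - (N.lsr / N.B2) ^ L * Real.exp (-N.g * (N.a * j + N.b * i)))

end Network

end

noncomputable section

/-! Every event depends on the channels only through squared moduli, and the squared modulus of a
CN(0, 1/λ) variable is exponential with rate λ. So S = ‖h_sr‖² is a sum of L exponentials, X =
|g_sp|² and Y = |h_sd|² are exponential, and all three are independent of the L i.i.d. pairs
(|h_rd^j|², |g_rp^j|²). Up to null sets the relay decodes iff X ≤ gS, and the direct link is in
outage iff Y < ψX.

Given (S, X, Y), the destination is in outage iff all antennas are, so the conditional probability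
is an L-th power (`law_real_forall_antenna`). One antenna has outage probability 1 - x(1 - y u) with
x, y exponentials (`real_min_mul_lt`). Expanding this power twice gives the exact double sum for p₂,
whose summands are truncated expectations of `kernel` times a power of u.

With u constant only the kernels have to be integrated (`setIntegral_kernel`). Integrating out Y,
then X, leaves a function of S with an apparent pole at S = δ = di. Partial fractions in S
(`partialFraction_identity`) leave two kinds of terms. Quotients (1 - e^{-(κS+p)g})/(κS+p) give E_L,
by writing 1/(S+z) as a Laplace integral. The divided difference of exponentials at δ is an integral
of e^{-τ(S-δ)} over τ, which the Laplace transform (r/(r+τ))^L turns into ∫ e^{δB}/B^L dB, and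
repeated integration by parts turns that into Ei.

The two means come from the same device: (1 - e^{-cX})/X is the integral of e^{-tX} over t in [0,
c], so only Laplace transforms have to be integrated over t.

The limits of the closed forms are not taken on Ei and E_L, but on the expectations that these
represent. As λ_rp → ∞, u tends to 0 and the kernel expectations stay bounded by 1, so only j = 0
survives, and those terms do not involve λ_rp. As λ_sd → ∞, Y is realized as a rescaled copy of one
fixed variable, and dominated convergence sets Y = 0. -/

/-! ### The exponential law and the squared modulus of a complex normal variable -/

theorem expMeasure_eq_withDensity (r : ℝ) :
    expMeasure r = (volume.restrict (Set.Ioi 0)).withDensity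
      fun x => ENNReal.ofReal (r * Real.exp (-(r * x))) := by
  ext s hs
  rw [expMeasure, gammaMeasure, withDensity_apply _ hs, withDensity_apply _ hs,
    ← lintegral_indicator hs, ← lintegral_indicator hs, restrict_Ioi_eq_restrict_Ici,
    ← lintegral_indicator measurableSet_Ici]
  refine lintegral_congr fun x => ?_
  by_cases hx : 0 ≤ x <;> by_cases hxs : x ∈ s <;>
    simp [Set.indicator, hx, hxs, gammaPDF_eq]

theorem integral_expMeasure {r : ℝ} (hr : 0 < r) (f : ℝ → ℝ) :
    ∫ x, f x ∂(expMeasure r) = ∫ x in Set.Ioi 0, r * Real.exp (-(r * x)) * f x := by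
  rw [expMeasure_eq_withDensity, integral_withDensity_eq_integral_toReal_smul
    (by fun_prop) (by simp)]
  refine integral_congr_ae (.of_forall fun x => ?_)
  simp only [smul_eq_mul]
  rw [ENNReal.toReal_ofReal (by positivity)]

theorem expMeasure_ae_pos (r : ℝ) : ∀ᵐ x ∂(expMeasure r), 0 < x := by
  rw [expMeasure_eq_withDensity]
  exact (withDensity_absolutelyContinuous _ _).ae_le (ae_restrict_mem measurableSet_Ioi)

instance nullSingletonClass_expMeasure (r : ℝ) : NullSingletonClass (expMeasure r) := by
  rw [expMeasure, gammaMeasure]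
  exact nullSingletonClass_withDensity _

/-- The squared modulus of a circular complex normal variable is exponentially distributed. -/
theorem map_normSq_circularNormal {r : ℝ} (hr : 0 < r) :
    (circularNormal (r⁻¹).toNNReal).map (fun z => ‖z‖ ^ 2) = expMeasure r := by
  have hv : (r⁻¹).toNNReal / 2 ≠ 0 := by
    have : 0 < (r⁻¹).toNNReal := by simpa using hr
    positivity
  have hvr : (((r⁻¹).toNNReal / 2 : ℝ≥0) : ℝ) = r⁻¹ / 2 := by
    simp [hr.le]
  have hm : Measurable fun p : ℝ × ℝ => (⟨p.1, p.2⟩ : ℂ) :=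
    Complex.measurableEquivRealProd.symm.measurable
  -- Squaring is a bijection of the half-line, used below to pull the exponential density back to
  -- the radius ρ.
  have himg : (fun x : ℝ => x ^ 2) '' Set.Ioi 0 = Set.Ioi 0 := by
    ext x
    simp only [Set.mem_image, Set.mem_Ioi]
    exact ⟨fun ⟨y, hy, h⟩ => h ▸ by positivity,
      fun h => ⟨√x, Real.sqrt_pos.2 h, Real.sq_sqrt h.le⟩⟩
  suffices key : ∀ f : ℝ → ENNReal, Measurable f →
      ∫⁻ x, f x ∂((circularNormal (r⁻¹).toNNReal).map (fun z => ‖z‖ ^ 2)) =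
        ∫⁻ x, f x ∂(expMeasure r) by
    ext s hs
    simpa [lintegral_indicator_one hs] using key (s.indicator 1) (measurable_one.indicator hs)
  intro f hf
  rw [circularNormal, Measure.map_map (by fun_prop) hm,
    lintegral_map hf (by fun_prop),
    gaussianReal_of_var_ne_zero 0 hv, prod_withDensity (by fun_prop) (by fun_prop),
    lintegral_withDensity_eq_lintegral_mul _ (by fun_prop) (by fun_prop),
    ← Measure.volume_eq_prod, ← lintegral_comp_polarCoord_symm, expMeasure_eq_withDensity,
    lintegral_withDensity_eq_lintegral_mul _ (by fun_prop) hf]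
  rw [← himg, lintegral_image_eq_lintegral_abs_deriv_mul measurableSet_Ioi
    (f' := fun x => 2 * x) (fun x _ => by simpa using (hasDerivAt_pow 2 x).hasDerivWithinAt)
    (fun x hx y hy h => by
      simp only [Set.mem_Ioi] at hx hy
      exact (pow_left_inj₀ hx.le hy.le two_ne_zero).1 h)]
  -- With variance r⁻¹/2 per coordinate, the planar density is (r/π) e^{-rρ²}, free of the angle;
  -- the factor ρ is the Jacobian.
  have hpt : ∀ p ∈ polarCoord.target, ENNReal.ofReal p.1 •
      ((fun z : ℝ × ℝ => gaussianPDF 0 ((r⁻¹).toNNReal / 2) z.1 *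
        gaussianPDF 0 ((r⁻¹).toNNReal / 2) z.2) *
        fun a => f (((fun z : ℂ => ‖z‖ ^ 2) ∘ fun p : ℝ × ℝ => (⟨p.1, p.2⟩ : ℂ)) a))
        (polarCoord.symm p) =
      ENNReal.ofReal (p.1 * (r / Real.pi) * Real.exp (-(r * p.1 ^ 2))) * f (p.1 ^ 2) := by
    rintro ⟨ρ, θ⟩ hp
    have hρ : 0 < ρ := by simpa using hp.1
    have hn : ‖(⟨ρ * Real.cos θ, ρ * Real.sin θ⟩ : ℂ)‖ ^ 2 = ρ ^ 2 := by
      rw [Complex.sq_norm, Complex.normSq_mk]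
      linear_combination ρ ^ 2 * Real.cos_sq_add_sin_sq θ
    simp only [Pi.mul_apply, Function.comp, polarCoord_symm_apply, smul_eq_mul, hn]
    rw [← mul_assoc, gaussianPDF, gaussianPDF, ← ENNReal.ofReal_mul (gaussianPDFReal_nonneg _ _ _),
      ← ENNReal.ofReal_mul hρ.le]
    congr 2
    simp only [gaussianPDFReal, hvr, sub_zero]
    have h2 : 2 * Real.pi * (r⁻¹ / 2) = Real.pi / r := by field_simp
    rw [h2, mul_mul_mul_comm, ← Real.exp_add, ← mul_inv, Real.mul_self_sqrt (by positivity),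
      inv_div, mul_assoc]
    congr 3
    field_simp
    linear_combination (-1) * Real.cos_sq_add_sin_sq θ
  rw [setLIntegral_congr_fun (by simpa using polarCoord.open_target.measurableSet) hpt,
    polarCoord_target, Measure.volume_eq_prod, ← Measure.prod_restrict]
  -- The angle contributes 2π, turning ρ r/π into 2ρ r, which is the density r e^{-rx} after x = ρ²,
  -- dx = 2ρ dρ.
  rw [lintegral_prod _ (by fun_prop)]
  simp only [lintegral_const, Measure.restrict_apply_univ, Real.volume_Ioo]
  refine setLIntegral_congr_fun measurableSet_Ioi fun ρ hρ => ?_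
  have hρ : 0 < ρ := hρ
  simp only [Pi.mul_apply]
  rw [mul_right_comm, ← ENNReal.ofReal_mul (by positivity), ← mul_assoc,
    ← ENNReal.ofReal_mul (by positivity), abs_of_pos (by positivity)]
  congr 2
  field_simp
  ring

/-! ### The Erlang law -/

/-- The law of a sum of `L` independent exponential variables with rate `r`. -/
def erlangLaw (L : ℕ) (r : ℝ) : Measure ℝ :=
  (Measure.pi fun _ : Fin L => expMeasure r).map fun v => ∑ i, v i

theorem isProbabilityMeasure_erlangLaw (L : ℕ) {r : ℝ} (hr : 0 < r) :
    IsProbabilityMeasure (erlangLaw L r) := by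
  have := isProbabilityMeasure_expMeasure hr
  exact Measure.isProbabilityMeasure_map (by fun_prop)

theorem laplace_expMeasure {r τ : ℝ} (hr : 0 < r) (hτ : 0 ≤ τ) :
    ∫ x, Real.exp (-(τ * x)) ∂(expMeasure r) = r / (r + τ) := by
  have h : ∀ x : ℝ, r * Real.exp (-(r * x)) * Real.exp (-(τ * x)) =
      r * Real.exp (-(r + τ) * x) := fun x => by rw [mul_assoc, ← Real.exp_add]; ring_nf
  rw [integral_expMeasure hr]
  simp_rw [h]
  rw [integral_const_mul, integral_exp_mul_Ioi (by linarith)]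
  have : r + τ ≠ 0 := by positivity
  rw [mul_zero, Real.exp_zero, neg_div_neg_eq, mul_one_div]

/-- The exponential of a sum factorizes over independent coordinates. All later Erlang integrals are
reduced to this transform, so the Erlang density is never needed. -/
theorem laplace_erlangLaw (L : ℕ) {r τ : ℝ} (hr : 0 < r) (hτ : 0 ≤ τ) :
    ∫ s, Real.exp (-(τ * s)) ∂(erlangLaw L r) = (r / (r + τ)) ^ L := by
  have := isProbabilityMeasure_expMeasure hr
  rw [erlangLaw, integral_map (by fun_prop) (by fun_prop)]
  simp_rw [Finset.mul_sum, ← Finset.sum_neg_distrib, Real.exp_sum]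
  rw [integral_fintype_prod_eq_pow (fun x : ℝ => Real.exp (-(τ * x))), laplace_expMeasure hr hτ,
    Fintype.card_fin]

theorem erlangLaw_ae_pos {L : ℕ} (hL : 1 ≤ L) {r : ℝ} (hr : 0 < r) :
    ∀ᵐ s ∂(erlangLaw L r), 0 < s := by
  have := isProbabilityMeasure_expMeasure hr
  have : Nonempty (Fin L) := ⟨⟨0, hL⟩⟩
  rw [erlangLaw, ae_map_iff (by fun_prop) measurableSet_Ioi]
  have h : ∀ᵐ v ∂(Measure.pi fun _ : Fin L => expMeasure r), ∀ i, 0 < v i :=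
    ae_all_iff.2 fun i => (Measure.tendsto_eval_ae_ae (i := i)).eventually (expMeasure_ae_pos r)
  filter_upwards [h] with v hv
  exact Finset.sum_pos (fun i _ => hv i) Finset.univ_nonempty

/-- Needed because the integral over X and Y is computed with a division by s - δ. With the other
summands fixed, the first one would have to hit a single prescribed value, and the exponential law
has no atoms. -/
theorem erlangLaw_ae_ne {L : ℕ} (hL : 1 ≤ L) {r : ℝ} (hr : 0 < r) (x : ℝ) :
    ∀ᵐ s ∂(erlangLaw L r), s ≠ x := by
  have := isProbabilityMeasure_expMeasure hr
  obtain ⟨n, rfl⟩ : ∃ n, L = n + 1 := ⟨L - 1, by omega⟩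
  rw [erlangLaw, ae_map_iff (by fun_prop) (measurableSet_singleton x).compl (p := (· ≠ x))]
  have hp := (measurePreserving_piFinSuccAbove (fun _ : Fin (n + 1) => expMeasure r) 0)
  suffices h : ∀ᵐ p ∂((expMeasure r).prod (Measure.pi fun _ : Fin n => expMeasure r)),
      p.1 + ∑ i, p.2 i ≠ x by
    have := hp.quasiMeasurePreserving.ae h
    filter_upwards [this] with v hv
    rw [Fin.sum_univ_succ]
    simpa [Fin.removeNth, Fin.tail] using hv
  have hmeas : MeasurableSet {p : ℝ × (Fin n → ℝ) | p.1 + ∑ i, p.2 i ≠ x} :=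
    (measurableSet_singleton x).compl.preimage
      (f := fun p : ℝ × (Fin n → ℝ) => p.1 + ∑ i, p.2 i) (by fun_prop)
  rw [Measure.ae_prod_iff_ae_ae hmeas, Measure.ae_ae_comm hmeas]
  refine .of_forall fun v => ?_
  filter_upwards [Measure.ae_ne (expMeasure r) (x - ∑ i, v i)] with y hy h
  exact hy (by linarith)

/-! ### Joint law of the gains and conditional independence of the antennas -/

namespace Network
variable {L : ℕ}

/-- The joint law of `(‖h_sr‖², |g_sp|², |h_sd|²)`. -/
def gainsLaw (N : Network L) : Measure (ℝ × ℝ × ℝ) :=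
  (erlangLaw L N.lsr).prod ((expMeasure N.lsp).prod (expMeasure N.lsd))

end Network

/-- `(‖h_sr‖², |g_sp|², |h_sd|²)` -/
def Channels.gains {L : ℕ} (h : Channels L) : ℝ × ℝ × ℝ := (h.gainSR, h.gainSP, h.gainSD)

theorem measurePreserving_normSq_circularNormal {r : ℝ} (hr : 0 < r) :
    MeasurePreserving (fun z : ℂ => ‖z‖ ^ 2) (circularNormal (r⁻¹).toNNReal) (expMeasure r) :=
  ⟨by fun_prop, map_normSq_circularNormal hr⟩

instance (v : ℝ≥0) : IsProbabilityMeasure (circularNormal v) :=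
  Measure.isProbabilityMeasure_map Complex.measurableEquivRealProd.symm.measurable.aemeasurable

namespace Network
variable {L : ℕ} {N : Network L}

/-- Coordinatewise passage to squared moduli, followed by reassociations and swaps of product
measures. The gains of each antenna are paired so that the antenna part becomes a power of one law
on ℝ × ℝ. -/
theorem measurePreserving_allGains (hN : N.Valid) :
    MeasurePreserving (fun h : Channels L => ((fun j => (h.gainRD j, h.gainRP j)), h.gains)) N.law
      ((Measure.pi fun _ => (expMeasure N.lrd).prod (expMeasure N.lrp)).prod N.gainsLaw) := by
  have := isProbabilityMeasure_expMeasure hN.lsr_pos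
  have := isProbabilityMeasure_expMeasure hN.lrd_pos
  have := isProbabilityMeasure_expMeasure hN.lrp_pos
  have := isProbabilityMeasure_expMeasure hN.lsd_pos
  have := isProbabilityMeasure_expMeasure hN.lsp_pos
  have := isProbabilityMeasure_erlangLaw L hN.lsr_pos
  have hpi : ∀ {r : ℝ}, 0 < r → MeasurePreserving (fun (v : Fin L → ℂ) i => ‖v i‖ ^ 2)
      (Measure.pi fun _ => circularNormal (r⁻¹).toNNReal) (Measure.pi fun _ => expMeasure r) := by
    intro r hr
    have := isProbabilityMeasure_expMeasure hr
    exact measurePreserving_pi _ _ fun _ => measurePreserving_normSq_circularNormal hr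
  have h1 := (hpi hN.lsr_pos).prod ((hpi hN.lrd_pos).prod ((hpi hN.lrp_pos).prod
    ((measurePreserving_normSq_circularNormal hN.lsd_pos).prod
      (measurePreserving_normSq_circularNormal hN.lsp_pos))))
  have hsum : MeasurePreserving (fun v : Fin L → ℝ => ∑ i, v i)
    (Measure.pi fun _ => expMeasure N.lsr) (erlangLaw L N.lsr) := ⟨by fun_prop, rfl⟩
  have h2 := hsum.prod (measurePreserving_prodAssoc
    (Measure.pi fun _ : Fin L => expMeasure N.lrd) (Measure.pi fun _ : Fin L => expMeasure N.lrp)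
    ((expMeasure N.lsd).prod (expMeasure N.lsp))).symm
  have h3 := (MeasurePreserving.id (erlangLaw L N.lsr)).prod
    ((measurePreserving_arrowProdEquivProdArrow ℝ ℝ (Fin L) (fun _ => expMeasure N.lrd)
      (fun _ => expMeasure N.lrp)).symm.prod
      (Measure.measurePreserving_swap (μ := expMeasure N.lsd) (ν := expMeasure N.lsp)))
  have h4 := (measurePreserving_prodAssoc (erlangLaw L N.lsr)
    (Measure.pi fun _ : Fin L => (expMeasure N.lrd).prod (expMeasure N.lrp))
    ((expMeasure N.lsp).prod (expMeasure N.lsd))).symm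
  have h5 := (Measure.measurePreserving_swap (μ := erlangLaw L N.lsr)
    (ν := Measure.pi fun _ : Fin L => (expMeasure N.lrd).prod (expMeasure N.lrp))).prod
    (MeasurePreserving.id ((expMeasure N.lsp).prod (expMeasure N.lsd)))
  have h6 := measurePreserving_prodAssoc
    (Measure.pi fun _ : Fin L => (expMeasure N.lrd).prod (expMeasure N.lrp)) (erlangLaw L N.lsr)
    ((expMeasure N.lsp).prod (expMeasure N.lsd))
  exact h6.comp (h5.comp (h4.comp (h3.comp (h2.comp h1))))

theorem measurePreserving_gains (hN : N.Valid) :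
    MeasurePreserving Channels.gains N.law N.gainsLaw := by
  have := isProbabilityMeasure_expMeasure hN.lrd_pos
  have := isProbabilityMeasure_expMeasure hN.lrp_pos
  have := isProbabilityMeasure_expMeasure hN.lsd_pos
  have := isProbabilityMeasure_expMeasure hN.lsp_pos
  have := isProbabilityMeasure_erlangLaw L hN.lsr_pos
  have : SFinite N.gainsLaw := by unfold gainsLaw; infer_instance
  exact measurePreserving_snd.comp (measurePreserving_allGains hN)

theorem isProbabilityMeasure_gainsLaw (hN : N.Valid) : IsProbabilityMeasure N.gainsLaw := by
  have := isProbabilityMeasure_expMeasure hN.lsd_pos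
  have := isProbabilityMeasure_expMeasure hN.lsp_pos
  have := isProbabilityMeasure_erlangLaw L hN.lsr_pos
  unfold gainsLaw
  infer_instance

instance isProbabilityMeasure_law (N : Network L) : IsProbabilityMeasure N.law := by
  unfold law
  infer_instance

/-- Given the gains of the other links, the antennas of the relay are independent. -/
theorem law_real_forall_antenna (hN : N.Valid) {G : Set ((ℝ × ℝ × ℝ) × (ℝ × ℝ))}
    (hG : MeasurableSet G) {C : Set (ℝ × ℝ × ℝ)} (hC : MeasurableSet C) :
    N.law.real {h | (∀ j, (h.gains, (h.gainRD j, h.gainRP j)) ∈ G) ∧ h.gains ∈ C} =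
      ∫ z in C, ((expMeasure N.lrd).prod (expMeasure N.lrp)).real {w | (z, w) ∈ G} ^ L
        ∂N.gainsLaw := by
  have := isProbabilityMeasure_expMeasure hN.lrd_pos
  have := isProbabilityMeasure_expMeasure hN.lrp_pos
  have := isProbabilityMeasure_gainsLaw hN
  set E : Set ((Fin L → ℝ × ℝ) × (ℝ × ℝ × ℝ)) := {p | (∀ j, (p.2, p.1 j) ∈ G) ∧ p.2 ∈ C} with hE
  have hEm : MeasurableSet E := by
    rw [hE, Set.ofPred_and, Set.ofPred_forall]
    refine MeasurableSet.inter ?_ (hC.preimage measurable_snd)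
    exact MeasurableSet.iInter fun j => hG.preimage
      (f := fun p : (Fin L → ℝ × ℝ) × (ℝ × ℝ × ℝ) => (p.2, p.1 j)) (by fun_prop)
  have h1 := (measurePreserving_allGains hN).measure_preimage hEm.nullMeasurableSet
  rw [Measure.real, show {h : Channels L | (∀ j, (h.gains, (h.gainRD j, h.gainRP j)) ∈ G) ∧
    h.gains ∈ C} = (fun h => ((fun j => (h.gainRD j, h.gainRP j)), h.gains)) ⁻¹' E from rfl, h1, Measure.prod_apply_symm hEm, ← integral_toReal
    (measurable_measure_prodMk_right hEm).aemeasurable (.of_forall fun _ => measure_lt_top _ _),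
    ← integral_indicator hC]
  refine integral_congr_ae (.of_forall fun z => ?_)
  by_cases hz : z ∈ C
  -- For fixed z the event is a cube over the antennas, so its measure is an L-th power.
  · have : (fun x => (x, z)) ⁻¹' E = Set.univ.pi fun _ : Fin L => {w | (z, w) ∈ G} := by
      ext; simp [hE, hz]
    simp only [Set.indicator_of_mem hz]
    rw [this, Measure.pi_pi, Finset.prod_const, ENNReal.toReal_pow, Finset.card_univ,
      Fintype.card_fin]
    rfl
  · have : (fun x => (x, z)) ⁻¹' E = ∅ := by ext; simp [hE, hz]
    simp [hz, this]

end Network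

/-! ### The exponential integral Ei -/

theorem intervalIntegrable_exp_div {x y : ℝ} (hx : 0 < x) (hy : 0 < y) :
    IntervalIntegrable (fun t => Real.exp t / t) volume x y := by
  refine ContinuousOn.intervalIntegrable fun t ht => ?_
  have ht0 : t ≠ 0 := ((lt_min hx hy).trans_le ht.1).ne'
  exact (by fun_prop (disch := assumption) : ContinuousAt _ t).continuousWithinAt

theorem intervalIntegrable_exp_div_of_neg {x y : ℝ} (hx : x < 0) (hy : y < 0) :
    IntervalIntegrable (fun t => Real.exp t / t) volume x y := by
  refine ContinuousOn.intervalIntegrable fun t ht => ?_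
  have ht0 : t ≠ 0 := (ht.2.trans_lt (max_lt hx hy)).ne
  exact (by fun_prop (disch := assumption) : ContinuousAt _ t).continuousWithinAt

theorem integrableOn_exp_div_Iic {x : ℝ} (hx : x < 0) :
    IntegrableOn (fun t => Real.exp t / t) (Set.Iic x) := by
  refine Integrable.mono' ((integrableOn_exp_Iic x).mul_const (|x|⁻¹))
    (by fun_prop : Measurable fun t : ℝ => Real.exp t / t).aestronglyMeasurable ?_
  filter_upwards [ae_restrict_mem measurableSet_Iic] with t ht
  have ht : t ≤ x := ht
  rw [norm_div, Real.norm_eq_abs, Real.norm_eq_abs, Real.abs_exp, div_eq_mul_inv]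
  refine mul_le_mul_of_nonneg_left (inv_anti₀ (abs_pos.2 hx.ne) ?_) (Real.exp_pos _).le
  rw [abs_of_neg hx, abs_of_neg (ht.trans_lt hx)]
  linarith

/-- The principal value defining `Ei` converges. -/
theorem tendsto_expIntegralEi {x : ℝ} (hx : 0 < x) :
    Tendsto (fun ε => (∫ t in Set.Iic (-ε), Real.exp t / t) + ∫ t in ε..x, Real.exp t / t)
      (𝓝[>] 0) (𝓝 (expIntegralEi x)) := by
  refine tendsto_nhds_limUnder ?_
  -- Folding [-1, -ε] onto [ε, 1] turns the singular part into the integral of 2 sinh t / t, whose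
  -- extension to t = 0 by the derivative is continuous. Its integral over [ε, 1] therefore
  -- converges as ε → 0.
  have hk : Continuous (dslope Real.sinh 0) := by
    rw [← continuousOn_univ, continuousOn_dslope Filter.univ_mem]
    exact ⟨Real.continuous_sinh.continuousOn, Real.differentiable_sinh 0⟩
  have hcont : Continuous fun ε => ∫ t in ε..1, 2 * dslope Real.sinh 0 t := by
    have h : Continuous fun ε => ∫ t in (1 : ℝ)..ε, 2 * dslope Real.sinh 0 t :=
      intervalIntegral.continuous_primitive (fun a b => (by fun_prop :
        Continuous fun t => 2 * dslope Real.sinh 0 t).intervalIntegrable a b) 1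
    exact h.neg.congr fun ε => (intervalIntegral.integral_symm _ _).symm
  refine ⟨(∫ t in Set.Iic (-1), Real.exp t / t) + (∫ t in (0 : ℝ)..1, 2 * dslope Real.sinh 0 t) +
    ∫ t in (1 : ℝ)..x, Real.exp t / t, ?_⟩
  refine (((hcont.tendsto 0).mono_left nhdsWithin_le_nhds).const_add _ |>.add_const _).congr' ?_
  filter_upwards [Ioo_mem_nhdsGT (zero_lt_one' ℝ)] with ε hε
  have h1 := intervalIntegral.integral_Iic_sub_Iic
    (integrableOn_exp_div_Iic (x := -1) (by norm_num))
    (integrableOn_exp_div_Iic (x := -ε) (by linarith [hε.1]))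
  have h2 := intervalIntegral.integral_add_adjacent_intervals
    (intervalIntegrable_exp_div hε.1 one_pos) (intervalIntegrable_exp_div one_pos hx)
  have h3 : ∫ t in (-1 : ℝ)..(-ε), Real.exp t / t = ∫ t in ε..1, -(Real.exp (-t) / t) := by
    rw [← intervalIntegral.integral_comp_neg (fun t => Real.exp t / t)]
    simp [div_neg]
  have h4 : ∫ t in ε..1, 2 * dslope Real.sinh 0 t =
      (∫ t in ε..1, -(Real.exp (-t) / t)) + ∫ t in ε..1, Real.exp t / t := by
    rw [← intervalIntegral.integral_add _ (intervalIntegrable_exp_div hε.1 one_pos)]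
    · refine intervalIntegral.integral_congr fun t ht => ?_
      rw [Set.uIcc_of_le hε.2.le] at ht
      have ht0 : t ≠ 0 := (hε.1.trans_le ht.1).ne'
      simp only [dslope_of_ne _ ht0, slope_def_field, Real.sinh_zero, sub_zero]
      rw [Real.sinh_eq]
      field_simp
      ring
    · have := (intervalIntegrable_exp_div_of_neg (x := -ε) (y := -1) (by linarith [hε.1])
        (by norm_num)).comp_sub_left 0
      simpa [div_neg] using this
  linarith

/-- The part around the singularity is the same for both arguments and cancels for every ε > 0. -/
theorem expIntegralEi_sub {x y : ℝ} (hx : 0 < x) (hy : 0 < y) :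
    expIntegralEi x - expIntegralEi y = ∫ t in y..x, Real.exp t / t := by
  refine tendsto_nhds_unique ((tendsto_expIntegralEi hx).sub (tendsto_expIntegralEi hy)) ?_
  refine tendsto_const_nhds.congr' ?_
  filter_upwards [self_mem_nhdsWithin] with ε hε
  have := intervalIntegral.integral_add_adjacent_intervals
    (intervalIntegrable_exp_div hε hy) (intervalIntegrable_exp_div hy hx)
  linarith

theorem intervalIntegrable_exp_mul_div_pow {δ u v : ℝ} (n : ℕ) (hu : 0 < u) (hv : 0 < v) :
    IntervalIntegrable (fun B => Real.exp (δ * B) / B ^ n) volume u v := by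
  refine ContinuousOn.intervalIntegrable fun t ht => ?_
  have ht0 : t ^ n ≠ 0 := pow_ne_zero _ ((lt_min hu hv).trans_le ht.1).ne'
  exact (by fun_prop (disch := assumption) : ContinuousAt _ t).continuousWithinAt

/-- Integration by parts with -e^{δB}/B^{n+1} lowers the power of B by one, at the price of one
boundary term and a factor δ. The recursion ends at ∫ e^{δB}/B dB, a difference of Ei after scaling.
-/
theorem integral_exp_mul_div_pow {δ u v : ℝ} (n : ℕ) (hδ : 0 < δ) (hu : 0 < u) (hv : 0 < v) :
    n.factorial * ∫ B in u..v, Real.exp (δ * B) / B ^ (n + 1) =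
      (∑ k ∈ Finset.range n, ((n - 1 - k).factorial : ℝ) * δ ^ k *
        (Real.exp (δ * u) / u ^ (n - k) - Real.exp (δ * v) / v ^ (n - k))) +
      δ ^ n * (expIntegralEi (δ * v) - expIntegralEi (δ * u)) := by
  induction n with
  | zero =>
    rw [expIntegralEi_sub (by positivity) (by positivity),
      ← intervalIntegral.smul_integral_comp_mul_left, ← intervalIntegral.integral_smul]
    simp only [Nat.factorial_zero, Nat.cast_one, one_mul, zero_add, pow_one, Finset.range_zero,
      Finset.sum_empty, pow_zero, smul_eq_mul]
    refine intervalIntegral.integral_congr fun t _ => ?_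
    rw [← mul_div_assoc, mul_div_mul_left _ _ hδ.ne']
  | succ n ih =>
    have hpos : ∀ t ∈ Set.uIcc u v, 0 < t := fun t ht => (lt_min hu hv).trans_le ht.1
    have hd : ∀ t ∈ Set.uIcc u v, HasDerivAt (fun B => -(Real.exp (δ * B) / B ^ (n + 1)))
        ((n + 1) * (Real.exp (δ * t) / t ^ (n + 2)) - δ * (Real.exp (δ * t) / t ^ (n + 1))) t := by
      intro t ht
      have ht0 := (hpos t ht).ne'
      have h1 : HasDerivAt (fun B => Real.exp (δ * B)) (Real.exp (δ * t) * (δ * 1)) t :=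
        ((hasDerivAt_id t).const_mul δ).exp
      refine (h1.div (hasDerivAt_pow (n + 1) t) (pow_ne_zero _ ht0)).neg.congr_deriv ?_
      push_cast [Nat.add_sub_cancel]
      field_simp
      ring
    have hint1 := (intervalIntegrable_exp_mul_div_pow (δ := δ) (n + 2) hu hv).const_mul
      ((n : ℝ) + 1)
    have hint2 := (intervalIntegrable_exp_mul_div_pow (δ := δ) (n + 1) hu hv).const_mul δ
    have h := intervalIntegral.integral_eq_sub_of_hasDerivAt hd (hint1.sub hint2)
    rw [intervalIntegral.integral_sub hint1 hint2, intervalIntegral.integral_const_mul,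
      intervalIntegral.integral_const_mul] at h
    -- The term k = 0 is the new boundary term; the terms k + 1 are δ times the sum of the induction
    -- hypothesis.
    rw [Finset.sum_range_succ']
    have hs : ∀ k ∈ Finset.range n, ((n + 1 - 1 - (k + 1)).factorial : ℝ) * δ ^ (k + 1) *
        (Real.exp (δ * u) / u ^ (n + 1 - (k + 1)) - Real.exp (δ * v) / v ^ (n + 1 - (k + 1))) =
        δ * (((n - 1 - k).factorial : ℝ) * δ ^ k *
        (Real.exp (δ * u) / u ^ (n - k) - Real.exp (δ * v) / v ^ (n - k))) := by
      intro k hk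
      rw [Nat.add_sub_add_right n 1 k, show n + 1 - 1 - (k + 1) = n - 1 - k by omega]
      ring
    rw [Finset.sum_congr rfl hs, ← Finset.mul_sum, Nat.factorial_succ]
    push_cast
    simp only [Nat.sub_zero, pow_zero]
    linear_combination (n.factorial : ℝ) * h + δ * ih

/-! ### Integrals against the Erlang law -/

/-- Source of E_L: since 1/(s+z) = ∫_0^∞ e^{-(s+z)t} dt, Fubini leaves e^{-zt} times the Laplace
transform (r/(r+τ+t))^L. Shifting by r+τ and scaling by it maps (0, ∞) onto (1, ∞). -/
theorem integral_erlangLaw_exp_neg_div_add {L : ℕ} (hL : 1 ≤ L) {r z τ : ℝ} (hr : 0 < r)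
    (hz : 0 < z) (hτ : 0 ≤ τ) :
    ∫ s, Real.exp (-(τ * s)) / (s + z) ∂(erlangLaw L r) =
      r * (r / (r + τ)) ^ (L - 1) * Real.exp (z * (r + τ)) * genExpIntegral L (z * (r + τ)) := by
  have := isProbabilityMeasure_erlangLaw L hr
  have hB : 0 < r + τ := by positivity
  have h1 : ∀ᵐ s ∂(erlangLaw L r), Real.exp (-(τ * s)) / (s + z) =
      ∫ t in Set.Ioi 0, Real.exp (-(τ * s)) * Real.exp (-(s + z) * t) := by
    filter_upwards [erlangLaw_ae_pos hL hr] with s hs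
    rw [integral_const_mul, integral_exp_mul_Ioi (by linarith), mul_zero, Real.exp_zero,
      neg_div_neg_eq, mul_one_div]
  have hint : Integrable (Function.uncurry fun s t : ℝ =>
      Real.exp (-(τ * s)) * Real.exp (-(s + z) * t))
      ((erlangLaw L r).prod (volume.restrict (Set.Ioi 0))) := by
    have hexp : Integrable (fun t => Real.exp (-z * t)) (volume.restrict (Set.Ioi 0)) :=
      exp_neg_integrableOn_Ioi 0 hz
    refine Integrable.mono' (hexp.comp_snd (erlangLaw L r)) (by fun_prop) ?_
    have hp : ∀ᵐ p ∂((erlangLaw L r).prod (volume.restrict (Set.Ioi (0 : ℝ)))),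
        0 < p.1 ∧ 0 < p.2 :=
      (Measure.quasiMeasurePreserving_fst.ae (erlangLaw_ae_pos hL hr)).and
        (Measure.quasiMeasurePreserving_snd.ae (ae_restrict_mem measurableSet_Ioi))
    filter_upwards [hp] with p hp
    rw [Function.uncurry, Real.norm_eq_abs, abs_of_pos (by positivity), ← Real.exp_add,
      Real.exp_le_exp]
    nlinarith [mul_pos hp.1 hp.2, mul_nonneg hτ hp.1.le]
  rw [integral_congr_ae h1, integral_integral_swap hint]
  have h2 : ∀ t ∈ Set.Ioi (0 : ℝ), ∫ s, Real.exp (-(τ * s)) * Real.exp (-(s + z) * t) ∂(erlangLaw L r)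
      = Real.exp (-(z * t)) * (r / (r + τ + t)) ^ L := by
    intro t ht
    have ht : 0 < t := ht
    have : ∀ s, Real.exp (-(τ * s)) * Real.exp (-(s + z) * t) =
        Real.exp (-(z * t)) * Real.exp (-((τ + t) * s)) := fun s => by
      rw [← Real.exp_add, ← Real.exp_add]; ring_nf
    simp_rw [this]
    rw [integral_const_mul, laplace_erlangLaw L hr (by positivity), add_assoc]
  rw [setIntegral_congr_fun measurableSet_Ioi h2, genExpIntegral]
  have h3 := integral_comp_mul_left_Ioi (fun t => Real.exp (-(z * (t - (r + τ)))) * (r / t) ^ L) 1 hB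
  have h4 : ∫ t in Set.Ioi 0, Real.exp (-(z * t)) * (r / (r + τ + t)) ^ L =
      ∫ t in Set.Ioi (r + τ), Real.exp (-(z * (t - (r + τ)))) * (r / t) ^ L := by
    have := (measurePreserving_add_left volume (r + τ)).setIntegral_preimage_emb
      (measurableEmbedding_addLeft _)
      (fun t => Real.exp (-(z * (t - (r + τ)))) * (r / t) ^ L) (Set.Ioi (r + τ))
    simpa using this
  rw [mul_one, smul_eq_mul, eq_inv_mul_iff_mul_eq₀ hB.ne'] at h3
  rw [h4, ← h3, ← integral_const_mul, ← integral_const_mul]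
  refine setIntegral_congr_fun measurableSet_Ioi fun t ht => ?_
  have ht : (1 : ℝ) < t := ht
  obtain ⟨n, rfl⟩ : ∃ n, L = n + 1 := ⟨L - 1, by omega⟩
  have he : Real.exp (-(z * ((r + τ) * t - (r + τ)))) =
      Real.exp (z * (r + τ)) * Real.exp (-(z * (r + τ)) * t) := by
    rw [← Real.exp_add]; ring_nf
  simp only [Nat.add_sub_cancel, he, div_pow, mul_pow]
  field_simp
  ring

theorem integrable_erlangLaw_prod_exp {L : ℕ} (hL : 1 ≤ L) {r δ u v : ℝ} (hr : 0 < r)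
    (hu : 0 ≤ u) :
    Integrable (Function.uncurry fun s τ : ℝ => Real.exp (-(τ * (s - δ))))
      ((erlangLaw L r).prod (volume.restrict (Set.Ioc u v))) := by
  have := isProbabilityMeasure_erlangLaw L hr
  refine Integrable.mono' (integrable_const (Real.exp (v * |δ|))) (by fun_prop) ?_
  have hp : ∀ᵐ p ∂((erlangLaw L r).prod (volume.restrict (Set.Ioc u v))),
      0 < p.1 ∧ p.2 ∈ Set.Ioc u v :=
    (Measure.quasiMeasurePreserving_fst.ae (erlangLaw_ae_pos hL hr)).and
      (Measure.quasiMeasurePreserving_snd.ae (ae_restrict_mem measurableSet_Ioc))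
  filter_upwards [hp] with p hp
  rw [Function.uncurry, Real.norm_eq_abs, abs_of_pos (by positivity), Real.exp_le_exp]
  have h0 : 0 < p.2 := hu.trans_lt hp.2.1
  nlinarith [mul_pos hp.1 h0, abs_nonneg δ,
    mul_le_mul_of_nonneg_left (le_abs_self δ) h0.le,
    mul_le_mul_of_nonneg_right hp.2.2 (abs_nonneg δ)]

theorem integrable_erlangLaw_intervalIntegral {L : ℕ} (hL : 1 ≤ L) {r δ u v : ℝ} (hr : 0 < r)
    (hu : 0 ≤ u) (huv : u ≤ v) :
    Integrable (fun s => ∫ τ in u..v, Real.exp (-(τ * (s - δ)))) (erlangLaw L r) := by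
  simp_rw [intervalIntegral.integral_of_le huv]
  exact (integrable_erlangLaw_prod_exp hL hr hu).integral_prod_left

/-- Source of the Ei part: Fubini produces (r/(r+τ))^L under the τ-integral, and B = r + τ is the
new variable. -/
theorem integral_erlangLaw_intervalIntegral {L : ℕ} (hL : 1 ≤ L) {r δ u v : ℝ} (hr : 0 < r)
    (hu : 0 ≤ u) (huv : u ≤ v) :
    ∫ s, (∫ τ in u..v, Real.exp (-(τ * (s - δ)))) ∂(erlangLaw L r) =
      r ^ L * Real.exp (-(δ * r)) *
        ∫ B in (r + u)..(r + v), Real.exp (δ * B) / B ^ L := by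
  have := isProbabilityMeasure_erlangLaw L hr
  simp_rw [intervalIntegral.integral_of_le huv]
  rw [integral_integral_swap (integrable_erlangLaw_prod_exp hL hr hu), ← intervalIntegral.integral_of_le huv,
    ← intervalIntegral.integral_const_mul]
  have h1 := intervalIntegral.integral_comp_add_left
    (fun B => r ^ L * Real.exp (-(δ * r)) * (Real.exp (δ * B) / B ^ L)) r (a := u) (b := v)
  rw [← h1, intervalIntegral.integral_of_le huv, intervalIntegral.integral_of_le huv]
  refine setIntegral_congr_fun measurableSet_Ioc fun τ hτ => ?_
  have h0 : 0 < τ := hu.trans_lt hτ.1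
  have : ∀ s, Real.exp (-(τ * (s - δ))) = Real.exp (δ * τ) * Real.exp (-(τ * s)) := fun s => by
    rw [← Real.exp_add]; ring_nf
  simp_rw [this]
  rw [integral_const_mul, laplace_erlangLaw L hr h0.le, mul_add, Real.exp_add, Real.exp_neg,
    div_pow]
  field_simp

theorem integral_erlangLaw_one_sub_exp {L : ℕ} {r κ p g : ℝ} (hr : 0 < r)
    (hκ : 0 ≤ κ) (hg : 0 ≤ g) :
    ∫ s, (1 - Real.exp (-((κ * s + p) * g))) ∂(erlangLaw L r) =
      1 - Real.exp (-(g * p)) * (r / (r + g * κ)) ^ L := by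
  have := isProbabilityMeasure_erlangLaw L hr
  have h : ∀ s, Real.exp (-((κ * s + p) * g)) =
      Real.exp (-(g * p)) * Real.exp (-(g * κ * s)) := fun s => by
    rw [← Real.exp_add]; ring_nf
  simp_rw [h]
  -- Integrability follows from the value of the Laplace transform: a non-integrable function would
  -- have integral 0 by convention, but the transform is positive.
  by_cases hi : Integrable (fun s => Real.exp (-(g * κ * s))) (erlangLaw L r)
  · rw [integral_sub (integrable_const _) (hi.const_mul _), integral_const_mul,
      laplace_erlangLaw L hr (by positivity)]
    simp
  · have h0 := laplace_erlangLaw L hr (τ := g * κ) (by positivity)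
    rw [integral_undef hi] at h0
    exact absurd h0 (by positivity)

theorem integrable_erlangLaw_one_sub_exp {L : ℕ} (hL : 1 ≤ L) {r κ p g : ℝ} (hr : 0 < r)
    (hκ : 0 ≤ κ) (hp : 0 ≤ p) (hg : 0 ≤ g) :
    Integrable (fun s => 1 - Real.exp (-((κ * s + p) * g))) (erlangLaw L r) := by
  have := isProbabilityMeasure_erlangLaw L hr
  refine Integrable.mono' (integrable_const 1) (by fun_prop) ?_
  filter_upwards [erlangLaw_ae_pos hL hr] with s hs
  have : Real.exp (-((κ * s + p) * g)) ≤ 1 := Real.exp_le_one_iff.2 (by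
    have : 0 ≤ (κ * s + p) * g := by positivity
    linarith)
  rw [Real.norm_eq_abs, abs_of_nonneg (by linarith)]
  linarith [Real.exp_pos (-((κ * s + p) * g))]

/-- The inequality 1 - e^{-xg} ≤ xg bounds the quotient by g, even for p = 0, where the denominator
is not bounded away from 0. -/
theorem integrable_erlangLaw_one_sub_exp_div {L : ℕ} (hL : 1 ≤ L) {r κ p g : ℝ} (hr : 0 < r)
    (hκ : 0 < κ) (hp : 0 ≤ p) (hg : 0 ≤ g) :
    Integrable (fun s => (1 - Real.exp (-((κ * s + p) * g))) / (κ * s + p)) (erlangLaw L r) := by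
  have := isProbabilityMeasure_erlangLaw L hr
  refine Integrable.mono' (integrable_const g) (Measurable.aestronglyMeasurable (by fun_prop)) ?_
  filter_upwards [erlangLaw_ae_pos hL hr] with s hs
  have h0 : 0 < κ * s + p := by positivity
  have h1 : Real.exp (-((κ * s + p) * g)) ≤ 1 := Real.exp_le_one_iff.2 (by
    have : 0 ≤ (κ * s + p) * g := by positivity
    linarith)
  rw [Real.norm_eq_abs, abs_of_nonneg (div_nonneg (by linarith) h0.le), div_le_iff₀ h0]
  linarith [Real.add_one_le_exp (-((κ * s + p) * g))]

theorem integrable_erlangLaw_exp_neg_div_add {L : ℕ} (hL : 1 ≤ L) {r z τ : ℝ} (hr : 0 < r)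
    (hz : 0 < z) (hτ : 0 ≤ τ) :
    Integrable (fun s => Real.exp (-(τ * s)) / (s + z)) (erlangLaw L r) := by
  have := isProbabilityMeasure_erlangLaw L hr
  refine Integrable.mono' (integrable_const (1 / z)) (Measurable.aestronglyMeasurable
    (by fun_prop)) ?_
  filter_upwards [erlangLaw_ae_pos hL hr] with s hs
  rw [Real.norm_eq_abs, abs_of_pos (by positivity)]
  have : Real.exp (-(τ * s)) ≤ 1 := Real.exp_le_one_iff.2 (by
    have : 0 ≤ τ * s := by positivity
    linarith)
  gcongr
  linarith

/-- For p > 0 the two halves of the numerator are integrable separately; they are the cases τ = 0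
and τ = gκ of `integral_erlangLaw_exp_neg_div_add`. The factor e^{-gp} of the second half cancels
against its larger exponential prefactor. -/
theorem integral_erlangLaw_one_sub_exp_div {L : ℕ} (hL : 1 ≤ L) {r κ p g : ℝ} (hr : 0 < r)
    (hκ : 0 < κ) (hp : 0 < p) (hg : 0 ≤ g) :
    ∫ s, (1 - Real.exp (-((κ * s + p) * g))) / (κ * s + p) ∂(erlangLaw L r) =
      r / κ * Real.exp (p / κ * r) * (genExpIntegral L (p / κ * r) -
        (r / (r + g * κ)) ^ (L - 1) * genExpIntegral L (p / κ * (r + g * κ))) := by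
  have hz : 0 < p / κ := by positivity
  have h : ∀ᵐ s ∂(erlangLaw L r), (1 - Real.exp (-((κ * s + p) * g))) / (κ * s + p) =
      κ⁻¹ * (Real.exp (-(0 * s)) / (s + p / κ)) -
        κ⁻¹ * Real.exp (-(g * p)) * (Real.exp (-(g * κ * s)) / (s + p / κ)) := by
    filter_upwards [erlangLaw_ae_pos hL hr] with s hs
    have h1 : Real.exp (-((κ * s + p) * g)) =
        Real.exp (-(g * p)) * Real.exp (-(g * κ * s)) := by
      rw [← Real.exp_add]; ring_nf
    have h2 : κ * s + p = κ * (s + p / κ) := by field_simp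
    rw [h1, h2, zero_mul, neg_zero, Real.exp_zero]
    field_simp
  rw [integral_congr_ae h, integral_sub
    ((integrable_erlangLaw_exp_neg_div_add hL hr hz le_rfl).const_mul _)
    ((integrable_erlangLaw_exp_neg_div_add hL hr hz (by positivity)).const_mul _),
    integral_const_mul, integral_const_mul,
    integral_erlangLaw_exp_neg_div_add hL hr hz le_rfl,
    integral_erlangLaw_exp_neg_div_add hL hr hz (by positivity)]
  have h3 : Real.exp (p / κ * (r + g * κ)) = Real.exp (g * p) * Real.exp (p / κ * r) := by
    rw [← Real.exp_add]
    congr 1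
    field_simp
    ring
  rw [h3, Real.exp_neg, add_zero, div_self hr.ne', one_pow]
  field_simp

/-! ### Truncated exponential integrals and partial fractions -/

/-- Keeping κ as a factor avoids division, so κ may have any sign; it is applied with multiples of s
- δ. -/
theorem mul_integral_exp_neg_mul (κ x : ℝ) :
    κ * ∫ t in (0 : ℝ)..x, Real.exp (-(κ * t)) = 1 - Real.exp (-(κ * x)) := by
  have hd : ∀ t ∈ Set.uIcc 0 x, HasDerivAt (fun t => -Real.exp (-(κ * t)))
      (κ * Real.exp (-(κ * t))) t := fun t _ => by
    have := ((hasDerivAt_id t).const_mul κ).neg.exp.neg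
    exact this.congr_deriv (by simp; ring)
  rw [← intervalIntegral.integral_const_mul, intervalIntegral.integral_eq_sub_of_hasDerivAt hd
    ((by fun_prop : Continuous fun t => κ * Real.exp (-(κ * t))).intervalIntegrable _ _)]
  simp
  ring

theorem setIntegral_expMeasure_Iic {r x : ℝ} (hr : 0 < r) (hx : 0 ≤ x) (f : ℝ → ℝ) :
    ∫ t in Set.Iic x, f t ∂(expMeasure r) = ∫ t in (0 : ℝ)..x, r * Real.exp (-(r * t)) * f t := by
  rw [← integral_indicator measurableSet_Iic, integral_expMeasure hr,
    intervalIntegral.integral_of_le hx, ← Set.Ioi_inter_Iic,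
    ← setIntegral_indicator measurableSet_Iic]
  refine integral_congr_ae (.of_forall fun t => ?_)
  by_cases ht : t ∈ Set.Iic x <;> simp [ht, Set.indicator]

theorem setIntegral_expMeasure_Iio {r x : ℝ} (hr : 0 < r) (hx : 0 ≤ x) (f : ℝ → ℝ) :
    ∫ t in Set.Iio x, f t ∂(expMeasure r) = ∫ t in (0 : ℝ)..x, r * Real.exp (-(r * t)) * f t := by
  rw [← setIntegral_expMeasure_Iic hr hx, setIntegral_congr_set Iio_ae_eq_Iic]

/-- Truncated Laplace transform of the exponential law. -/
theorem setIntegral_expMeasure_exp {r κ x : ℝ} (hr : 0 < r) (hκ : 0 ≤ κ) (hx : 0 ≤ x) :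
    ∫ t in Set.Iic x, Real.exp (-(κ * t)) ∂(expMeasure r) =
      r / (r + κ) * (1 - Real.exp (-((r + κ) * x))) := by
  rw [setIntegral_expMeasure_Iic hr hx, ← mul_integral_exp_neg_mul, ← mul_assoc,
    div_mul_cancel₀ _ (by positivity), ← intervalIntegral.integral_const_mul]
  refine intervalIntegral.integral_congr fun t _ => ?_
  simp only [mul_assoc]
  rw [← Real.exp_add]
  ring_nf

/-- The left side is what remains after integrating a kernel over X and Y at S = s. Because q = c +
α, both fractions have the same residue αδ²/(p+qδ) at s = δ, so over s - δ only the difference E₂ -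
E₁ survives. -/
theorem partialFraction_identity {α q c p δ s E₁ E₂ : ℝ} (hα : 0 < α) (hc : 0 < c) (hq : q = c + α)
    (hp : 0 ≤ p) (hδ : 0 ≤ δ) (hs : 0 < s) (hsδ : s ≠ δ) :
    s / (s - δ) * (α * s / (α * s + (p + c * δ)) * (1 - E₁) - α * s / (q * s + p) * (1 - E₂)) =
      (1 - E₁) - (p + c * δ) ^ 2 / (p + q * δ) * ((1 - E₁) / (α * s + (p + c * δ)))
        - α / q * (1 - E₂) + α * p ^ 2 / (q * (p + q * δ)) * ((1 - E₂) / (q * s + p))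
        + α * δ ^ 2 / (p + q * δ) * ((E₂ - E₁) / (s - δ)) := by
  have hqp : 0 < q := by linarith
  have hsd : s - δ ≠ 0 := sub_ne_zero.2 hsδ
  have h1 : α * s + (p + c * δ) ≠ 0 := by positivity
  have h2 : q * s + p ≠ 0 := by positivity
  -- The denominator p + qδ vanishes only for p = δ = 0, and then every term divided by it is 0 by
  -- the convention for division by zero.
  rcases (show 0 ≤ p + q * δ by positivity).eq_or_lt with hD | hD
  · have hp0 : p = 0 := by nlinarith [mul_nonneg hqp.le hδ]
    have hδ0 : δ = 0 := by
      rcases mul_eq_zero.1 (show q * δ = 0 by linarith) with h | h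
      · exact absurd h hqp.ne'
      · exact h
    subst hp0 hδ0
    simp
    field_simp
  · obtain ⟨D, hDq⟩ : ∃ D, D = p + q * δ := ⟨_, rfl⟩
    rw [← hDq] at hD ⊢
    have hD' := hD.ne'
    have e1 : α * s ^ 2 / ((s - δ) * (α * s + (p + c * δ))) =
        1 - (p + c * δ) ^ 2 / D / (α * s + (p + c * δ)) +
          α * δ ^ 2 / D / (s - δ) := by
      field_simp
      rw [hDq, hq]
      ring
    have e2 : α * s ^ 2 / ((s - δ) * (q * s + p)) =
        α / q - α * p ^ 2 / (q * D) / (q * s + p) +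
          α * δ ^ 2 / D / (s - δ) := by
      field_simp
      rw [hDq]
      ring
    have e3 : s / (s - δ) * (α * s / (α * s + (p + c * δ)) * (1 - E₁) -
        α * s / (q * s + p) * (1 - E₂)) =
        α * s ^ 2 / ((s - δ) * (α * s + (p + c * δ))) * (1 - E₁) -
          α * s ^ 2 / ((s - δ) * (q * s + p)) * (1 - E₂) := by
      field_simp
    rw [e3, e1, e2]
    ring

/-- At s = δ both exponents equal -g(p+qδ), so after this factor is taken out the divided difference
is an integral of exponentials in s. This removes the apparent pole and prepares for the Laplace
transform. -/
theorem exp_sub_exp_div_eq_integral {α q p c δ s g : ℝ} (hq : q = c + α) (hsδ : s ≠ δ) :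
    (Real.exp (-((q * s + p) * g)) - Real.exp (-((α * s + (p + c * δ)) * g))) / (s - δ) =
      -Real.exp (-(g * (p + q * δ))) * ∫ τ in (g * α)..(g * q), Real.exp (-(τ * (s - δ))) := by
  have hsd : s - δ ≠ 0 := sub_ne_zero.2 hsδ
  have h := mul_integral_exp_neg_mul (s - δ)
  have hi : ∀ u v, IntervalIntegrable (fun τ => Real.exp (-(τ * (s - δ)))) volume u v := fun u v =>
    (by fun_prop : Continuous fun τ => Real.exp (-(τ * (s - δ)))).intervalIntegrable _ _
  rw [← intervalIntegral.integral_interval_sub_left (hi 0 _) (hi 0 _)]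
  simp only [mul_comm (s - δ)] at h
  have h1 := h (g * q)
  have h2 := h (g * α)
  have e1 : Real.exp (-((q * s + p) * g)) =
      Real.exp (-(g * (p + q * δ))) * Real.exp (-(g * q * (s - δ))) := by
    rw [← Real.exp_add]; ring_nf
  have e2 : Real.exp (-((α * s + (p + c * δ)) * g)) =
      Real.exp (-(g * (p + q * δ))) * Real.exp (-(g * α * (s - δ))) := by
    rw [← Real.exp_add, hq]; ring_nf
  rw [e1, e2, div_eq_iff hsd]
  linear_combination (Real.exp (-(g * (p + q * δ)))) * (h1 - h2)

/-! ### Truncated expectations of the exponential kernel -/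

namespace Network
variable {L : ℕ} {N : Network L}

theorem gammaTh_pos (hN : N.Valid) : 0 < N.gammaTh :=
  sub_pos.2 (Real.one_lt_rpow one_lt_two (mul_pos two_pos hN.Rs_pos))

theorem psi_pos (hN : N.Valid) : 0 < N.psi :=
  div_pos (gammaTh_pos hN) (div_pos hN.Itemp_pos hN.No_pos)

theorem c_pos (hN : N.Valid) : 0 < N.c := mul_pos (psi_pos hN) hN.lsd_pos

theorem g_pos (hN : N.Valid) : 0 < N.g := div_pos hN.xi_pos (psi_pos hN)

theorem a_pos (hN : N.Valid) : 0 < N.a := div_pos hN.lrp_pos hN.beta_pos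

theorem d_pos (hN : N.Valid) : 0 < N.d := div_pos hN.lrd_pos (mul_pos hN.beta_pos hN.lsd_pos)

theorem B1_pos (hN : N.Valid) : 0 < N.B1 :=
  add_pos hN.lsr_pos (mul_pos (g_pos hN) (add_pos (c_pos hN) hN.lsp_pos))

theorem B2_pos (hN : N.Valid) : 0 < N.B2 :=
  add_pos hN.lsr_pos (mul_pos (g_pos hN) hN.lsp_pos)

/-- With p = aj and δ = di this turns p + cδ into A_ij and p + (c + λ_sp)δ into D_ij. -/
theorem b_eq (hN : N.Valid) : N.b = N.c * N.d := by
  have := hN.lsd_pos.ne'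
  have := hN.beta_pos.ne'
  simp only [b, c, d]
  field_simp

/-- The gains for which the relay decodes. -/
def relaySet (N : Network L) : Set (ℝ × ℝ × ℝ) := {z | z.2.1 ≤ N.g * z.1}

/-- The gains for which the direct link is in outage. -/
def directSet (N : Network L) : Set (ℝ × ℝ × ℝ) := {z | z.2.2 < N.psi * z.2.1}

/-- The gains for which the relay decodes and the direct link is in outage. -/
def decodeSet (N : Network L) : Set (ℝ × ℝ × ℝ) := N.relaySet ∩ N.directSet

theorem measurableSet_relaySet : MeasurableSet N.relaySet :=
  measurableSet_le (by fun_prop) (by fun_prop)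

theorem measurableSet_directSet : MeasurableSet N.directSet :=
  measurableSet_lt (by fun_prop) (by fun_prop)

theorem measurableSet_decodeSet : MeasurableSet N.decodeSet :=
  measurableSet_relaySet.inter measurableSet_directSet

theorem gainsLaw_ae_pos (hN : N.Valid) :
    ∀ᵐ z ∂N.gainsLaw, 0 < z.1 ∧ 0 < z.2.1 ∧ 0 < z.2.2 := by
  have := isProbabilityMeasure_expMeasure hN.lsd_pos
  have := isProbabilityMeasure_expMeasure hN.lsp_pos
  have := isProbabilityMeasure_erlangLaw L hN.lsr_pos
  have h1 := (Measure.quasiMeasurePreserving_fst (μ := erlangLaw L N.lsr)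
    (ν := (expMeasure N.lsp).prod (expMeasure N.lsd))).ae (erlangLaw_ae_pos hN.one_le_L hN.lsr_pos)
  have h2 := Measure.quasiMeasurePreserving_snd (μ := erlangLaw L N.lsr)
    (ν := (expMeasure N.lsp).prod (expMeasure N.lsd))
  have h3 := h2.ae (Measure.quasiMeasurePreserving_fst.ae (expMeasure_ae_pos N.lsp))
  have h4 := h2.ae (Measure.quasiMeasurePreserving_snd.ae (expMeasure_ae_pos N.lsd))
  exact h1.and (h3.and h4)

theorem integral_gainsLaw (hN : N.Valid) {f : ℝ × ℝ × ℝ → ℝ} (hf : Integrable f N.gainsLaw) :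
    ∫ z, f z ∂N.gainsLaw =
      ∫ s, ∫ x, ∫ y, f (s, x, y) ∂(expMeasure N.lsd) ∂(expMeasure N.lsp) ∂(erlangLaw L N.lsr) := by
  have := isProbabilityMeasure_expMeasure hN.lsd_pos
  have := isProbabilityMeasure_expMeasure hN.lsp_pos
  have := isProbabilityMeasure_erlangLaw L hN.lsr_pos
  rw [gainsLaw, integral_prod _ hf]
  refine integral_congr_ae ?_
  filter_upwards [hf.prod_right_ae] with s hs
  exact integral_prod _ hs

theorem setIntegral_decodeSet (hN : N.Valid) {f : ℝ × ℝ × ℝ → ℝ}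
    (hf : IntegrableOn f N.decodeSet N.gainsLaw) :
    ∫ z in N.decodeSet, f z ∂N.gainsLaw =
      ∫ s, ∫ x in Set.Iic (N.g * s), ∫ y in Set.Iio (N.psi * x), f (s, x, y)
        ∂(expMeasure N.lsd) ∂(expMeasure N.lsp) ∂(erlangLaw L N.lsr) := by
  rw [← integral_indicator measurableSet_decodeSet,
    integral_gainsLaw hN (hf.integrable_indicator measurableSet_decodeSet)]
  congr 1 with s
  rw [← integral_indicator measurableSet_Iic]
  congr 1 with x
  by_cases hx : x ≤ N.g * s
  · rw [Set.indicator_of_mem (by exact hx), ← integral_indicator measurableSet_Iio]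
    congr 1 with y
    by_cases hy : y < N.psi * x <;>
      simp [Set.indicator, decodeSet, relaySet, directSet, hx, hy]
  · rw [Set.indicator_of_notMem (by exact hx)]
    simp [Set.indicator, decodeSet, relaySet, hx]

theorem setIntegral_directSet (hN : N.Valid) {f : ℝ × ℝ → ℝ}
    (hf : IntegrableOn (fun z => f z.2) N.directSet N.gainsLaw) :
    ∫ z in N.directSet, f z.2 ∂N.gainsLaw =
      ∫ x, ∫ y in Set.Iio (N.psi * x), f (x, y) ∂(expMeasure N.lsd) ∂(expMeasure N.lsp) := by
  have := isProbabilityMeasure_erlangLaw L hN.lsr_pos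
  rw [← integral_indicator measurableSet_directSet,
    integral_gainsLaw hN (hf.integrable_indicator measurableSet_directSet)]
  have h : ∀ s x, ∫ y, N.directSet.indicator (fun z => f z.2) (s, x, y) ∂(expMeasure N.lsd) =
      ∫ y in Set.Iio (N.psi * x), f (x, y) ∂(expMeasure N.lsd) := fun s x => by
    rw [← integral_indicator measurableSet_Iio]
    congr 1 with y
  simp_rw [h]
  simp

theorem setIntegral_relaySet (hN : N.Valid) {f : ℝ × ℝ → ℝ}
    (hf : IntegrableOn (fun z => f (z.1, z.2.1)) N.relaySet N.gainsLaw) :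
    ∫ z in N.relaySet, f (z.1, z.2.1) ∂N.gainsLaw =
      ∫ s, ∫ x in Set.Iic (N.g * s), f (s, x) ∂(expMeasure N.lsp) ∂(erlangLaw L N.lsr) := by
  have := isProbabilityMeasure_expMeasure hN.lsd_pos
  rw [← integral_indicator measurableSet_relaySet,
    integral_gainsLaw hN (hf.integrable_indicator measurableSet_relaySet)]
  congr 1 with s
  rw [← integral_indicator measurableSet_Iic]
  congr 1 with x
  by_cases hx : x ≤ N.g * s <;> simp [Set.indicator, relaySet, hx]

/-- The exponential factors of the `(i, j)` term as a function of the gains. -/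
def kernel (N : Network L) (p q : ℝ) (z : ℝ × ℝ × ℝ) : ℝ :=
  Real.exp (-(p * z.2.1 + q * (N.psi * z.2.1 - z.2.2)) / z.1)

theorem kernel_pos (p q : ℝ) (z : ℝ × ℝ × ℝ) : 0 < N.kernel p q z := Real.exp_pos _

theorem measurable_kernel (p q : ℝ) : Measurable (N.kernel p q) := by
  unfold kernel; fun_prop

theorem kernel_le_one {p q : ℝ} (hp : 0 ≤ p) (hq : 0 ≤ q) {z : ℝ × ℝ × ℝ}
    (hz : 0 < z.1 ∧ 0 < z.2.1 ∧ 0 < z.2.2) (hd : z ∈ N.directSet) : N.kernel p q z ≤ 1 := by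
  have h1 : 0 < N.psi * z.2.1 - z.2.2 := sub_pos.2 hd
  have h2 := hz.2.1
  rw [kernel, Real.exp_le_one_iff, neg_div, neg_nonpos]
  exact div_nonneg (by positivity) hz.1.le

theorem integrableOn_kernel (hN : N.Valid) {p q : ℝ} (hp : 0 ≤ p) (hq : 0 ≤ q) :
    IntegrableOn (N.kernel p q) N.decodeSet N.gainsLaw := by
  have := isProbabilityMeasure_gainsLaw hN
  refine Integrable.mono' (integrable_const 1) (measurable_kernel p q).aestronglyMeasurable ?_
  filter_upwards [ae_restrict_of_ae (gainsLaw_ae_pos hN),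
    ae_restrict_mem measurableSet_decodeSet] with z hz hd
  rw [Real.norm_eq_abs, abs_of_pos (kernel_pos p q z)]
  exact kernel_le_one hp hq hz hd.2

/-- Writing the second rate as λ_sd δ makes the total exponent linear in y with slope -λ_sd (s-δ)/s,
which exhibits the point s = δ. -/
theorem inner_integral_kernel (hN : N.Valid) {p δ s x : ℝ} (hs : 0 < s) (hsδ : s ≠ δ)
    (hx : 0 < x) :
    ∫ y in Set.Iio (N.psi * x), N.kernel p (N.lsd * δ) (s, x, y) ∂(expMeasure N.lsd) =
      s / (s - δ) * (Real.exp (-((p + N.c * δ) / s * x)) -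
        Real.exp (-((N.c + p / s) * x))) := by
  have hsd : s - δ ≠ 0 := sub_ne_zero.2 hsδ
  have h := mul_integral_exp_neg_mul (N.lsd * (s - δ) / s) (N.psi * x)
  rw [setIntegral_expMeasure_Iio hN.lsd_pos (mul_pos (psi_pos hN) hx).le]
  have h1 : ∀ y, N.lsd * Real.exp (-(N.lsd * y)) * N.kernel p (N.lsd * δ) (s, x, y) =
      N.lsd * Real.exp (-((p + N.c * δ) / s * x)) *
        Real.exp (-(N.lsd * (s - δ) / s * y)) := fun y => by
    rw [kernel, mul_assoc N.lsd (Real.exp _), mul_assoc N.lsd (Real.exp _), ← Real.exp_add,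
      ← Real.exp_add, c]
    congr 2
    field_simp
    ring
  have h2 : Real.exp (-((N.c + p / s) * x)) = Real.exp (-((p + N.c * δ) / s * x)) *
      Real.exp (-(N.lsd * (s - δ) / s * (N.psi * x))) := by
    rw [← Real.exp_add, c]
    congr 1
    field_simp
    ring
  simp_rw [h1]
  rw [intervalIntegral.integral_const_mul, h2, ← mul_one_sub, ← h]
  field_simp

theorem middle_integral_kernel (hN : N.Valid) {p δ s : ℝ} (hp : 0 ≤ p) (hδ : 0 ≤ δ) (hs : 0 < s)
    (hsδ : s ≠ δ) :
    ∫ x in Set.Iic (N.g * s), ∫ y in Set.Iio (N.psi * x), N.kernel p (N.lsd * δ) (s, x, y)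
        ∂(expMeasure N.lsd) ∂(expMeasure N.lsp) =
      s / (s - δ) * (N.lsp * s / (N.lsp * s + (p + N.c * δ)) *
          (1 - Real.exp (-((N.lsp * s + (p + N.c * δ)) * N.g))) -
        N.lsp * s / ((N.c + N.lsp) * s + p) *
          (1 - Real.exp (-(((N.c + N.lsp) * s + p) * N.g)))) := by
  have hα := hN.lsp_pos
  have hc := c_pos hN
  have := isProbabilityMeasure_expMeasure hN.lsp_pos
  have h1 : ∀ᵐ x ∂((expMeasure N.lsp).restrict (Set.Iic (N.g * s))),
      ∫ y in Set.Iio (N.psi * x), N.kernel p (N.lsd * δ) (s, x, y) ∂(expMeasure N.lsd) =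
      s / (s - δ) * (Real.exp (-((p + N.c * δ) / s * x)) -
        Real.exp (-((N.c + p / s) * x))) := by
    filter_upwards [ae_restrict_of_ae (expMeasure_ae_pos N.lsp)] with x hx
    exact inner_integral_kernel hN hs hsδ hx
  have hi : ∀ κ : ℝ, 0 ≤ κ → Integrable (fun x => Real.exp (-(κ * x)))
      ((expMeasure N.lsp).restrict (Set.Iic (N.g * s))) := fun κ hκ => by
    refine Integrable.mono' (integrable_const 1) (by fun_prop) ?_
    filter_upwards [ae_restrict_of_ae (expMeasure_ae_pos N.lsp)] with x hx
    rw [Real.norm_eq_abs, abs_of_pos (Real.exp_pos _), Real.exp_le_one_iff]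
    have : 0 ≤ κ * x := by positivity
    linarith
  have hgs : 0 ≤ N.g * s := (mul_pos (g_pos hN) hs).le
  rw [integral_congr_ae h1, integral_const_mul, integral_sub (hi _ (by positivity))
    (hi _ (by positivity)), setIntegral_expMeasure_exp hα (by positivity) hgs,
    setIntegral_expMeasure_exp hα (by positivity) hgs]
  have e1 : (N.lsp + (p + N.c * δ) / s) * (N.g * s) = (N.lsp * s + (p + N.c * δ)) * N.g := by
    field_simp
  have e2 : (N.lsp + (N.c + p / s)) * (N.g * s) = ((N.c + N.lsp) * s + p) * N.g := by
    field_simp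
    ring
  have e3 : N.lsp / (N.lsp + (p + N.c * δ) / s) = N.lsp * s / (N.lsp * s + (p + N.c * δ)) := by
    field_simp
  have e4 : N.lsp / (N.lsp + (N.c + p / s)) = N.lsp * s / ((N.c + N.lsp) * s + p) := by
    rw [← add_assoc, add_comm N.lsp]
    field_simp
  rw [e1, e2, e3, e4]

/-- The central computation: iterated integration, partial fractions in s, and the Erlang integrals
term by term. Two integrals stay unevaluated because their E_L form requires a positive shift,
whereas p and p + cδ may be 0 here. -/
theorem setIntegral_kernel (hN : N.Valid) {p δ : ℝ} (hp : 0 ≤ p) (hδ : 0 ≤ δ) :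
    ∫ z in N.decodeSet, N.kernel p (N.lsd * δ) z ∂N.gainsLaw =
      (1 - Real.exp (-(N.g * (p + N.c * δ))) * (N.lsr / N.B2) ^ L)
      - (p + N.c * δ) ^ 2 / (p + (N.c + N.lsp) * δ) *
        ∫ s, (1 - Real.exp (-((N.lsp * s + (p + N.c * δ)) * N.g))) / (N.lsp * s + (p + N.c * δ))
          ∂(erlangLaw L N.lsr)
      - N.lsp / (N.c + N.lsp) * (1 - Real.exp (-(N.g * p)) * (N.lsr / N.B1) ^ L)
      + N.lsp * p ^ 2 / ((N.c + N.lsp) * (p + (N.c + N.lsp) * δ)) *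
        ∫ s, (1 - Real.exp (-(((N.c + N.lsp) * s + p) * N.g))) / ((N.c + N.lsp) * s + p)
          ∂(erlangLaw L N.lsr)
      - N.lsp * δ ^ 2 / (p + (N.c + N.lsp) * δ) *
        Real.exp (-(N.g * (p + (N.c + N.lsp) * δ))) * (N.lsr ^ L * Real.exp (-(δ * N.lsr)) *
          ∫ B in N.B2..N.B1, Real.exp (δ * B) / B ^ L) := by
  have hα := hN.lsp_pos
  have hc := c_pos hN
  have hg := g_pos hN
  have hL := hN.one_le_L
  have hr := hN.lsr_pos
  have hmono : N.g * N.lsp ≤ N.g * (N.c + N.lsp) := by gcongr; linarith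
  rw [setIntegral_decodeSet hN (integrableOn_kernel hN hp (mul_nonneg hN.lsd_pos.le hδ))]
  have hae : ∀ᵐ s ∂(erlangLaw L N.lsr),
      ∫ x in Set.Iic (N.g * s), ∫ y in Set.Iio (N.psi * x), N.kernel p (N.lsd * δ) (s, x, y)
        ∂(expMeasure N.lsd) ∂(expMeasure N.lsp) =
      (1 - Real.exp (-((N.lsp * s + (p + N.c * δ)) * N.g)))
      - (p + N.c * δ) ^ 2 / (p + (N.c + N.lsp) * δ) *
        ((1 - Real.exp (-((N.lsp * s + (p + N.c * δ)) * N.g))) / (N.lsp * s + (p + N.c * δ)))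
      - N.lsp / (N.c + N.lsp) * (1 - Real.exp (-(((N.c + N.lsp) * s + p) * N.g)))
      + N.lsp * p ^ 2 / ((N.c + N.lsp) * (p + (N.c + N.lsp) * δ)) *
        ((1 - Real.exp (-(((N.c + N.lsp) * s + p) * N.g))) / ((N.c + N.lsp) * s + p))
      - N.lsp * δ ^ 2 / (p + (N.c + N.lsp) * δ) *
        Real.exp (-(N.g * (p + (N.c + N.lsp) * δ))) *
          ∫ τ in (N.g * N.lsp)..(N.g * (N.c + N.lsp)), Real.exp (-(τ * (s - δ))) := by
    filter_upwards [erlangLaw_ae_pos hL hr, erlangLaw_ae_ne hL hr δ] with s hs hsδ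
    rw [middle_integral_kernel hN hp hδ hs hsδ,
      partialFraction_identity hα hc rfl hp hδ hs hsδ, exp_sub_exp_div_eq_integral rfl hsδ]
    ring
  have i1 := integrable_erlangLaw_one_sub_exp hL hr hα.le (p := p + N.c * δ) (by positivity) hg.le
  have i2 := integrable_erlangLaw_one_sub_exp_div hL hr hα (p := p + N.c * δ) (by positivity) hg.le
  have i3 := integrable_erlangLaw_one_sub_exp hL hr (κ := N.c + N.lsp) (by positivity) hp hg.le
  have i4 := integrable_erlangLaw_one_sub_exp_div hL hr (κ := N.c + N.lsp) (by positivity) hp hg.le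
  have i5 := integrable_erlangLaw_intervalIntegral hL hr (δ := δ) (u := N.g * N.lsp) (by positivity)
    hmono
  have j2 := i1.sub (i2.const_mul ((p + N.c * δ) ^ 2 / (p + (N.c + N.lsp) * δ)))
  have j3 := j2.sub (i3.const_mul (N.lsp / (N.c + N.lsp)))
  have j4 := j3.add (i4.const_mul (N.lsp * p ^ 2 / ((N.c + N.lsp) * (p + (N.c + N.lsp) * δ))))
  rw [integral_congr_ae hae]
  refine (integral_sub j4 (i5.const_mul _)).trans ?_
  refine (congrArg (· - _) ((integral_add j3 (i4.const_mul _)).trans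
    (congrArg (· + _) ((integral_sub j2 (i3.const_mul _)).trans
      (congrArg (· - _) (integral_sub i1 (i2.const_mul _))))))).trans ?_
  simp only [integral_const_mul]
  rw [integral_erlangLaw_one_sub_exp hr hα.le hg.le,
    integral_erlangLaw_one_sub_exp hr (by positivity) hg.le,
    integral_erlangLaw_intervalIntegral hL hr (by positivity) hmono]
  rfl

end Network

/-! ### The closed-form summands -/

namespace Network
variable {L : ℕ} {N : Network L}

/-- The coefficient of `(-1) ^ (i + j) * t ^ j` in the closed form. -/
def closedTerm (N : Network L) (i j : ℕ) : ℝ :=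
  N.termEi i j + N.termE1 i j - N.termE2 i j
    - (N.lsr / N.B2) ^ L * Real.exp (-N.g * (N.a * j + N.b * i))
    + N.lsp / (N.c + N.lsp) * Real.exp (-N.a * N.g * j) * (N.lsr / N.B1) ^ L
    + N.c / (N.c + N.lsp)

/-- If A_ij > 0 this is the E_L formula; if A_ij = 0 the squared factor annihilates both sides. -/
theorem termE2_eq (hN : N.Valid) (i j : ℕ) :
    (N.a * j + N.b * i) ^ 2 / (N.a * j + N.b * i + N.d * N.lsp * i) *
      ∫ s, (1 - Real.exp (-((N.lsp * s + (N.a * j + N.b * i)) * N.g))) /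
        (N.lsp * s + (N.a * j + N.b * i)) ∂(erlangLaw L N.lsr) = N.termE2 i j := by
  have h0 : 0 ≤ N.a * j + N.b * i := by
    have := a_pos hN
    have := c_pos hN
    have := d_pos hN
    rw [b_eq hN]
    positivity
  rw [termE2]
  rcases h0.eq_or_lt with h | h
  · simp [← h]
  · rw [integral_erlangLaw_one_sub_exp_div hN.one_le_L hN.lsr_pos hN.lsp_pos h (g_pos hN).le, B2,
      ← div_mul_div_comm]
    ring

theorem termE1_eq (hN : N.Valid) (i j : ℕ) :
    N.lsp * (N.a * j) ^ 2 / ((N.c + N.lsp) * (N.a * j + N.b * i + N.d * N.lsp * i)) *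
      ∫ s, (1 - Real.exp (-(((N.c + N.lsp) * s + N.a * j) * N.g))) / ((N.c + N.lsp) * s + N.a * j)
        ∂(erlangLaw L N.lsr) = N.termE1 i j := by
  have := a_pos hN
  have := c_pos hN
  have := hN.lsp_pos
  have h0 : 0 ≤ N.a * j := by positivity
  rw [termE1]
  rcases h0.eq_or_lt with h | h
  · simp [← h]
  · rw [integral_erlangLaw_one_sub_exp_div hN.one_le_L hN.lsr_pos (by positivity) h (g_pos hN).le,
      B1, div_pow, ← div_mul_div_comm]
    ring

/-- The reduction formula with n = L - 1 on [B₂, B₁]; the closed form lists its end points in the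
opposite order, whence the minus sign. All its exponentials share the prefactor e^{-gD_ij - di
λ_sr}, because B₁ and B₂ differ from λ_sr by multiples of g. -/
theorem termEi_eq (hN : N.Valid) (i j : ℕ) :
    -(N.lsp * (N.d * i) ^ 2 / (N.a * j + N.b * i + N.d * N.lsp * i) *
      Real.exp (-(N.g * (N.a * j + N.b * i + N.d * N.lsp * i))) *
        (N.lsr ^ L * Real.exp (-(N.d * i * N.lsr)) *
          ∫ B in N.B2..N.B1, Real.exp (N.d * i * B) / B ^ L)) = N.termEi i j := by
  rw [termEi]
  -- For i = 0 the factor (di)² vanishes, so the value assigned to Ei at 0 is irrelevant.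
  rcases Nat.eq_zero_or_pos i with rfl | hi
  · simp
  have hd := d_pos hN
  have hδ : 0 < N.d * i := by positivity
  obtain ⟨n, rfl⟩ : ∃ n, L = n + 1 := ⟨L - 1, by have := hN.one_le_L; omega⟩
  have h := integral_exp_mul_div_pow n hδ (B2_pos hN) (B1_pos hN)
  have hn : (n.factorial : ℝ) ≠ 0 := Nat.cast_ne_zero.2 n.factorial_ne_zero
  rw [mul_comm, ← eq_div_iff hn] at h
  have hsum : ∀ k ∈ Finset.range n, Real.Gamma (((n + 1 : ℕ) : ℝ) - 1 - k) * (N.d * i) ^ k *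
        (Real.exp (-N.a * N.g * j) * N.B1 ^ ((k : ℤ) - (n + 1 : ℕ) + 1)
          - Real.exp (-N.g * (N.a * j + N.b * i)) * N.B2 ^ ((k : ℤ) - (n + 1 : ℕ) + 1)) =
      -(Real.exp (-(N.g * (N.a * j + N.b * i + N.d * N.lsp * i))) * Real.exp (-(N.d * i * N.lsr)) *
        (((n - 1 - k).factorial : ℝ) * (N.d * i) ^ k *
        (Real.exp (N.d * i * N.B2) / N.B2 ^ (n - k) -
          Real.exp (N.d * i * N.B1) / N.B1 ^ (n - k)))) := by
    intro k hk
    have hk := Finset.mem_range.1 hk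
    have hG : Real.Gamma (((n + 1 : ℕ) : ℝ) - 1 - k) = ((n - 1 - k).factorial : ℝ) := by
      rw [← Real.Gamma_nat_eq_factorial, Nat.cast_sub (by omega), Nat.cast_sub (by omega)]
      push_cast
      ring_nf
    have hz : ((k : ℤ) - (n + 1 : ℕ) + 1) = -((n - k : ℕ) : ℤ) := by omega
    have e1 : Real.exp (-N.a * N.g * j) =
        Real.exp (-(N.g * (N.a * j + N.b * i + N.d * N.lsp * i))) *
          Real.exp (-(N.d * i * N.lsr)) * Real.exp (N.d * i * N.B1) := by
      rw [← Real.exp_add, ← Real.exp_add, B1, b_eq hN]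
      ring_nf
    have e2 : Real.exp (-N.g * (N.a * j + N.b * i)) =
        Real.exp (-(N.g * (N.a * j + N.b * i + N.d * N.lsp * i))) *
          Real.exp (-(N.d * i * N.lsr)) * Real.exp (N.d * i * N.B2) := by
      rw [← Real.exp_add, ← Real.exp_add, B2]
      ring_nf
    rw [hG, hz, zpow_neg, zpow_neg, zpow_natCast, zpow_natCast, e1, e2]
    ring
  have e3 : Real.exp (-N.g * (N.a * j + N.b * i)) * Real.exp (-(N.d * i * N.B2)) =
      Real.exp (-(N.g * (N.a * j + N.b * i + N.d * N.lsp * i))) *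
        Real.exp (-(N.d * i * N.lsr)) := by
    rw [← Real.exp_add, ← Real.exp_add, B2]
    ring_nf
  simp only [Nat.add_sub_cancel]
  rw [Finset.sum_congr rfl hsum, Finset.sum_neg_distrib, ← Finset.mul_sum, h,
    mul_assoc (_ ^ n) (Real.exp _), e3, ← div_div]
  ring

/-- The closed form of the truncated expectation of a kernel. -/
theorem setIntegral_kernel_eq_closedTerm (hN : N.Valid) (i j : ℕ) :
    ∫ z in N.decodeSet, N.kernel (N.a * j) (N.lrd / N.beta * i) z ∂N.gainsLaw =
      N.closedTerm i j := by
  have ha := a_pos hN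
  have hd := d_pos hN
  have hc := c_pos hN
  have hα := hN.lsp_pos
  have h1 : N.lrd / N.beta * i = N.lsd * (N.d * i) := by
    have := hN.lsd_pos.ne'
    have := hN.beta_pos.ne'
    rw [d]
    field_simp
  have h2 : N.a * j + N.c * (N.d * i) = N.a * j + N.b * i := by rw [b_eq hN]; ring
  have h3 : N.a * j + (N.c + N.lsp) * (N.d * i) = N.a * j + N.b * i + N.d * N.lsp * i := by
    rw [b_eq hN]; ring
  rw [h1, setIntegral_kernel hN (by positivity) (by positivity), h2, h3, termE1_eq hN,
    termE2_eq hN, closedTerm, ← termEi_eq hN]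
  have h4 : N.c / (N.c + N.lsp) = 1 - N.lsp / (N.c + N.lsp) := by
    field_simp
    ring
  rw [h4]
  ring_nf

theorem kernel_zero (p q s x : ℝ) :
    N.kernel p q (s, x, 0) = Real.exp (-((p + q * N.psi) / s * x)) := by
  rw [kernel]
  ring_nf

/-- The summand of the closed form without direct link. -/
def closedTermNoDirect (N : Network L) (i j : ℕ) : ℝ :=
  1 - N.lsr * (N.a * j + N.b * i) / N.lsp *
      Real.exp ((N.a * j + N.b * i) / N.lsp * N.lsr) *
        (genExpIntegral L ((N.a * j + N.b * i) / N.lsp * N.lsr)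
          - (N.lsr / N.B2) ^ (L - 1) *
            genExpIntegral L ((N.a * j + N.b * i) / N.lsp * N.B2))
    - (N.lsr / N.B2) ^ L * Real.exp (-N.g * (N.a * j + N.b * i))

theorem integrableOn_kernel_zero (hN : N.Valid) {p q : ℝ} (hp : 0 ≤ p) (hq : 0 ≤ q) :
    IntegrableOn (fun z => N.kernel p q (z.1, z.2.1, 0)) N.relaySet N.gainsLaw := by
  have := isProbabilityMeasure_gainsLaw hN
  have hψ := psi_pos hN
  refine Integrable.mono' (integrable_const 1)
    ((measurable_kernel p q).comp (by fun_prop)).aestronglyMeasurable ?_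
  filter_upwards [ae_restrict_of_ae (gainsLaw_ae_pos hN)] with z hz
  obtain ⟨h1, h2, -⟩ := hz
  rw [Real.norm_eq_abs, abs_of_pos (kernel_pos p q _), kernel_zero, Real.exp_le_one_iff]
  have : 0 ≤ (p + q * N.psi) / z.1 * z.2.1 := by positivity
  linarith

/-- With y = 0 there is no integration over Y and hence no pole at δ: the single fraction λ_sp
s/(λ_sp s + A) is 1 - A/(λ_sp s + A), which produces only an E_L term. -/
theorem setIntegral_kernel_eq_closedTermNoDirect (hN : N.Valid) (i j : ℕ) :
    ∫ z in N.relaySet, N.kernel (N.a * j) (N.lrd / N.beta * i) (z.1, z.2.1, 0) ∂N.gainsLaw =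
      N.closedTermNoDirect i j := by
  have ha := a_pos hN
  have hψ := psi_pos hN
  have hα := hN.lsp_pos
  have hβ := hN.beta_pos
  have hκ := hN.lrd_pos
  have hL := hN.one_le_L
  have hr := hN.lsr_pos
  have hA : N.a * j + N.lrd / N.beta * i * N.psi = N.a * j + N.b * i := by rw [b]; ring
  have hA0 : 0 ≤ N.a * j + N.b * i := by rw [← hA]; positivity
  rw [setIntegral_relaySet hN (f := fun w => N.kernel (N.a * j) (N.lrd / N.beta * i) (w.1, w.2, 0))
    (integrableOn_kernel_zero hN (by positivity) (by positivity))]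
  simp only [kernel_zero, hA]
  have hae : ∀ᵐ s ∂(erlangLaw L N.lsr),
      ∫ x in Set.Iic (N.g * s), Real.exp (-((N.a * j + N.b * i) / s * x)) ∂(expMeasure N.lsp) =
      (1 - Real.exp (-((N.lsp * s + (N.a * j + N.b * i)) * N.g))) - (N.a * j + N.b * i) *
        ((1 - Real.exp (-((N.lsp * s + (N.a * j + N.b * i)) * N.g))) /
          (N.lsp * s + (N.a * j + N.b * i))) := by
    filter_upwards [erlangLaw_ae_pos hL hr] with s hs
    rw [setIntegral_expMeasure_exp hα (by positivity) (mul_pos (g_pos hN) hs).le]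
    have e1 : (N.lsp + (N.a * j + N.b * i) / s) * (N.g * s) =
        (N.lsp * s + (N.a * j + N.b * i)) * N.g := by
      field_simp
    rw [e1]
    have : 0 < N.lsp * s + (N.a * j + N.b * i) := by positivity
    generalize N.a * j + N.b * i = A at *
    field_simp
    ring
  rw [integral_congr_ae hae, integral_sub
    (integrable_erlangLaw_one_sub_exp hL hr hα.le hA0 (g_pos hN).le)
    ((integrable_erlangLaw_one_sub_exp_div hL hr hα hA0 (g_pos hN).le).const_mul _),
    integral_erlangLaw_one_sub_exp hr hα.le (g_pos hN).le, integral_const_mul, closedTermNoDirect]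
  rcases hA0.eq_or_lt with h | h
  · simp [← h, B2]
  · rw [integral_erlangLaw_one_sub_exp_div hL hr hα h (g_pos hN).le, B2]
    ring_nf

end Network

/-! ### Outage probability of a single antenna -/

theorem expMeasure_real_Iic {r x : ℝ} (hr : 0 < r) (hx : 0 ≤ x) :
    (expMeasure r).real (Set.Iic x) = 1 - Real.exp (-(r * x)) := by
  have := setIntegral_expMeasure_exp hr le_rfl hx
  simpa [hr.ne'] using this

theorem expMeasure_real_Iio {r x : ℝ} (hr : 0 < r) (hx : 0 ≤ x) :
    (expMeasure r).real (Set.Iio x) = 1 - Real.exp (-(r * x)) := by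
  rw [← expMeasure_real_Iic hr hx, measureReal_congr Iio_ae_eq_Iic]

/-- The point v is where A and Bx cross. Below it the integrand is constant; above it the integral
is the full Laplace transform minus the truncated one. -/
theorem integral_expMeasure_exp_max {l A B v : ℝ} (hl : 0 < l) (hA : 0 < A) (hB : 0 < B)
    (hv : A = B * v) :
    ∫ x, Real.exp (-max A (B * x)) ∂(expMeasure l) =
      Real.exp (-A) * (1 - Real.exp (-(l * v)) * (1 - l / (l + B))) := by
  have := isProbabilityMeasure_expMeasure hl
  have hv0 : 0 < v := by
    rcases lt_trichotomy 0 v with h | h | h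
    · exact h
    · simp [← h] at hv; linarith
    · nlinarith
  have hi : Integrable (fun x => Real.exp (-max A (B * x))) (expMeasure l) := by
    refine Integrable.mono' (integrable_const 1) (by fun_prop) (.of_forall fun x => ?_)
    rw [Real.norm_eq_abs, abs_of_pos (Real.exp_pos _), Real.exp_le_one_iff, neg_nonpos]
    exact hA.le.trans (le_max_left _ _)
  have hfull : Integrable (fun x => Real.exp (-(B * x))) (expMeasure l) := by
    refine Integrable.mono' (integrable_const 1) (by fun_prop) ?_
    filter_upwards [expMeasure_ae_pos l] with x hx
    rw [Real.norm_eq_abs, abs_of_pos (Real.exp_pos _), Real.exp_le_one_iff, neg_nonpos]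
    positivity
  rw [← integral_add_compl (measurableSet_Iic (a := v)) hi]
  have h1 : ∫ x in Set.Iic v, Real.exp (-max A (B * x)) ∂(expMeasure l) =
      Real.exp (-A) * (1 - Real.exp (-(l * v))) := by
    rw [setIntegral_congr_fun (g := fun _ => Real.exp (-A)) measurableSet_Iic fun x hx => by
      have hx : x ≤ v := hx
      simp only
      rw [max_eq_left (by rw [hv]; gcongr)], setIntegral_const, expMeasure_real_Iic hl hv0.le,
      smul_eq_mul, mul_comm]
  have h2 : ∫ x in (Set.Iic v)ᶜ, Real.exp (-max A (B * x)) ∂(expMeasure l) =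
      ∫ x in (Set.Iic v)ᶜ, Real.exp (-(B * x)) ∂(expMeasure l) :=
    setIntegral_congr_fun measurableSet_Iic.compl fun x hx => by
      have hx : v < x := not_le.1 hx
      rw [max_eq_right (by rw [hv]; gcongr)]
  have h3 := integral_add_compl (measurableSet_Iic (a := v)) hfull
  rw [laplace_expMeasure hl hB.le, setIntegral_expMeasure_exp hl hB.le hv0.le] at h3
  rw [h1, h2, eq_sub_of_add_eq' h3]
  have h4 : Real.exp (-((l + B) * v)) = Real.exp (-A) * Real.exp (-(l * v)) := by
    rw [← Real.exp_add, hv]; ring_nf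
  rw [h4]
  ring

/-- Outage probability of one antenna whose transmit power is limited both by the harvested power
and by the interference constraint. -/
theorem real_min_mul_lt {lrd lrp I P r : ℝ} (hrd : 0 < lrd) (hrp : 0 < lrp) (hI : 0 < I)
    (hP : 0 < P) (hr : 0 < r) :
    ((expMeasure lrd).prod (expMeasure lrp)).real {w | min P (I / w.2) * w.1 < r} =
      1 - Real.exp (-(lrd * r / P)) * (1 - Real.exp (-(lrp * I / P)) *
        (1 - 1 / (1 + lrd / (I * lrp) * r))) := by
  have := isProbabilityMeasure_expMeasure hrd
  have := isProbabilityMeasure_expMeasure hrp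
  have hm : MeasurableSet {w : ℝ × ℝ | min P (I / w.2) * w.1 < r} :=
    measurableSet_lt (by fun_prop) (by fun_prop)
  rw [Measure.real, Measure.prod_apply_symm hm, ← integral_toReal
    (measurable_measure_prodMk_right hm).aemeasurable (.of_forall fun _ => measure_lt_top _ _)]
  -- Dividing the threshold r by the minimum of P and I/v gives the maximum of r/P and rv/I; the two
  -- coincide at v = I/P.
  have hae : ∀ᵐ v ∂(expMeasure lrp),
      ((expMeasure lrd) ((fun u => (u, v)) ⁻¹' {w | min P (I / w.2) * w.1 < r})).toReal =
        1 - Real.exp (-max (lrd * r / P) (lrd * r / I * v)) := by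
    filter_upwards [expMeasure_ae_pos lrp] with v hv
    have hmin : 0 < min P (I / v) := lt_min hP (by positivity)
    have hset : (fun u => (u, v)) ⁻¹' {w : ℝ × ℝ | min P (I / w.2) * w.1 < r} =
        Set.Iio (r / min P (I / v)) := by
      ext u
      simp only [Set.mem_preimage, Set.mem_ofPred_eq, Set.mem_Iio]
      rw [lt_div_iff₀ hmin, mul_comm]
    have h := expMeasure_real_Iio hrd (x := r / min P (I / v)) (by positivity)
    rw [Measure.real] at h
    rw [hset, h]
    congr 3
    rcases le_total P (I / v) with hle | hle
    · have : v ≤ I / P := by rw [le_div_iff₀ hP]; rw [le_div_iff₀ hv] at hle; linarith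
      rw [min_eq_left hle, max_eq_left, mul_div_assoc]
      rw [div_mul_eq_mul_div, div_le_div_iff₀ hI hP]
      rw [le_div_iff₀ hP] at this
      nlinarith [mul_pos hrd hr]
    · rw [min_eq_right hle, max_eq_right]
      · field_simp
      · rw [div_le_iff₀ hv] at hle
        rw [div_mul_eq_mul_div, div_le_div_iff₀ hP hI]
        nlinarith [mul_pos hrd hr]
  rw [integral_congr_ae hae, integral_sub (integrable_const _), integral_expMeasure_exp_max hrp
    (by positivity) (by positivity) (v := I / P) (by field_simp)]
  · have : lrp / (lrp + lrd * r / I) = 1 / (1 + lrd / (I * lrp) * r) := by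
      field_simp
    rw [this, mul_div_assoc lrp]
    simp
  · refine Integrable.mono' (integrable_const 1) (by fun_prop) (.of_forall fun x => ?_)
    rw [Real.norm_eq_abs, abs_of_pos (Real.exp_pos _), Real.exp_le_one_iff, neg_nonpos]
    exact (by positivity : 0 ≤ lrd * r / P).trans (le_max_left _ _)

theorem real_mul_lt {lrd lrp P r : ℝ} (hrd : 0 < lrd) (hrp : 0 < lrp)
    (hP : 0 < P) (hr : 0 < r) :
    ((expMeasure lrd).prod (expMeasure lrp)).real {w | P * w.1 < r} =
      1 - Real.exp (-(lrd * r / P)) := by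
  have := isProbabilityMeasure_expMeasure hrd
  have := isProbabilityMeasure_expMeasure hrp
  have hset : {w : ℝ × ℝ | P * w.1 < r} = Set.Iio (r / P) ×ˢ Set.univ := by
    ext w
    simp [lt_div_iff₀ hP, mul_comm]
  rw [hset, measureReal_prod_prod, expMeasure_real_Iio hrd (by positivity), mul_div_assoc]
  simp

/-! ### First-hop outage and decomposition of the outage event -/

namespace Network
variable {L : ℕ} {N : Network L}

theorem measurable_gains : Measurable (Channels.gains (L := L)) := by
  unfold Channels.gains Channels.gainSR Channels.gainSP Channels.gainSD
  fun_prop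

theorem law_ae_pos (hN : N.Valid) :
    ∀ᵐ h ∂N.law, 0 < h.gainSR ∧ 0 < h.gainSP ∧ 0 < h.gainSD :=
  (measurePreserving_gains hN).quasiMeasurePreserving.ae (gainsLaw_ae_pos hN)

theorem psi_mul_Itemp (hN : N.Valid) : N.psi * N.Itemp = N.gammaTh * N.No := by
  have := hN.Itemp_pos.ne'
  have := hN.No_pos.ne'
  rw [psi]
  field_simp

/-- The relay decodes exactly on `relaySet`. -/
theorem le_snr_iff (hN : N.Valid) {z : ℝ × ℝ × ℝ} (hz : 0 < z.2.1) :
    N.gammaTh ≤ N.xi * (N.Itemp / z.2.1) * z.1 / N.No ↔ z ∈ N.relaySet := by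
  have hI := hN.Itemp_pos
  have hψ := psi_pos hN
  rw [le_div_iff₀ hN.No_pos, ← psi_mul_Itemp hN, relaySet, Set.mem_ofPred_eq, g,
    show N.xi * (N.Itemp / z.2.1) * z.1 = N.xi * N.Itemp * z.1 / z.2.1 by ring, le_div_iff₀ hz,
    div_mul_eq_mul_div, le_div_iff₀ hψ]
  constructor <;> intro h <;> nlinarith

theorem direct_lt_iff (hN : N.Valid) {z : ℝ × ℝ × ℝ} (hz : 0 < z.2.1) :
    N.Itemp / z.2.1 * z.2.2 / N.No < N.gammaTh ↔ z ∈ N.directSet := by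
  have hI := hN.Itemp_pos
  rw [div_lt_iff₀ hN.No_pos, ← psi_mul_Itemp hN, directSet, Set.mem_ofPred_eq, div_mul_eq_mul_div,
    div_lt_iff₀ hz]
  constructor <;> intro h <;> nlinarith

/-- For i = j = 0 the kernel is 1, so the integral formula is a probability. -/
theorem gainsLaw_real_relaySet (hN : N.Valid) :
    N.gainsLaw.real N.relaySet = 1 - (N.lsr / N.B2) ^ L := by
  have h := setIntegral_kernel_eq_closedTermNoDirect hN 0 0
  simpa [kernel, closedTermNoDirect] using h

theorem p1_eq (hN : N.Valid) :
    N.p1 = (1 + N.lsp * N.xi / (N.lsr * N.psi)) ^ (-(L : ℤ)) := by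
  have := isProbabilityMeasure_gainsLaw hN
  have hae : {h | N.snrR h < N.gammaTh} =ᵐ[N.law] Channels.gains ⁻¹' N.relaySetᶜ := by
    filter_upwards [law_ae_pos hN] with h hh
    exact propext (not_le.symm.trans (not_congr (le_snr_iff hN (z := h.gains) hh.2.1)))
  rw [p1, measureReal_congr hae, Measure.real, (measurePreserving_gains hN).measure_preimage
    measurableSet_relaySet.compl.nullMeasurableSet, ← Measure.real,
    probReal_compl_eq_one_sub measurableSet_relaySet, gainsLaw_real_relaySet hN, zpow_neg,
    zpow_natCast, ← inv_pow, sub_sub_cancel]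
  congr 1
  have := hN.lsr_pos
  have := psi_pos hN
  rw [B2, g]
  field_simp

theorem measurable_snrR : Measurable N.snrR := by
  unfold snrR Ps Channels.gainSR Channels.gainSP
  fun_prop

theorem outage_eq : N.outage = N.p1 + N.p2 := by
  have hset : {h | min (N.snrR h) (N.snrD h) < N.gammaTh} =
      {h | N.snrR h < N.gammaTh} ∪ {h | N.snrD h < N.gammaTh ∧ N.gammaTh ≤ N.snrR h} := by
    ext h
    simp only [Set.mem_ofPred_eq, Set.mem_union, min_lt_iff]
    rcases lt_or_ge (N.snrR h) N.gammaTh with h1 | h1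
    · simp [h1]
    · simp [h1, not_lt.2 h1]
  rw [outage, hset, Set.union_comm, measureReal_union _
    (measurableSet_lt measurable_snrR measurable_const), p1, p2, add_comm]
  exact Set.disjoint_left.2 fun h h1 h2 => not_lt.2 h1.2 h2

end Network

/-! ### Expansion of p₂, and the systems without interference constraint or direct link -/

namespace Network
variable {L : ℕ} {N : Network L}

theorem condEvent_ae_eq (hN : N.Valid) :
    N.condEvent =ᵐ[N.law] Channels.gains ⁻¹' N.decodeSet := by
  filter_upwards [law_ae_pos hN] with h hh
  exact propext (and_congr (le_snr_iff hN (z := h.gains) hh.2.1)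
    (direct_lt_iff hN (z := h.gains) hh.2.1))

theorem setIntegral_condEvent (hN : N.Valid) {f : ℝ × ℝ × ℝ → ℝ} (hf : Measurable f) :
    ∫ h in N.condEvent, f h.gains ∂N.law = ∫ z in N.decodeSet, f z ∂N.gainsLaw := by
  rw [setIntegral_congr_set (condEvent_ae_eq hN), ← (measurePreserving_gains hN).map_eq,
    setIntegral_map measurableSet_decodeSet hf.aestronglyMeasurable
      measurable_gains.aemeasurable]

/-- The inner term as a function of the gains. -/
def innerGains (N : Network L) (z : ℝ × ℝ × ℝ) : ℝ := N.innerTerm (N.Itemp / z.2.1 * z.2.2)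

theorem measurable_innerGains : Measurable N.innerGains := by
  unfold innerGains innerTerm
  fun_prop

theorem exp_mul_exp_eq_kernel (hN : N.Valid) {h : Channels L}
    (hS : 0 < h.gainSR) (hX : 0 < h.gainSP) (i j : ℕ) :
    Real.exp (-(i * N.lrd * (N.gammaTh * N.No - N.Ps h * h.gainSD)) / N.harvested h) *
      Real.exp (-(j * N.lrp * N.Itemp) / N.harvested h) =
    N.kernel (N.a * j) (N.lrd / N.beta * i) h.gains := by
  have := hN.Itemp_pos
  have := hN.beta_pos
  rw [← psi_mul_Itemp hN, ← Real.exp_add, kernel, harvested, Ps, a, Channels.gains]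
  congr 1
  field_simp
  ring

theorem setIntegral_condEvent_expansion (hN : N.Valid) {u : Channels L → ℝ} {f : ℝ × ℝ × ℝ → ℝ}
    (hf : Measurable f) (hu : ∀ h, u h = f h.gains) (i j : ℕ) :
    ∫ h in N.condEvent,
        Real.exp (-(i * N.lrd * (N.gammaTh * N.No - N.Ps h * h.gainSD)) / N.harvested h) *
          Real.exp (-(j * N.lrp * N.Itemp) / N.harvested h) * u h ^ j ∂N.law =
      ∫ z in N.decodeSet, N.kernel (N.a * j) (N.lrd / N.beta * i) z * f z ^ j ∂N.gainsLaw := by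
  rw [← setIntegral_condEvent hN
    (f := fun z => N.kernel (N.a * j) (N.lrd / N.beta * i) z * f z ^ j)
    ((measurable_kernel _ _).mul (hf.pow_const j))]
  refine integral_congr_ae ?_
  filter_upwards [ae_restrict_of_ae (law_ae_pos hN)] with h hh
  rw [hu, exp_mul_exp_eq_kernel hN hh.1 hh.2.1]

/-- A constant inner term leaves the integral as t^j, so only kernels remain to be integrated. -/
theorem p2Approx_eq (hN : N.Valid) (m : ℝ) : N.p2Approx m = N.p2Closed (N.innerTerm m) := by
  rw [p2Approx, expansion, p2Closed]
  refine Finset.sum_congr rfl fun i _ => Finset.sum_congr rfl fun j _ => ?_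
  rw [setIntegral_condEvent_expansion hN (f := fun _ => N.innerTerm m) measurable_const
    (fun _ => rfl), integral_mul_const, setIntegral_kernel_eq_closedTerm hN, mul_comm _ (_ ^ j),
    ← mul_assoc]
  rfl

/-- Conditional outage probability of one antenna, given the other gains. -/
def antennaOutage (N : Network L) (z : ℝ × ℝ × ℝ) : ℝ :=
  1 - N.kernel 0 (N.lrd / N.beta) z * (1 - N.kernel N.a 0 z * N.innerGains z)

theorem measurable_antennaOutage : Measurable N.antennaOutage := by
  have h1 := measurable_kernel (N := N) 0 (N.lrd / N.beta)
  have h2 := measurable_kernel (N := N) N.a 0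
  have h3 := measurable_innerGains (N := N)
  unfold antennaOutage
  fun_prop

theorem kernel_mul_pow (i j : ℕ) (p q : ℝ) (z : ℝ × ℝ × ℝ) :
    N.kernel 0 q z ^ i * N.kernel p 0 z ^ j = N.kernel (p * j) (q * i) z := by
  simp only [kernel]
  rw [← Real.exp_nat_mul, ← Real.exp_nat_mul, ← Real.exp_add]
  ring_nf

theorem one_sub_mul_pow_eq_sum (n : ℕ) (x y : ℝ) :
    (1 - x * (1 - y)) ^ n = ∑ i ∈ Finset.range (n + 1), ∑ j ∈ Finset.range (i + 1),
      (n.choose i : ℝ) * (i.choose j : ℝ) * (-1) ^ (i + j) * (x ^ i * y ^ j) := by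
  rw [show 1 - x * (1 - y) = -x * (-y + 1) + 1 by ring, add_pow]
  refine Finset.sum_congr rfl fun i _ => ?_
  rw [one_pow, mul_one, mul_pow, add_pow, Finset.mul_sum, Finset.sum_mul]
  refine Finset.sum_congr rfl fun j _ => ?_
  rw [one_pow, mul_one, neg_pow, neg_pow y, pow_add]
  ring

theorem antennaOutage_pow (z : ℝ × ℝ × ℝ) :
    N.antennaOutage z ^ L = ∑ i ∈ Finset.range (L + 1), ∑ j ∈ Finset.range (i + 1),
      (L.choose i : ℝ) * (i.choose j : ℝ) * (-1) ^ (i + j) *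
        (N.kernel (N.a * j) (N.lrd / N.beta * i) z * N.innerGains z ^ j) := by
  rw [antennaOutage, one_sub_mul_pow_eq_sum]
  simp only [mul_pow, ← kernel_mul_pow, mul_assoc]

theorem sub_pos_of_mem_directSet (hN : N.Valid) {z : ℝ × ℝ × ℝ} (hz : 0 < z.2.1)
    (hd : z ∈ N.directSet) : 0 < N.gammaTh * N.No - N.Itemp / z.2.1 * z.2.2 := by
  have := (direct_lt_iff hN hz).2 hd
  rw [div_lt_iff₀ hN.No_pos] at this
  linarith

/-- The inner term is t/(1+t) with t > 0, hence at most 1 and at most t. The bound 1 gives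
integrability; the last bound, proportional to 1/λ_rp, drives the limit λ_rp → ∞. -/
theorem innerGains_mem (hN : N.Valid) {z : ℝ × ℝ × ℝ} (hX : 0 < z.2.1) (hY : 0 ≤ z.2.2)
    (hd : z ∈ N.directSet) :
    0 ≤ N.innerGains z ∧ N.innerGains z ≤ 1 ∧
      N.innerGains z ≤ N.lrd / (N.Itemp * N.lrp) * (N.gammaTh * N.No) := by
  have h0 := sub_pos_of_mem_directSet hN hX hd
  have h1 := hN.lrd_pos
  have h2 := hN.lrp_pos
  have h3 := hN.Itemp_pos
  have h4 : 0 < N.lrd / (N.Itemp * N.lrp) * (N.gammaTh * N.No - N.Itemp / z.2.1 * z.2.2) := by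
    positivity
  have h5 : N.lrd / (N.Itemp * N.lrp) * (N.gammaTh * N.No - N.Itemp / z.2.1 * z.2.2) ≤
      N.lrd / (N.Itemp * N.lrp) * (N.gammaTh * N.No) := by
    gcongr
    have : 0 ≤ N.Itemp / z.2.1 * z.2.2 := by positivity
    linarith
  rw [innerGains, innerTerm]
  generalize N.lrd / (N.Itemp * N.lrp) * (N.gammaTh * N.No - N.Itemp / z.2.1 * z.2.2) = t at *
  have h6 : 1 - 1 / (1 + t) = t / (1 + t) := by
    field_simp
    ring
  rw [h6]
  refine ⟨by positivity, ?_, (div_le_self h4.le (by linarith)).trans h5⟩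
  rw [div_le_one (by positivity)]
  linarith

theorem integrableOn_kernel_mul_innerGains (hN : N.Valid) (i j : ℕ) :
    IntegrableOn (fun z => N.kernel (N.a * j) (N.lrd / N.beta * i) z * N.innerGains z ^ j)
      N.decodeSet N.gainsLaw := by
  have := isProbabilityMeasure_gainsLaw hN
  have := a_pos hN
  have := hN.lrd_pos
  have := hN.beta_pos
  refine Integrable.mono' (integrable_const 1)
    ((measurable_kernel _ _).mul (measurable_innerGains.pow_const j)).aestronglyMeasurable ?_
  filter_upwards [ae_restrict_of_ae (gainsLaw_ae_pos hN),
    ae_restrict_mem measurableSet_decodeSet] with z hz hd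
  obtain ⟨h0, h1, -⟩ := innerGains_mem hN hz.2.1 hz.2.2.le hd.2
  rw [Real.norm_eq_abs, abs_of_nonneg (mul_nonneg (kernel_pos _ _ _).le (by positivity))]
  exact mul_le_one₀ (kernel_le_one (by positivity) (by positivity) hz hd.2) (by positivity)
    (pow_le_one₀ h0 h1)

/-- The antenna events of the relay, with interference constraint and direct link. -/
def antennaSet (N : Network L) : Set ((ℝ × ℝ × ℝ) × (ℝ × ℝ)) :=
  {p | min (N.beta * (N.Itemp / p.1.2.1) * p.1.1) (N.Itemp / p.2.2) * p.2.1 / N.No +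
    N.Itemp / p.1.2.1 * p.1.2.2 / N.No < N.gammaTh}

theorem measurableSet_antennaSet : MeasurableSet N.antennaSet :=
  measurableSet_lt (by fun_prop) measurable_const

theorem real_antennaSet (hN : N.Valid) {z : ℝ × ℝ × ℝ} (hS : 0 < z.1) (hX : 0 < z.2.1)
    (hd : z ∈ N.directSet) :
    ((expMeasure N.lrd).prod (expMeasure N.lrp)).real {w | (z, w) ∈ N.antennaSet} =
      N.antennaOutage z := by
  have hI := hN.Itemp_pos
  have hβ := hN.beta_pos
  have hNo := hN.No_pos
  have hr := sub_pos_of_mem_directSet hN hX hd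
  have hset : {w : ℝ × ℝ | (z, w) ∈ N.antennaSet} =
      {w | min (N.beta * (N.Itemp / z.2.1) * z.1) (N.Itemp / w.2) * w.1 <
        N.gammaTh * N.No - N.Itemp / z.2.1 * z.2.2} := by
    ext w
    simp only [antennaSet, Set.mem_ofPred_eq]
    rw [← add_div, div_lt_iff₀ hNo, lt_sub_iff_add_lt]
  rw [hset, real_min_mul_lt hN.lrd_pos hN.lrp_pos hI (by positivity) hr, antennaOutage, innerGains,
    innerTerm]
  have e1 : -(N.lrd * (N.gammaTh * N.No - N.Itemp / z.2.1 * z.2.2) /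
      (N.beta * (N.Itemp / z.2.1) * z.1)) =
      -(0 * z.2.1 + N.lrd / N.beta * (N.psi * z.2.1 - z.2.2)) / z.1 := by
    rw [← psi_mul_Itemp hN]
    field_simp
    ring
  have e2 : -(N.lrp * N.Itemp / (N.beta * (N.Itemp / z.2.1) * z.1)) =
      -(N.a * z.2.1 + 0 * (N.psi * z.2.1 - z.2.2)) / z.1 := by
    rw [a]
    field_simp
    ring
  rw [e1, e2]
  rfl

/-- A finite nonempty family attains its supremum, so strict inequality passes in both directions;
this uses L ≥ 1. -/
theorem snr_lt_iff (hN : N.Valid) (f : Fin L → ℝ) (γ : ℝ) : (⨆ j, f j) < γ ↔ ∀ j, f j < γ := by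
  have : Nonempty (Fin L) := ⟨⟨0, hN.one_le_L⟩⟩
  refine ⟨fun h j => (le_ciSup (Set.finite_range f).bddAbove j).trans_lt h, fun h => ?_⟩
  obtain ⟨j, hj⟩ := exists_eq_ciSup_of_finite (f := f)
  exact hj ▸ h j

theorem relaySet_ae_eq (hN : N.Valid) :
    {z | N.gammaTh ≤ N.xi * (N.Itemp / z.2.1) * z.1 / N.No} =ᵐ[N.gainsLaw] N.relaySet := by
  filter_upwards [gainsLaw_ae_pos hN] with z hz
  exact propext (le_snr_iff hN hz.2.1)

theorem measurableSet_snr_ge :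
    MeasurableSet {z : ℝ × ℝ × ℝ | N.gammaTh ≤ N.xi * (N.Itemp / z.2.1) * z.1 / N.No} :=
  measurableSet_le measurable_const (by fun_prop)

/-- Applied to conditional antenna outage probabilities: these vanish when the direct link suffices
by itself, and 0^L = 0 since L ≥ 1. The integral therefore only sees the outage region of the direct
link. -/
theorem setIntegral_relaySet_eq_decodeSet (hN : N.Valid) {f q : ℝ × ℝ × ℝ → ℝ}
    (h1 : ∀ z ∈ N.directSet, 0 < z.1 → 0 < z.2.1 → q z = f z)
    (h2 : ∀ z ∉ N.directSet, 0 < z.1 → 0 < z.2.1 → q z = 0) :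
    ∫ z in N.relaySet, q z ^ L ∂N.gainsLaw = ∫ z in N.decodeSet, f z ^ L ∂N.gainsLaw := by
  have hL : L ≠ 0 := by have := hN.one_le_L; omega
  rw [← integral_indicator measurableSet_relaySet, ← integral_indicator measurableSet_decodeSet]
  refine integral_congr_ae ?_
  filter_upwards [gainsLaw_ae_pos hN] with z hz
  by_cases hr : z ∈ N.relaySet <;> by_cases hd : z ∈ N.directSet <;>
    simp [Set.indicator, decodeSet, hr, hd]
  · rw [h1 z hd hz.1 hz.2.1]
  · exact ⟨h2 z hd hz.1 hz.2.1, hL⟩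

theorem real_antennas_eq_zero (hN : N.Valid) {A : Set (ℝ × ℝ)}
    (hA : ∀ w : ℝ × ℝ, 0 < w.1 → 0 < w.2 → w ∉ A) :
    ((expMeasure N.lrd).prod (expMeasure N.lrp)).real A = 0 := by
  have := isProbabilityMeasure_expMeasure hN.lrd_pos
  have := isProbabilityMeasure_expMeasure hN.lrp_pos
  have hae : ∀ᵐ w ∂((expMeasure N.lrd).prod (expMeasure N.lrp)), w ∉ A := by
    filter_upwards [Measure.quasiMeasurePreserving_fst.ae (expMeasure_ae_pos N.lrd),
      Measure.quasiMeasurePreserving_snd.ae (expMeasure_ae_pos N.lrp)] with w h1 h2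
    exact hA w h1 h2
  have : ((expMeasure N.lrd).prod (expMeasure N.lrp)) A = 0 := by
    simpa [ae_iff] using hae
  rw [Measure.real, this, ENNReal.toReal_zero]

theorem le_direct_of_notMem (hN : N.Valid) {z : ℝ × ℝ × ℝ} (hX : 0 < z.2.1)
    (hd : z ∉ N.directSet) {x : ℝ} (hx : 0 ≤ x) :
    ¬ (x / N.No + N.Itemp / z.2.1 * z.2.2 / N.No < N.gammaTh) := by
  have h := not_lt.1 (mt (direct_lt_iff hN hX).1 hd)
  have := div_nonneg hx hN.No_pos.le
  linarith

theorem p2_eq_setIntegral (hN : N.Valid) :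
    N.p2 = ∫ z in N.decodeSet, N.antennaOutage z ^ L ∂N.gainsLaw := by
  have hI := hN.Itemp_pos
  have hβ := hN.beta_pos
  have h1 : {h | N.snrD h < N.gammaTh ∧ N.gammaTh ≤ N.snrR h} =
      {h : Channels L | (∀ j, (h.gains, (h.gainRD j, h.gainRP j)) ∈ N.antennaSet) ∧
        h.gains ∈ {z | N.gammaTh ≤ N.xi * (N.Itemp / z.2.1) * z.1 / N.No}} := by
    ext h
    exact and_congr_left' (snr_lt_iff hN _ _)
  rw [p2, h1, law_real_forall_antenna hN measurableSet_antennaSet measurableSet_snr_ge,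
    setIntegral_congr_set (relaySet_ae_eq hN)]
  refine setIntegral_relaySet_eq_decodeSet hN
    (fun z hd hS hX => real_antennaSet hN hS hX hd) fun z hd hS hX => ?_
  refine real_antennas_eq_zero hN fun w hU hV => le_direct_of_notMem hN hX hd ?_
  exact mul_nonneg (le_min (by positivity) (by positivity)) hU.le

theorem p2_eq_expansion (hN : N.Valid) :
    N.p2 = N.expansion (fun h => N.innerTerm (N.Ps h * h.gainSD)) := by
  rw [p2_eq_setIntegral hN]
  simp_rw [antennaOutage_pow]
  rw [integral_finsetSum _ fun i _ => integrable_finsetSum _ fun j _ =>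
    (integrableOn_kernel_mul_innerGains hN i j).const_mul _, expansion]
  refine Finset.sum_congr rfl fun i _ => ?_
  rw [integral_finsetSum _ fun j _ => (integrableOn_kernel_mul_innerGains hN i j).const_mul _]
  refine Finset.sum_congr rfl fun j _ => ?_
  rw [integral_const_mul, ← setIntegral_condEvent_expansion hN
    (u := fun h => N.innerTerm (N.Ps h * h.gainSD)) measurable_innerGains fun _ => rfl]

/-- The antenna events without interference constraint. -/
def antennaSetUnconstrained (N : Network L) : Set ((ℝ × ℝ × ℝ) × (ℝ × ℝ)) :=
  {p | N.beta * (N.Itemp / p.1.2.1) * p.1.1 * p.2.1 / N.No +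
    N.Itemp / p.1.2.1 * p.1.2.2 / N.No < N.gammaTh}

theorem measurableSet_antennaSetUnconstrained : MeasurableSet N.antennaSetUnconstrained :=
  measurableSet_lt (by fun_prop) measurable_const

theorem real_antennaSetUnconstrained (hN : N.Valid) {z : ℝ × ℝ × ℝ} (hS : 0 < z.1)
    (hX : 0 < z.2.1) (hd : z ∈ N.directSet) :
    ((expMeasure N.lrd).prod (expMeasure N.lrp)).real {w | (z, w) ∈ N.antennaSetUnconstrained} =
      1 - N.kernel 0 (N.lrd / N.beta) z := by
  have hI := hN.Itemp_pos
  have hβ := hN.beta_pos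
  have hNo := hN.No_pos
  have hset : {w : ℝ × ℝ | (z, w) ∈ N.antennaSetUnconstrained} =
      {w | N.beta * (N.Itemp / z.2.1) * z.1 * w.1 <
        N.gammaTh * N.No - N.Itemp / z.2.1 * z.2.2} := by
    ext w
    simp only [antennaSetUnconstrained, Set.mem_ofPred_eq]
    rw [← add_div, div_lt_iff₀ hNo, lt_sub_iff_add_lt]
  rw [hset, real_mul_lt hN.lrd_pos hN.lrp_pos (by positivity) (sub_pos_of_mem_directSet hN hX hd),
    kernel, ← psi_mul_Itemp hN]
  congr 2
  field_simp
  ring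

/-- The sum of the terms that remain without interference constraint. -/
theorem p2Unconstrained_eq_sum (hN : N.Valid) :
    N.p2Unconstrained =
      ∑ i ∈ Finset.range (L + 1), (L.choose i : ℝ) * (-1) ^ i * N.closedTerm i 0 := by
  have hI := hN.Itemp_pos
  have hβ := hN.beta_pos
  have hκ := hN.lrd_pos
  have h1 : {h | N.snrDUnconstrained h < N.gammaTh ∧ N.gammaTh ≤ N.snrR h} =
      {h : Channels L | (∀ j, (h.gains, (h.gainRD j, h.gainRP j)) ∈ N.antennaSetUnconstrained) ∧
        h.gains ∈ {z | N.gammaTh ≤ N.xi * (N.Itemp / z.2.1) * z.1 / N.No}} := by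
    ext h
    exact and_congr_left' (snr_lt_iff hN _ _)
  rw [p2Unconstrained, h1, law_real_forall_antenna hN measurableSet_antennaSetUnconstrained
    measurableSet_snr_ge, setIntegral_congr_set (relaySet_ae_eq hN),
    setIntegral_relaySet_eq_decodeSet hN (f := fun z => 1 - N.kernel 0 (N.lrd / N.beta) z)
      (fun z hd hS hX => real_antennaSetUnconstrained hN hS hX hd) fun z hd hS hX => ?_]
  · have h2 : ∀ z, (1 - N.kernel 0 (N.lrd / N.beta) z) ^ L =
        ∑ i ∈ Finset.range (L + 1), (L.choose i : ℝ) * (-1) ^ i *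
          N.kernel (N.a * (0 : ℕ)) (N.lrd / N.beta * i) z := fun z => by
      rw [sub_eq_neg_add, add_pow]
      refine Finset.sum_congr rfl fun i _ => ?_
      rw [← kernel_mul_pow, pow_zero, neg_pow]
      ring
    simp_rw [h2]
    rw [integral_finsetSum _ fun i _ =>
      (integrableOn_kernel hN (by simp) (by positivity)).const_mul _]
    refine Finset.sum_congr rfl fun i _ => ?_
    rw [integral_const_mul, setIntegral_kernel_eq_closedTerm hN]
  · exact real_antennas_eq_zero hN fun w hU hV => le_direct_of_notMem hN hX hd (by positivity)

/-- For j = 0 the denominator is D_i0 = iF/β, so one factor i cancels against the squares. The last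
bracket is kept apart because it does not depend on i. -/
theorem closedTerm_zero_right (hN : N.Valid) {i : ℕ} (hi : 1 ≤ i) :
    N.closedTerm i 0 =
      N.lsr ^ L * N.lrd ^ 2 * N.lsp /
        (N.beta * N.lsd ^ 2 * (L - 1).factorial * (N.lrd * N.lsp / N.lsd + N.lrd * N.psi)) *
      ((∑ k ∈ Finset.range (L - 1), i * Real.Gamma ((L : ℝ) - 1 - k) * (N.d * i) ^ k *
          (N.B1 ^ ((k : ℤ) - L + 1)
            - Real.exp (-(N.lrd * i * N.xi) / N.beta) * N.B2 ^ ((k : ℤ) - L + 1)))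
        + i * (N.d * i) ^ (L - 1) *
          Real.exp (-(N.d * i * N.B2) - N.lrd * i * N.xi / N.beta) *
            (expIntegralEi (N.d * i * N.B2) - expIntegralEi (N.d * i * N.B1)))
      - N.lrd ^ 2 * N.lsr * i * N.psi ^ 2 /
          (N.beta * N.lsp * (N.lrd * N.lsp / N.lsd + N.lrd * N.psi)) *
        Real.exp (N.lrd * N.lsr * i * N.psi / (N.beta * N.lsp)) *
          (genExpIntegral L (N.lrd * N.lsr * i * N.psi / (N.beta * N.lsp))
            - (N.lsr / N.B2) ^ (L - 1) *
              genExpIntegral L (N.lrd * i * N.psi / (N.beta * N.lsp) * N.B2))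
      - Real.exp (-(N.lrd * i * N.xi) / N.beta) * (N.lsr / N.B2) ^ L
      + (N.lsp / (N.c + N.lsp) * (N.lsr / N.B1) ^ L + N.c / (N.c + N.lsp)) := by
  have hi0 : (0 : ℝ) < i := by exact_mod_cast hi
  have hα := hN.lsp_pos
  have hβ := hN.beta_pos
  have hsd := hN.lsd_pos
  have hrd := hN.lrd_pos
  have hψ := psi_pos hN
  have hfac : (0 : ℝ) < (L - 1).factorial := by positivity
  have e1 : -N.g * (N.a * (0 : ℕ) + N.b * i) = -(N.lrd * i * N.xi) / N.beta := by
    rw [g, b, Nat.cast_zero]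
    field_simp
    ring
  have e2 : (N.a * (0 : ℕ) + N.b * i) / N.lsp * N.lsr =
      N.lrd * N.lsr * i * N.psi / (N.beta * N.lsp) := by
    rw [b, Nat.cast_zero]
    field_simp
    ring
  have e3 : (N.a * (0 : ℕ) + N.b * i) / N.lsp * N.B2 =
      N.lrd * i * N.psi / (N.beta * N.lsp) * N.B2 := by
    rw [b, Nat.cast_zero]
    field_simp
    ring
  have e4 : N.lsr * (N.a * (0 : ℕ) + N.b * i) ^ 2 /
      (N.lsp * (N.a * (0 : ℕ) + N.b * i + N.d * N.lsp * i)) =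
      N.lrd ^ 2 * N.lsr * i * N.psi ^ 2 /
        (N.beta * N.lsp * (N.lrd * N.lsp / N.lsd + N.lrd * N.psi)) := by
    rw [b, d, Nat.cast_zero, mul_zero, zero_add]
    field_simp
    ring
  have e5 : N.lsr ^ L * N.lsp * (N.d * i) ^ 2 /
      ((L - 1).factorial * (N.a * (0 : ℕ) + N.b * i + N.d * N.lsp * i)) =
      N.lsr ^ L * N.lrd ^ 2 * N.lsp /
        (N.beta * N.lsd ^ 2 * (L - 1).factorial * (N.lrd * N.lsp / N.lsd + N.lrd * N.psi)) * i := by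
    rw [b, d, Nat.cast_zero, mul_zero, zero_add]
    field_simp
    ring
  have e6 : N.termE1 i 0 = 0 := by simp [termE1]
  rw [closedTerm, e6, termEi, termE2, e1, e2, e3, e4, e5, sub_eq_add_neg (-(N.d * i * N.B2)),
    Real.exp_add, ← neg_div]
  simp only [Nat.cast_zero, mul_zero, Real.exp_zero, one_mul, mul_one, mul_assoc (i : ℝ),
    ← Finset.mul_sum]
  ring

theorem closedTerm_zero_zero :
    N.closedTerm 0 0 = -(N.lsr / N.B2) ^ L +
      (N.lsp / (N.c + N.lsp) * (N.lsr / N.B1) ^ L + N.c / (N.c + N.lsp)) := by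
  simp [closedTerm, termEi, termE1, termE2]
  ring

/-- The part of the summands independent of i occurs for every i including 0, and the alternating
sum of binomial coefficients vanishes for L ≥ 1. From i = 0 only -(λ_sr/B₂)^L remains. -/
theorem sum_closedTerm_eq (hN : N.Valid) :
    ∑ i ∈ Finset.range (L + 1), (L.choose i : ℝ) * (-1) ^ i * N.closedTerm i 0 =
      N.p2ClosedUnconstrained := by
  have hsum : ∑ i ∈ Finset.range (L + 1), (L.choose i : ℝ) * (-1 : ℝ) ^ i = 0 := by
    have := add_pow (-1 : ℝ) 1 L
    rw [neg_add_cancel, zero_pow (by have := hN.one_le_L; omega)] at this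
    rw [this]
    exact Finset.sum_congr rfl fun i _ => by rw [one_pow]; ring
  have hIcc : Finset.range (L + 1) = insert 0 (Finset.Icc 1 L) := by
    ext i
    simp only [Finset.mem_range, Finset.mem_insert, Finset.mem_Icc]
    omega
  have h0 : (0 : ℕ) ∉ Finset.Icc 1 L := by simp
  rw [hIcc, Finset.sum_insert h0] at hsum ⊢
  rw [p2ClosedUnconstrained, closedTerm_zero_zero, Finset.sum_congr rfl fun i hi => by
    rw [closedTerm_zero_right hN (Finset.mem_Icc.1 hi).1, mul_add], Finset.sum_add_distrib,
    ← Finset.sum_mul]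
  simp only [Nat.choose_zero_right, Nat.cast_one, pow_zero, mul_one, one_mul] at hsum ⊢
  have hsum' := eq_neg_of_add_eq_zero_right hsum
  simp only [mul_comm ((L.choose _ : ℕ) : ℝ)] at hsum' ⊢
  rw [hsum']
  ring

theorem p2Unconstrained_eq (hN : N.Valid) : N.p2Unconstrained = N.p2ClosedUnconstrained := by
  rw [p2Unconstrained_eq_sum hN, sum_closedTerm_eq hN]

/-- The antenna events without direct link. -/
def antennaSetNoDirect (N : Network L) : Set ((ℝ × ℝ × ℝ) × (ℝ × ℝ)) :=
  {p | min (N.beta * (N.Itemp / p.1.2.1) * p.1.1) (N.Itemp / p.2.2) * p.2.1 / N.No < N.gammaTh}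

theorem measurableSet_antennaSetNoDirect : MeasurableSet N.antennaSetNoDirect :=
  measurableSet_lt (by fun_prop) measurable_const

theorem mem_directSet_zero (hN : N.Valid) {s x : ℝ} (hx : 0 < x) :
    ((s, x, 0) : ℝ × ℝ × ℝ) ∈ N.directSet :=
  mul_pos (psi_pos hN) hx

/-- Dropping the direct link amounts to setting y = 0 in the antenna events, and for x > 0 such
points always lie in `directSet`. -/
theorem p2NoDirect_eq_setIntegral (hN : N.Valid) :
    N.p2NoDirect = ∫ z in N.relaySet, N.antennaOutage (z.1, z.2.1, 0) ^ L ∂N.gainsLaw := by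
  have h1 : {h | N.snrDNoDirect h < N.gammaTh ∧ N.gammaTh ≤ N.snrR h} =
      {h : Channels L | (∀ j, (h.gains, (h.gainRD j, h.gainRP j)) ∈ N.antennaSetNoDirect) ∧
        h.gains ∈ {z | N.gammaTh ≤ N.xi * (N.Itemp / z.2.1) * z.1 / N.No}} := by
    ext h
    exact and_congr_left' (snr_lt_iff hN _ _)
  rw [p2NoDirect, h1, law_real_forall_antenna hN measurableSet_antennaSetNoDirect
    measurableSet_snr_ge, setIntegral_congr_set (relaySet_ae_eq hN)]
  refine integral_congr_ae ?_
  filter_upwards [ae_restrict_of_ae (gainsLaw_ae_pos hN)] with z hz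
  rw [← real_antennaSet hN (z := (z.1, z.2.1, 0)) hz.1 hz.2.1 (mem_directSet_zero hN hz.2.1)]
  simp [antennaSet, antennaSetNoDirect]

theorem innerGains_zero (hN : N.Valid) (s x : ℝ) : N.innerGains (s, x, 0) = N.tNoDirect := by
  have := hN.Itemp_pos.ne'
  have := hN.lrp_pos.ne'
  rw [innerGains, innerTerm, tNoDirect, mul_zero, sub_zero, ← psi_mul_Itemp hN, one_div]
  congr 3
  field_simp

theorem p2NoDirect_eq (hN : N.Valid) : N.p2NoDirect = N.p2ClosedNoDirect := by
  have ha := a_pos hN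
  have hκ := hN.lrd_pos
  have hβ := hN.beta_pos
  rw [p2NoDirect_eq_setIntegral hN]
  simp_rw [antennaOutage_pow, innerGains_zero hN]
  have hi : ∀ i j : ℕ, IntegrableOn (fun z => (L.choose i : ℝ) * (i.choose j : ℝ) * (-1) ^ (i + j) *
      (N.kernel (N.a * j) (N.lrd / N.beta * i) (z.1, z.2.1, 0) * N.tNoDirect ^ j))
      N.relaySet N.gainsLaw := fun i j =>
    ((integrableOn_kernel_zero hN (by positivity) (by positivity)).mul_const _).const_mul _
  rw [integral_finsetSum _ fun i _ => integrable_finsetSum _ fun j _ => hi i j,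
    p2ClosedNoDirect]
  refine Finset.sum_congr rfl fun i _ => ?_
  rw [integral_finsetSum _ fun j _ => hi i j]
  refine Finset.sum_congr rfl fun j _ => ?_
  rw [integral_const_mul, integral_mul_const, setIntegral_kernel_eq_closedTermNoDirect hN,
    mul_comm _ (_ ^ j), ← mul_assoc]
  rfl

end Network

/-! ### Truncated and conditional mean of the direct power -/

theorem integrable_prod_exp_neg_mul {Ω : Type*} [MeasurableSpace Ω] {μ : Measure Ω}
    [IsFiniteMeasure μ] {X : Ω → ℝ} (hX : Measurable X) (hpos : ∀ᵐ ω ∂μ, 0 < X ω) (c : ℝ) :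
    Integrable (Function.uncurry fun ω t => Real.exp (-(t * X ω)))
      (μ.prod (volume.restrict (Set.Ioc 0 c))) := by
  refine Integrable.mono' (integrable_const 1)
    (Measurable.aestronglyMeasurable (by unfold Function.uncurry; fun_prop)) ?_
  filter_upwards [Measure.quasiMeasurePreserving_fst.ae hpos,
    Measure.quasiMeasurePreserving_snd.ae (ae_restrict_mem measurableSet_Ioc)] with p h1 h2
  rw [Function.uncurry, Real.norm_eq_abs, abs_of_pos (Real.exp_pos _), Real.exp_le_one_iff,
    neg_nonpos]
  exact (mul_pos h2.1 h1).le

/-- The inner integral stands for (1 - e^{-cX})/X; after the exchange, the expectation of this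
quotient is an integral of Laplace transforms over t. -/
theorem integral_intervalIntegral_exp_neg_mul {Ω : Type*} [MeasurableSpace Ω] {μ : Measure Ω}
    [IsFiniteMeasure μ] {X : Ω → ℝ} (hX : Measurable X) (hpos : ∀ᵐ ω ∂μ, 0 < X ω) {c : ℝ}
    (hc : 0 ≤ c) :
    Integrable (fun ω => ∫ t in (0 : ℝ)..c, Real.exp (-(t * X ω))) μ ∧
    ∫ ω, (∫ t in (0 : ℝ)..c, Real.exp (-(t * X ω))) ∂μ =
      ∫ t in (0 : ℝ)..c, ∫ ω, Real.exp (-(t * X ω)) ∂μ := by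
  have h := integrable_prod_exp_neg_mul hX hpos c
  simp_rw [intervalIntegral.integral_of_le hc]
  exact ⟨h.integral_prod_left, integral_integral_swap h⟩

theorem integrable_exp_neg_mul {Ω : Type*} [MeasurableSpace Ω] {μ : Measure Ω}
    [IsFiniteMeasure μ] {X : Ω → ℝ} (hX : Measurable X) (hpos : ∀ᵐ ω ∂μ, 0 < X ω) {c : ℝ}
    (hc : 0 ≤ c) : Integrable (fun ω => Real.exp (-(c * X ω))) μ := by
  refine Integrable.mono' (integrable_const 1) (Measurable.aestronglyMeasurable (by fun_prop)) ?_
  filter_upwards [hpos] with ω h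
  rw [Real.norm_eq_abs, abs_of_pos (Real.exp_pos _), Real.exp_le_one_iff, neg_nonpos]
  exact mul_nonneg hc h.le

theorem integral_div_add {α c : ℝ} (hα : 0 < α) (hc : 0 ≤ c) :
    ∫ t in (0 : ℝ)..c, α / (α + t) = α * Real.log (c / α + 1) := by
  have hpos : ∀ t ∈ Set.uIcc 0 c, 0 < α + t := fun t ht => by
    rw [Set.uIcc_of_le hc] at ht; linarith [ht.1]
  have hd : ∀ t ∈ Set.uIcc 0 c, HasDerivAt (fun t => α * Real.log (α + t)) (α / (α + t)) t := by
    intro t ht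
    have h1 : HasDerivAt (fun t => α + t) 1 t := (hasDerivAt_id t).const_add α
    exact ((h1.log (hpos t ht).ne').const_mul α).congr_deriv (by ring)
  rw [intervalIntegral.integral_eq_sub_of_hasDerivAt hd, ← mul_sub, add_zero,
    ← Real.log_div (by positivity) hα.ne', add_div, div_self hα.ne', add_comm]
  refine ContinuousOn.intervalIntegrable fun t ht => ?_
  have := (hpos t ht).ne'
  exact (by fun_prop (disch := assumption) : ContinuousAt _ t).continuousWithinAt

/-- With w = α + μ + t and q = μ/w one has 1 - q = (α+t)/w, so the geometric sum rewrites (1 -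
q^L)/(α+t) as (1/w) ∑_{k<L} q^k. The term k = 0 integrates to the logarithm, the others to powers of
w. -/
theorem integral_div_add_mul_one_sub_pow {α c μ : ℝ} (L : ℕ) (hα : 0 < α) (hc : 0 ≤ c)
    (hμ : 0 < μ) (hL : 1 ≤ L) :
    ∫ t in (0 : ℝ)..c, α / (α + t) * (1 - (μ / (μ + (α + t))) ^ L) =
      α * (Real.log (1 + c / (α + μ)) + ∑ k ∈ Finset.Icc 1 (L - 1), μ ^ k / k *
        (1 / (α + μ) ^ k - 1 / (α + μ + c) ^ k)) := by
  have hpos : ∀ t ∈ Set.uIcc 0 c, 0 < α + t := fun t ht => by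
    rw [Set.uIcc_of_le hc] at ht; linarith [ht.1]
  have hd : ∀ t ∈ Set.uIcc 0 c, HasDerivAt (fun t => α * (Real.log (α + μ + t) -
      ∑ k ∈ Finset.Icc 1 (L - 1), μ ^ k / k * ((α + μ + t) ^ k)⁻¹))
      (α / (α + t) * (1 - (μ / (μ + (α + t))) ^ L)) t := by
    intro t ht
    have h0 := hpos t ht
    have hw : 0 < α + μ + t := by linarith
    have h1 : HasDerivAt (fun t => α + μ + t) 1 t := (hasDerivAt_id t).const_add _
    have h2 : ∀ k ∈ Finset.Icc 1 (L - 1),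
        HasDerivAt (fun t => μ ^ k / k * ((α + μ + t) ^ k)⁻¹)
          (-(1 / (α + μ + t) * (μ / (α + μ + t)) ^ k)) t := by
      intro k hk
      have hk0 : k ≠ 0 := by have := (Finset.mem_Icc.1 hk).1; omega
      have hk0' : (k : ℝ) ≠ 0 := Nat.cast_ne_zero.2 hk0
      obtain ⟨n, rfl⟩ := Nat.exists_eq_succ_of_ne_zero hk0
      refine (((h1.pow (n + 1)).inv (pow_ne_zero _ hw.ne')).const_mul _).congr_deriv ?_
      simp only [Nat.succ_eq_add_one, Nat.add_sub_cancel, Pi.pow_apply] at hk0' ⊢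
      rw [div_pow]
      field_simp
      ring
    have h3 := ((h1.log hw.ne').sub (HasDerivAt.fun_sum h2)).const_mul α
    refine h3.congr_deriv ?_
    obtain ⟨n, rfl⟩ : ∃ n, L = n + 1 := ⟨L - 1, by omega⟩
    have hgeom := mul_neg_geom_sum (μ / (α + μ + t)) (n + 1)
    have hrange : Finset.range (n + 1) = insert 0 (Finset.Icc 1 n) := by
      ext i
      simp only [Finset.mem_range, Finset.mem_insert, Finset.mem_Icc]
      omega
    rw [hrange, Finset.sum_insert (by simp), pow_zero] at hgeom
    rw [Nat.add_sub_cancel, Finset.sum_neg_distrib, ← Finset.mul_sum, sub_neg_eq_add, ← mul_one_add,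
      show μ + (α + t) = α + μ + t by ring, ← hgeom]
    have : 1 - μ / (α + μ + t) = (α + t) / (α + μ + t) := by
      field_simp
      ring
    rw [this]
    field_simp
  rw [intervalIntegral.integral_eq_sub_of_hasDerivAt hd, ← mul_sub]
  · congr 1
    have h1 : (0 : ℝ) < α + μ := by positivity
    rw [sub_sub_sub_comm, ← Real.log_div (by positivity) (by positivity), ← Finset.sum_sub_distrib,
      sub_eq_add_neg, ← Finset.sum_neg_distrib, add_zero, add_div, div_self h1.ne']
    congr 1
    refine Finset.sum_congr rfl fun k _ => ?_
    simp only [one_div]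
    ring
  · refine ContinuousOn.intervalIntegrable fun t ht => ?_
    have h1 := (hpos t ht).ne'
    have h2 : μ + (α + t) ≠ 0 := by have := hpos t ht; positivity
    exact (by fun_prop (disch := assumption) : ContinuousAt _ t).continuousWithinAt

namespace Network
variable {L : ℕ} {N : Network L}

/-- The y-integral contains (1 - e^{-cx})/x, which is written as an integral over t so that no 1/x
is left when x is integrated. -/
theorem inner_integral_direct (hN : N.Valid) {x : ℝ} (hx : 0 < x) :
    ∫ y in Set.Iio (N.psi * x), N.Itemp / x * y ∂(expMeasure N.lsd) =
      N.Itemp * (1 / N.lsd * (∫ t in (0 : ℝ)..N.c, Real.exp (-(t * x))) -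
        N.psi * Real.exp (-(N.c * x))) := by
  have hsd := hN.lsd_pos
  have h1 := mul_integral_exp_neg_mul x N.c
  simp only [mul_comm x] at h1
  rw [setIntegral_expMeasure_Iio hsd (mul_pos (psi_pos hN) hx).le]
  have hd : ∀ y ∈ Set.uIcc 0 (N.psi * x),
      HasDerivAt (fun y => -(N.Itemp / x) * ((y + 1 / N.lsd) * Real.exp (-(N.lsd * y))))
        (N.lsd * Real.exp (-(N.lsd * y)) * (N.Itemp / x * y)) y := fun y _ => by
    have h2 : HasDerivAt (fun y => Real.exp (-(N.lsd * y)))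
        (Real.exp (-(N.lsd * y)) * (-(N.lsd * 1))) y :=
      (((hasDerivAt_id y).const_mul N.lsd).neg).exp
    refine ((((hasDerivAt_id y).add_const (1 / N.lsd)).mul h2).const_mul _).congr_deriv ?_
    simp only [id]
    field_simp
    ring
  rw [intervalIntegral.integral_eq_sub_of_hasDerivAt hd
    ((by fun_prop : Continuous fun y => N.lsd * Real.exp (-(N.lsd * y)) *
      (N.Itemp / x * y)).intervalIntegrable _ _), mul_zero, neg_zero, Real.exp_zero]
  have h3 : N.lsd * (N.psi * x) = N.c * x := by rw [c]; ring
  rw [h3]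
  have h4 : ∫ t in (0 : ℝ)..N.c, Real.exp (-(t * x)) = (1 - Real.exp (-(N.c * x))) / x := by
    rw [← h1, mul_div_cancel_right₀ _ hx.ne']
  rw [h4]
  field_simp
  ring

theorem directPower_le (hN : N.Valid) {z : ℝ × ℝ × ℝ} (hz : 0 < z.1 ∧ 0 < z.2.1 ∧ 0 < z.2.2)
    (hd : z ∈ N.directSet) :
    0 ≤ N.Itemp / z.2.1 * z.2.2 ∧ N.Itemp / z.2.1 * z.2.2 ≤ N.gammaTh * N.No := by
  obtain ⟨-, h2, h3⟩ := hz
  have := hN.Itemp_pos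
  exact ⟨by positivity, by linarith [sub_pos_of_mem_directSet hN h2 hd]⟩

theorem measurable_directPower :
    Measurable fun z : ℝ × ℝ × ℝ => N.Itemp / z.2.1 * z.2.2 := by
  fun_prop

theorem integrableOn_directPower (hN : N.Valid) :
    IntegrableOn (fun z => N.Itemp / z.2.1 * z.2.2) N.directSet N.gainsLaw := by
  have := isProbabilityMeasure_gainsLaw hN
  refine Integrable.mono' (integrable_const (N.gammaTh * N.No))
    measurable_directPower.aestronglyMeasurable ?_
  filter_upwards [ae_restrict_of_ae (gainsLaw_ae_pos hN),
    ae_restrict_mem measurableSet_directSet] with z hz hd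
  obtain ⟨h0, h1⟩ := directPower_le hN hz hd
  rwa [Real.norm_eq_abs, abs_of_nonneg h0]

theorem truncMean_eq_setIntegral (hN : N.Valid) :
    N.truncMean = ∫ z in N.directSet, N.Itemp / z.2.1 * z.2.2 ∂N.gainsLaw := by
  have hae : {h | N.Ps h * h.gainSD / N.No < N.gammaTh} =ᵐ[N.law]
      Channels.gains ⁻¹' N.directSet := by
    filter_upwards [law_ae_pos hN] with h hh
    exact propext (direct_lt_iff hN (z := h.gains) hh.2.1)
  rw [truncMean, setIntegral_congr_set hae, ← (measurePreserving_gains hN).map_eq,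
    setIntegral_map measurableSet_directSet measurable_directPower.aestronglyMeasurable
      measurable_gains.aemeasurable]
  rfl

theorem truncMean_eq (hN : N.Valid) :
    N.truncMean = N.Itemp * N.lsp / N.lsd *
      (Real.log (N.psi * N.lsd / N.lsp + 1) - N.psi * N.lsd / (N.psi * N.lsd + N.lsp)) := by
  have := isProbabilityMeasure_expMeasure hN.lsp_pos
  have hc := c_pos hN
  have hα := hN.lsp_pos
  have hsd := hN.lsd_pos
  rw [truncMean_eq_setIntegral hN, setIntegral_directSet hN
    (f := fun w => N.Itemp / w.1 * w.2) (integrableOn_directPower hN)]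
  have hae : ∀ᵐ x ∂(expMeasure N.lsp), ∫ y in Set.Iio (N.psi * x),
      N.Itemp / x * y ∂(expMeasure N.lsd) =
      N.Itemp * (1 / N.lsd * (∫ t in (0 : ℝ)..N.c, Real.exp (-(t * x))) -
        N.psi * Real.exp (-(N.c * x))) := by
    filter_upwards [expMeasure_ae_pos N.lsp] with x hx
    exact inner_integral_direct hN hx
  obtain ⟨hi, hs⟩ := integral_intervalIntegral_exp_neg_mul (μ := expMeasure N.lsp)
    measurable_id (expMeasure_ae_pos N.lsp) hc.le
  have hi2 := integrable_exp_neg_mul (μ := expMeasure N.lsp)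
    measurable_id (expMeasure_ae_pos N.lsp) hc.le
  simp only [id] at hi hs hi2
  have hΛ : ∫ t in (0 : ℝ)..N.c, ∫ x, Real.exp (-(t * x)) ∂(expMeasure N.lsp) =
      ∫ t in (0 : ℝ)..N.c, N.lsp / (N.lsp + t) := by
    refine intervalIntegral.integral_congr fun t ht => ?_
    rw [Set.uIcc_of_le hc.le] at ht
    exact laplace_expMeasure hα ht.1
  simp only
  rw [integral_congr_ae hae, integral_const_mul, integral_sub (hi.const_mul _) (hi2.const_mul _),
    integral_const_mul, integral_const_mul, hs, hΛ, laplace_expMeasure hα hc.le,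
    integral_div_add hα hc.le, c]
  rw [c] at hc
  field_simp
  ring

theorem innerTerm_eq (hN : N.Valid) (m : ℝ) :
    N.innerTerm (N.Itemp * m) = 1 - (1 + N.lrd / N.lrp * (N.psi - m))⁻¹ := by
  have := hN.Itemp_pos.ne'
  have := hN.lrp_pos.ne'
  rw [innerTerm, ← psi_mul_Itemp hN, one_div]
  congr 3
  field_simp

theorem setIntegral_relaySet_exp (hN : N.Valid) {t : ℝ} (ht : 0 ≤ t) :
    ∫ z in N.relaySet, Real.exp (-(t * z.2.1)) ∂N.gainsLaw =
      N.lsp / (N.lsp + t) * (1 - (N.lsr / (N.lsr + N.g * (N.lsp + t))) ^ L) := by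
  have := isProbabilityMeasure_gainsLaw hN
  have hα := hN.lsp_pos
  rw [setIntegral_relaySet hN (f := fun w => Real.exp (-(t * w.2))) (integrable_exp_neg_mul
    (by fun_prop) (ae_restrict_of_ae ((gainsLaw_ae_pos hN).mono fun z hz => hz.2.1)) ht)]
  have hae : ∀ᵐ s ∂(erlangLaw L N.lsr),
      ∫ x in Set.Iic (N.g * s), Real.exp (-(t * x)) ∂(expMeasure N.lsp) =
      N.lsp / (N.lsp + t) * (1 - Real.exp (-(((N.lsp + t) * s + 0) * N.g))) := by
    filter_upwards [erlangLaw_ae_pos hN.one_le_L hN.lsr_pos] with s hs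
    rw [setIntegral_expMeasure_exp hα ht (mul_pos (g_pos hN) hs).le]
    ring_nf
  simp only
  rw [integral_congr_ae hae, integral_const_mul, integral_erlangLaw_one_sub_exp hN.lsr_pos
    (by positivity) (g_pos hN).le]
  simp

theorem setIntegral_decodeSet_directPower (hN : N.Valid) :
    ∫ z in N.decodeSet, N.Itemp / z.2.1 * z.2.2 ∂N.gainsLaw = N.Itemp * N.lsp / N.lsd *
      (Real.log (1 + N.c / (N.lsp + N.lsr / N.g))
        + (∑ k ∈ Finset.Icc 1 (L - 1), (N.lsr / N.g) ^ k / k *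
            (1 / (N.lsp + N.lsr / N.g) ^ k - 1 / (N.lsp + N.lsr / N.g + N.c) ^ k))
        - N.c / (N.c + N.lsp) * (1 - (N.lsr / N.B1) ^ L)) := by
  have := isProbabilityMeasure_gainsLaw hN
  have hc := c_pos hN
  have hα := hN.lsp_pos
  have hsd := hN.lsd_pos
  have hg := g_pos hN
  have hr := hN.lsr_pos
  have hpos : ∀ᵐ z ∂(N.gainsLaw.restrict N.relaySet), 0 < z.2.1 :=
    ae_restrict_of_ae ((gainsLaw_ae_pos hN).mono fun z hz => hz.2.1)
  obtain ⟨hi, hs⟩ := integral_intervalIntegral_exp_neg_mul (μ := N.gainsLaw.restrict N.relaySet)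
    (X := fun z => z.2.1) (by fun_prop) hpos hc.le
  have hi2 := integrable_exp_neg_mul (μ := N.gainsLaw.restrict N.relaySet)
    (X := fun z => z.2.1) (by fun_prop) hpos hc.le
  have hstep : ∫ z in N.decodeSet, N.Itemp / z.2.1 * z.2.2 ∂N.gainsLaw =
      ∫ z in N.relaySet, N.Itemp * (1 / N.lsd * (∫ t in (0 : ℝ)..N.c, Real.exp (-(t * z.2.1))) -
        N.psi * Real.exp (-(N.c * z.2.1))) ∂N.gainsLaw := by
    rw [setIntegral_decodeSet hN ((integrableOn_directPower hN).mono_set Set.inter_subset_right),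
      setIntegral_relaySet hN (f := fun w => N.Itemp * (1 / N.lsd *
        (∫ t in (0 : ℝ)..N.c, Real.exp (-(t * w.2))) - N.psi * Real.exp (-(N.c * w.2))))
        (((hi.const_mul (1 / N.lsd)).sub (hi2.const_mul N.psi)).const_mul N.Itemp)]
    congr 1 with s
    refine integral_congr_ae (ae_restrict_of_ae ?_)
    filter_upwards [expMeasure_ae_pos N.lsp] with x hx
    exact inner_integral_direct hN hx
  -- Dividing by g brings the ratio to the form μ/(μ + λ_sp + t) with μ = λ_sr/g.
  have hB : ∀ t : ℝ, N.lsr / (N.lsr + N.g * (N.lsp + t)) =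
      (N.lsr / N.g) / (N.lsr / N.g + (N.lsp + t)) := fun t => by
    rw [show N.lsr + N.g * (N.lsp + t) = N.g * (N.lsr / N.g + (N.lsp + t)) by field_simp,
      div_mul_eq_div_div]
  have hΛ : ∫ t in (0 : ℝ)..N.c, ∫ z in N.relaySet, Real.exp (-(t * z.2.1)) ∂N.gainsLaw =
      ∫ t in (0 : ℝ)..N.c, N.lsp / (N.lsp + t) *
        (1 - ((N.lsr / N.g) / (N.lsr / N.g + (N.lsp + t))) ^ L) := by
    refine intervalIntegral.integral_congr fun t ht => ?_
    rw [Set.uIcc_of_le hc.le] at ht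
    rw [setIntegral_relaySet_exp hN ht.1, hB]
  rw [hstep, integral_const_mul, integral_sub (hi.const_mul _) (hi2.const_mul _),
    integral_const_mul, integral_const_mul, hs, hΛ, setIntegral_relaySet_exp hN hc.le,
    integral_div_add_mul_one_sub_pow L hα hc.le (by positivity) hN.one_le_L,
    add_comm N.lsp N.c, ← B1]
  have hψ : N.psi = N.c / N.lsd := by rw [c]; field_simp
  rw [hψ]
  field_simp

theorem law_real_condEvent (hN : N.Valid) :
    N.law.real N.condEvent = N.closedTerm 0 0 := by
  rw [← setIntegral_kernel_eq_closedTerm hN, measureReal_congr (condEvent_ae_eq hN), Measure.real,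
    (measurePreserving_gains hN).measure_preimage measurableSet_decodeSet.nullMeasurableSet]
  simp [kernel, Measure.real]

/-- The denominator is the probability of the conditioning event. This form serves both the explicit
formula and the limit λ_sd → ∞. -/
theorem condMean_eq_div (hN : N.Valid) :
    N.condMean = (∫ z in N.decodeSet, N.Itemp / z.2.1 * z.2.2 ∂N.gainsLaw) /
      N.closedTerm 0 0 := by
  rw [condMean, ProbabilityTheory.cond, integral_smul_measure, ← law_real_condEvent hN,
    ← setIntegral_condEvent hN measurable_directPower, ENNReal.toReal_inv, smul_eq_mul,
    inv_mul_eq_div]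
  rfl

theorem condMean_eq (hN : N.Valid) :
    N.condMean = N.Itemp * N.lsp / N.lsd *
      (Real.log (1 + N.c / (N.lsp + N.lsr / N.g))
        + (∑ k ∈ Finset.Icc 1 (L - 1), (N.lsr / N.g) ^ k / k *
            (1 / (N.lsp + N.lsr / N.g) ^ k - 1 / (N.lsp + N.lsr / N.g + N.c) ^ k))
        - N.c / (N.c + N.lsp) * (1 - (N.lsr / N.B1) ^ L)) /
      (1 - (N.lsr / N.B2) ^ L - N.lsp / (N.c + N.lsp) * (1 - (N.lsr / N.B1) ^ L)) := by
  have : N.closedTerm 0 0 =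
      1 - (N.lsr / N.B2) ^ L - N.lsp / (N.c + N.lsp) * (1 - (N.lsr / N.B1) ^ L) := by
    have := c_pos hN
    have := hN.lsp_pos
    rw [closedTerm_zero_zero, show N.c / (N.c + N.lsp) = 1 - N.lsp / (N.c + N.lsp) by
      field_simp; ring]
    ring
  rw [condMean_eq_div hN, setIntegral_decodeSet_directPower hN, this]

end Network

/-! ### Varying λ_sd on a fixed probability space -/

/-- Exponential laws of all rates are rescalings of one of them, as their distribution functions
show. A limit in the rate thus becomes a pointwise limit under a fixed law. -/
theorem map_mul_expMeasure {r r' : ℝ} (hr : 0 < r) (hr' : 0 < r') :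
    (expMeasure r).map (fun y => y * (r / r')) = expMeasure r' := by
  have := isProbabilityMeasure_expMeasure hr
  have := isProbabilityMeasure_expMeasure hr'
  have hm : Measurable fun y => y * (r / r') := by fun_prop
  have := Measure.isProbabilityMeasure_map (μ := expMeasure r) hm.aemeasurable
  refine Measure.ext_of_Iic _ _ fun x => ?_
  rw [Measure.map_apply hm measurableSet_Iic]
  have hset : (fun y => y * (r / r')) ⁻¹' Set.Iic x = Set.Iic (x * r' / r) := by
    ext y
    simp only [Set.mem_preimage, Set.mem_Iic]
    rw [le_div_iff₀ hr, ← mul_div_assoc, div_le_iff₀ hr']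
  rw [hset, ← ofReal_cdf, ← ofReal_cdf, cdf_expMeasure_eq hr, cdf_expMeasure_eq hr']
  have hiff : 0 ≤ x * r' / r ↔ 0 ≤ x := by
    rw [le_div_iff₀ hr, zero_mul]
    exact ⟨fun h => nonneg_of_mul_nonneg_left h hr', fun h => by positivity⟩
  have he : r * (x * r' / r) = r' * x := by field_simp
  simp only [hiff, he]

namespace Network
variable {L : ℕ} {N : Network L}

theorem Valid.with_lrp (hN : N.Valid) {x : ℝ} (hx : 0 < x) :
    ({N with lrp := x} : Network L).Valid :=
  ⟨hN.1, hN.2, hN.3, hx, hN.5, hN.6, hN.7, hN.8, hN.9, hN.10, hN.11⟩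

theorem Valid.with_lsd (hN : N.Valid) {x : ℝ} (hx : 0 < x) :
    ({N with lsd := x} : Network L).Valid :=
  ⟨hN.1, hN.2, hN.3, hN.4, hx, hN.6, hN.7, hN.8, hN.9, hN.10, hN.11⟩

theorem gainsLaw_with_lsd (hN : N.Valid) {x : ℝ} (hx : 0 < x) :
    ({N with lsd := x} : Network L).gainsLaw =
      N.gainsLaw.map fun z => (z.1, z.2.1, z.2.2 * (N.lsd / x)) := by
  have := isProbabilityMeasure_expMeasure hN.lsd_pos
  have := isProbabilityMeasure_expMeasure hN.lsp_pos
  have := isProbabilityMeasure_expMeasure hx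
  have := isProbabilityMeasure_erlangLaw L hN.lsr_pos
  have h1 : MeasurePreserving (fun y => y * (N.lsd / x)) (expMeasure N.lsd) (expMeasure x) :=
    ⟨by fun_prop, map_mul_expMeasure hN.lsd_pos hx⟩
  exact ((MeasurePreserving.id (erlangLaw L N.lsr)).prod
    ((MeasurePreserving.id (expMeasure N.lsp)).prod h1)).map_eq.symm

/-- As `λ_sd → ∞`, the law of the gains concentrates on `|h_sd|² = 0`. -/
theorem tendsto_integral_gainsLaw_lsd (hN : N.Valid) {f : ℝ × ℝ × ℝ → ℝ} {f₀ : ℝ × ℝ → ℝ} {M : ℝ}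
    (hf : Measurable f) (hM : ∀ z : ℝ × ℝ × ℝ, 0 < z.1 ∧ 0 < z.2.1 ∧ 0 < z.2.2 → |f z| ≤ M)
    (hlim : ∀ s x, 0 < s → 0 < x → Tendsto (fun y => f (s, x, y)) (𝓝[>] 0) (𝓝 (f₀ (s, x)))) :
    Tendsto (fun r => ∫ z, f z ∂({N with lsd := r} : Network L).gainsLaw) atTop
      (𝓝 (∫ z, f₀ (z.1, z.2.1) ∂N.gainsLaw)) := by
  have := isProbabilityMeasure_gainsLaw hN
  have hsd := hN.lsd_pos
  have hscale : Tendsto (fun r : ℝ => N.lsd / r) atTop (𝓝 0) := tendsto_const_nhds.div_atTop tendsto_id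
  have h1 : Tendsto (fun r => ∫ z, f (z.1, z.2.1, z.2.2 * (N.lsd / r)) ∂N.gainsLaw) atTop
      (𝓝 (∫ z, f₀ (z.1, z.2.1) ∂N.gainsLaw)) := by
    refine tendsto_integral_filter_of_dominated_convergence (fun _ => M)
      (.of_forall fun r => (hf.comp (by fun_prop)).aestronglyMeasurable) ?_
      (integrable_const M) ?_
    · filter_upwards [eventually_gt_atTop 0] with r hr
      filter_upwards [gainsLaw_ae_pos hN] with z hz
      obtain ⟨hs, hx, hy⟩ := hz
      exact hM (z.1, z.2.1, z.2.2 * (N.lsd / r)) ⟨hs, hx, by positivity⟩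
    · filter_upwards [gainsLaw_ae_pos hN] with z hz
      refine (hlim z.1 z.2.1 hz.1 hz.2.1).comp (tendsto_nhdsWithin_iff.2 ⟨?_, ?_⟩)
      · simpa using hscale.const_mul z.2.2
      · filter_upwards [eventually_gt_atTop 0] with r hr
        exact mul_pos hz.2.2 (by positivity)
  refine h1.congr' ?_
  filter_upwards [eventually_gt_atTop 0] with r hr
  rw [gainsLaw_with_lsd hN hr, integral_map (Measurable.aemeasurable (by fun_prop))
    hf.aestronglyMeasurable]

theorem eventually_mem_directSet (hN : N.Valid) (s : ℝ) {x : ℝ} (hx : 0 < x) :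
    ∀ᶠ y in 𝓝[>] (0 : ℝ), ((s, x, y) : ℝ × ℝ × ℝ) ∈ N.directSet :=
  mem_nhdsWithin_of_mem_nhds (Iio_mem_nhds (mul_pos (psi_pos hN) hx))

/-- For fixed x > 0 the condition y < ψx holds once y is small, so the indicator of `decodeSet`
tends to that of `relaySet`. Neither set depends on λ_sd; only the measure moves. -/
theorem tendsto_setIntegral_decodeSet_lsd (hN : N.Valid) {f : ℝ × ℝ × ℝ → ℝ} {M : ℝ}
    (hf : Measurable f) (hM0 : 0 ≤ M)
    (hM : ∀ z ∈ N.directSet, 0 < z.1 ∧ 0 < z.2.1 ∧ 0 < z.2.2 → |f z| ≤ M)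
    (hlim : ∀ s x, 0 < s → 0 < x → ContinuousAt (fun y => f (s, x, y)) 0) :
    Tendsto (fun r => ∫ z in N.decodeSet, f z ∂({N with lsd := r} : Network L).gainsLaw) atTop
      (𝓝 (∫ z in N.relaySet, f (z.1, z.2.1, 0) ∂N.gainsLaw)) := by
  rw [← integral_indicator measurableSet_relaySet]
  simp_rw [← integral_indicator measurableSet_decodeSet]
  refine tendsto_integral_gainsLaw_lsd hN (M := M)
    (f₀ := fun w => N.relaySet.indicator (fun z => f (z.1, z.2.1, 0)) (w.1, w.2, 0))
    (hf.indicator measurableSet_decodeSet) (fun z hz => ?_) fun s x hs hx => ?_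
  · by_cases hd : z ∈ N.decodeSet
    · simpa [hd] using hM z hd.2 hz
    · simpa [hd] using hM0
  · by_cases hr : x ≤ N.g * s
    · refine (((hlim s x hs hx).tendsto.mono_left nhdsWithin_le_nhds).congr' ?_).trans_eq ?_
      · filter_upwards [eventually_mem_directSet hN s hx] with y hy
        rw [Set.indicator_of_mem (show (s, x, y) ∈ N.decodeSet from ⟨hr, hy⟩)]
      · simp [Set.indicator, relaySet, hr]
    · refine (tendsto_const_nhds (x := 0)).congr' ?_ |>.trans_eq ?_
      · exact .of_forall fun y => by simp [Set.indicator, decodeSet, relaySet, hr]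
      · simp [Set.indicator, relaySet, hr]

end Network

/-! ### The limits λ_sd → ∞ and λ_rp → ∞ -/

namespace Network
variable {L : ℕ} {N : Network L}

theorem continuousAt_kernel (p q s x : ℝ) : ContinuousAt (fun y => N.kernel p q (s, x, y)) 0 := by
  have h : Continuous fun y => -(p * x + q * (N.psi * x - y)) / s :=
    Continuous.div_const (by fun_prop) s
  exact h.continuousAt.rexp

/-- The closed form is replaced by the expectation it represents. The kernel and its parameters do
not involve λ_sd, so the concentration at y = 0 applies directly. -/
theorem tendsto_closedTerm_lsd (hN : N.Valid) (i j : ℕ) :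
    Tendsto (fun r => ({N with lsd := r} : Network L).closedTerm i j) atTop
      (𝓝 (N.closedTermNoDirect i j)) := by
  have ha := a_pos hN
  have hκ := hN.lrd_pos
  have hβ := hN.beta_pos
  rw [← setIntegral_kernel_eq_closedTermNoDirect hN]
  refine (tendsto_setIntegral_decodeSet_lsd hN (f := N.kernel (N.a * j) (N.lrd / N.beta * i))
    (measurable_kernel _ _) zero_le_one (fun z hd hz => ?_)
    fun s x _ _ => continuousAt_kernel _ _ _ _).congr' ?_
  · rw [abs_of_pos (kernel_pos _ _ _)]
    exact kernel_le_one (by positivity) (by positivity) hz hd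
  · filter_upwards [eventually_gt_atTop 0] with r hr
    exact setIntegral_kernel_eq_closedTerm (hN.with_lsd hr) i j

theorem continuousAt_innerTerm_zero (hN : N.Valid) : ContinuousAt N.innerTerm 0 := by
  have h1 := hN.lrd_pos
  have h2 := hN.lrp_pos
  have h3 := hN.Itemp_pos
  have h4 := hN.No_pos
  have h5 := gammaTh_pos hN
  have h : 1 + N.lrd / (N.Itemp * N.lrp) * (N.gammaTh * N.No - 0) ≠ 0 := by
    rw [sub_zero]
    positivity
  unfold innerTerm
  fun_prop (disch := assumption)

theorem innerTerm_zero (hN : N.Valid) : N.innerTerm 0 = N.tNoDirect := by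
  rw [← innerGains_zero hN 0 0, innerGains, mul_zero]

theorem continuousAt_antennaOutage (hN : N.Valid) (s x : ℝ) :
    ContinuousAt (fun y => N.antennaOutage (s, x, y)) 0 := by
  have h1 : ContinuousAt (fun y => N.innerGains (s, x, y)) 0 := by
    have h : ContinuousAt (fun y => N.Itemp / x * y) 0 := by fun_prop
    refine ContinuousAt.comp (g := N.innerTerm) ?_ h
    rw [mul_zero]
    exact continuousAt_innerTerm_zero hN
  exact continuousAt_const.sub ((continuousAt_kernel _ _ _ _).mul
    (continuousAt_const.sub ((continuousAt_kernel _ _ _ _).mul h1)))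

theorem tendsto_p2_lsd (hN : N.Valid) :
    Tendsto (fun r => ({N with lsd := r} : Network L).p2) atTop (𝓝 N.p2ClosedNoDirect) := by
  have := isProbabilityMeasure_expMeasure hN.lrd_pos
  have := isProbabilityMeasure_expMeasure hN.lrp_pos
  rw [← p2NoDirect_eq hN, p2NoDirect_eq_setIntegral hN]
  refine (tendsto_setIntegral_decodeSet_lsd hN (f := fun z => N.antennaOutage z ^ L)
    (measurable_antennaOutage.pow_const L) zero_le_one (fun z hd hz => ?_)
    fun s x _ _ => (continuousAt_antennaOutage hN s x).pow L).congr' ?_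
  · rw [← real_antennaSet hN hz.1 hz.2.1 hd, abs_of_nonneg (by positivity)]
    exact pow_le_one₀ measureReal_nonneg measureReal_le_one
  · filter_upwards [eventually_gt_atTop 0] with r hr
    exact (p2_eq_setIntegral (hN.with_lsd hr)).symm

theorem tendsto_truncMean_lsd (hN : N.Valid) :
    Tendsto (fun r => ({N with lsd := r} : Network L).truncMean) atTop (𝓝 0) := by
  have h := tendsto_integral_gainsLaw_lsd hN (M := N.gammaTh * N.No) (f₀ := fun _ => 0)
    ((measurable_directPower (N := N)).indicator (measurableSet_directSet (N := N)))
    (fun z hz => ?_) fun s x hs hx => ?_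
  · rw [integral_zero] at h
    refine h.congr' ?_
    filter_upwards [eventually_gt_atTop 0] with r hr
    rw [integral_indicator measurableSet_directSet]
    exact (truncMean_eq_setIntegral (hN.with_lsd hr)).symm
  · by_cases hd : z ∈ N.directSet
    · obtain ⟨h0, h1⟩ := directPower_le hN hz hd
      rw [Set.indicator_of_mem hd, abs_of_nonneg h0]
      exact h1
    · rw [Set.indicator_of_notMem hd, abs_zero]
      exact mul_nonneg (gammaTh_pos hN).le hN.No_pos.le
  · have hc : Tendsto (fun y => N.Itemp / x * y) (𝓝[>] 0) (𝓝 0) := by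
      have : Continuous fun y => N.Itemp / x * y := by fun_prop
      simpa using (this.tendsto 0).mono_left nhdsWithin_le_nhds
    refine hc.congr' ?_
    filter_upwards [eventually_mem_directSet hN s hx] with y hy
    rw [Set.indicator_of_mem hy]

/-- This is the limit of the denominator of the conditional mean, namely the probability that the
relay decodes. -/
theorem closedTermNoDirect_zero_zero (hN : N.Valid) : 0 < N.closedTermNoDirect 0 0 := by
  have h1 : N.closedTermNoDirect 0 0 = 1 - (N.lsr / N.B2) ^ L := by simp [closedTermNoDirect]
  rw [h1, sub_pos]
  have h2 := mul_pos (g_pos hN) hN.lsp_pos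
  have h3 := B2_pos hN
  refine pow_lt_one₀ (div_nonneg hN.lsr_pos.le h3.le) ?_ (by have := hN.one_le_L; omega)
  rw [div_lt_one h3, B2]
  linarith

theorem tendsto_condMean_lsd (hN : N.Valid) :
    Tendsto (fun r => ({N with lsd := r} : Network L).condMean) atTop (𝓝 0) := by
  have h := tendsto_setIntegral_decodeSet_lsd hN (f := fun z => N.Itemp / z.2.1 * z.2.2)
    measurable_directPower (mul_nonneg (gammaTh_pos hN).le hN.No_pos.le)
    (fun z hd hz => by
      obtain ⟨h0, h1⟩ := directPower_le hN hz hd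
      rw [abs_of_nonneg h0]
      exact h1) fun s x _ _ => continuousAt_const.mul continuousAt_id
  simp only [mul_zero, integral_zero] at h
  have h2 := h.div (tendsto_closedTerm_lsd hN 0 0) (closedTermNoDirect_zero_zero hN).ne'
  rw [zero_div] at h2
  refine h2.congr' ?_
  filter_upwards [eventually_gt_atTop 0] with r hr
  exact (condMean_eq_div (hN.with_lsd hr)).symm

theorem tendsto_p2Closed_lsd (hN : N.Valid) {t : ℝ → ℝ} (ht : Tendsto t atTop (𝓝 N.tNoDirect)) :
    Tendsto (fun r => ({N with lsd := r} : Network L).p2Closed (t r)) atTop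
      (𝓝 N.p2ClosedNoDirect) :=
  tendsto_finsetSum _ fun i _ => tendsto_finsetSum _ fun j _ =>
    ((ht.pow j).const_mul _).mul (tendsto_closedTerm_lsd hN i j)

theorem tendsto_innerTerm_lrp (m : ℝ) :
    Tendsto (fun x => ({N with lrp := x} : Network L).innerTerm m) atTop (𝓝 0) := by
  have h1 : Tendsto (fun x : ℝ => 1 - 1 / (1 + N.lrd / N.Itemp / x * (N.gammaTh * N.No - m)))
      atTop (𝓝 (1 - 1 / (1 + 0 * (N.gammaTh * N.No - m)))) :=
    tendsto_const_nhds.sub (tendsto_const_nhds.div (tendsto_const_nhds.add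
      ((tendsto_const_nhds.div_atTop tendsto_id).mul_const _)) (by simp))
  have h2 : (1 : ℝ) - 1 / (1 + 0 * (N.gammaTh * N.No - m)) = 0 := by simp
  rw [h2] at h1
  refine h1.congr fun x => ?_
  rw [div_div]
  rfl

/-- The parameter λ_rp enters only through a, and a only through the product aj. -/
theorem closedTerm_with_lrp (x : ℝ) (i : ℕ) :
    ({N with lrp := x} : Network L).closedTerm i 0 = N.closedTerm i 0 := by
  simp only [closedTerm, termEi, termE1, termE2, a, b, c, d, g, B1, B2, psi, gammaTh,
    Nat.cast_zero, mul_zero]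

/-- As `λ_rp → ∞`, only the terms with `j = 0` remain. -/
theorem tendsto_sum_lrp (hN : N.Valid) {T : ℝ → ℕ → ℕ → ℝ}
    (h0 : ∀ i, ∀ᶠ x in atTop, T x i 0 = N.closedTerm i 0)
    (h1 : ∀ i j, 1 ≤ j → Tendsto (fun x => T x i j) atTop (𝓝 0)) :
    Tendsto (fun x => ∑ i ∈ Finset.range (L + 1), ∑ j ∈ Finset.range (i + 1),
      (L.choose i : ℝ) * (i.choose j : ℝ) * (-1) ^ (i + j) * T x i j) atTop
      (𝓝 N.p2ClosedUnconstrained) := by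
  rw [← sum_closedTerm_eq hN]
  refine tendsto_finsetSum _ fun i _ => ?_
  have h2 : (L.choose i : ℝ) * (-1) ^ i * N.closedTerm i 0 =
      ∑ j ∈ Finset.range (i + 1), (L.choose i : ℝ) * (i.choose j : ℝ) * (-1) ^ (i + j) *
        if j = 0 then N.closedTerm i 0 else 0 := by
    simp
  rw [h2]
  refine tendsto_finsetSum _ fun j _ => ?_
  refine Tendsto.const_mul _ ?_
  rcases Nat.eq_zero_or_pos j with rfl | hj
  · rw [if_pos rfl]
    exact tendsto_const_nhds.congr' ((h0 i).mono fun x hx => hx.symm)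
  · rw [if_neg (by omega)]
    exact h1 i j hj

theorem abs_setIntegral_kernel_mul_le (hN : N.Valid) (i j : ℕ) :
    |∫ z in N.decodeSet, N.kernel (N.a * j) (N.lrd / N.beta * i) z * N.innerGains z ^ j
      ∂N.gainsLaw| ≤ (N.lrd / (N.Itemp * N.lrp) * (N.gammaTh * N.No)) ^ j := by
  have := isProbabilityMeasure_gainsLaw hN
  have := a_pos hN
  have := hN.lrd_pos
  have := hN.lrp_pos
  have := hN.Itemp_pos
  have := hN.No_pos
  have := gammaTh_pos hN
  have := hN.beta_pos
  have hK : 0 ≤ (N.lrd / (N.Itemp * N.lrp) * (N.gammaTh * N.No)) ^ j := by positivity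
  have h : ∀ᵐ z ∂(N.gainsLaw.restrict N.decodeSet),
      ‖N.kernel (N.a * j) (N.lrd / N.beta * i) z * N.innerGains z ^ j‖ ≤
        (N.lrd / (N.Itemp * N.lrp) * (N.gammaTh * N.No)) ^ j := by
    filter_upwards [ae_restrict_of_ae (gainsLaw_ae_pos hN),
      ae_restrict_mem measurableSet_decodeSet] with z hz hd
    obtain ⟨h0, -, h1⟩ := innerGains_mem hN hz.2.1 hz.2.2.le hd.2
    rw [Real.norm_eq_abs, abs_of_nonneg (mul_nonneg (kernel_pos _ _ _).le (by positivity))]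
    exact (mul_le_of_le_one_left (by positivity) (kernel_le_one (by positivity) (by positivity)
      hz hd.2)).trans (pow_le_pow_left₀ h0 h1 j)
  refine (norm_integral_le_of_norm_le_const h).trans (mul_le_of_le_one_right hK ?_)
  rw [measureReal_restrict_apply_univ]
  exact measureReal_le_one

/-- The closed form is a truncated expectation of a kernel with values in (0, 1]. The bound is
uniform in the parameters, so the behaviour of Ei and E_L as a → ∞ need not be examined. -/
theorem abs_closedTerm_le_one (hN : N.Valid) (i j : ℕ) : |N.closedTerm i j| ≤ 1 := by
  have := isProbabilityMeasure_gainsLaw hN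
  have := a_pos hN
  have := hN.lrd_pos
  have := hN.beta_pos
  rw [← setIntegral_kernel_eq_closedTerm hN]
  have h : ∀ᵐ z ∂(N.gainsLaw.restrict N.decodeSet),
      ‖N.kernel (N.a * j) (N.lrd / N.beta * i) z‖ ≤ 1 := by
    filter_upwards [ae_restrict_of_ae (gainsLaw_ae_pos hN),
      ae_restrict_mem measurableSet_decodeSet] with z hz hd
    rw [Real.norm_eq_abs, abs_of_pos (kernel_pos _ _ _)]
    exact kernel_le_one (by positivity) (by positivity) hz hd.2
  refine (norm_integral_le_of_norm_le_const h).trans (mul_le_of_le_one_right zero_le_one ?_)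
  rw [measureReal_restrict_apply_univ]
  exact measureReal_le_one

theorem tendsto_p2Closed_lrp (hN : N.Valid) {t : ℝ → ℝ} (ht : Tendsto t atTop (𝓝 0)) :
    Tendsto (fun x => ({N with lrp := x} : Network L).p2Closed (t x)) atTop
      (𝓝 N.p2ClosedUnconstrained) := by
  have h := tendsto_sum_lrp hN
    (T := fun x i j => t x ^ j * ({N with lrp := x} : Network L).closedTerm i j)
    (fun i => .of_forall fun x => by rw [pow_zero, one_mul, closedTerm_with_lrp])
    fun i j hj => ?_
  · refine h.congr fun x => ?_
    simp only [← mul_assoc]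
    rfl
  · have h1 : Tendsto (fun x => |t x ^ j|) atTop (𝓝 0) := by
      have := (ht.pow j).abs
      rwa [zero_pow (by omega), abs_zero] at this
    refine squeeze_zero_norm' ?_ h1
    filter_upwards [eventually_gt_atTop 0] with x hx
    rw [norm_mul, Real.norm_eq_abs, Real.norm_eq_abs]
    exact mul_le_of_le_one_right (abs_nonneg _) (abs_closedTerm_le_one (hN.with_lrp hx) i j)

theorem p2_eq_sum (hN : N.Valid) :
    N.p2 = ∑ i ∈ Finset.range (L + 1), ∑ j ∈ Finset.range (i + 1),
      (L.choose i : ℝ) * (i.choose j : ℝ) * (-1) ^ (i + j) *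
        ∫ z in N.decodeSet, N.kernel (N.a * j) (N.lrd / N.beta * i) z * N.innerGains z ^ j
          ∂N.gainsLaw := by
  rw [p2_eq_expansion hN, expansion]
  refine Finset.sum_congr rfl fun i _ => Finset.sum_congr rfl fun j _ => ?_
  rw [← setIntegral_condEvent_expansion hN
    (u := fun h => N.innerTerm (N.Ps h * h.gainSD)) measurable_innerGains fun _ => rfl]

theorem tendsto_p2_lrp (hN : N.Valid) :
    Tendsto (fun x => ({N with lrp := x} : Network L).p2) atTop
      (𝓝 N.p2ClosedUnconstrained) := by
  have h := tendsto_sum_lrp hN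
    (T := fun x i j => ∫ z in ({N with lrp := x} : Network L).decodeSet,
      ({N with lrp := x} : Network L).kernel (({N with lrp := x} : Network L).a * j)
        (N.lrd / N.beta * i) z * ({N with lrp := x} : Network L).innerGains z ^ j
          ∂({N with lrp := x} : Network L).gainsLaw) (fun i => ?_) fun i j hj => ?_
  · refine h.congr' ?_
    filter_upwards [eventually_gt_atTop 0] with x hx
    exact (p2_eq_sum (hN.with_lrp hx)).symm
  · filter_upwards [eventually_gt_atTop 0] with x hx
    simp only [pow_zero, mul_one]
    exact (setIntegral_kernel_eq_closedTerm (hN.with_lrp hx) i 0).trans (closedTerm_with_lrp x i)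
  -- For j ≥ 1 the true inner term is at most a constant over λ_rp on the decoding event, so the
  -- whole summand is squeezed to 0.
  · have h1 : Tendsto (fun x : ℝ => (N.lrd / N.Itemp / x * (N.gammaTh * N.No)) ^ j) atTop
        (𝓝 0) := by
      have := (((tendsto_const_nhds (x := N.lrd / N.Itemp)).div_atTop tendsto_id).mul_const
        (N.gammaTh * N.No)).pow j
      rwa [zero_mul, zero_pow (by omega)] at this
    refine squeeze_zero_norm' ?_ h1
    filter_upwards [eventually_gt_atTop 0] with x hx
    rw [div_div]
    exact abs_setIntegral_kernel_mul_le (hN.with_lrp hx) i j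

end Network

theorem mainTheorem2 {L : ℕ} (N : Network L) (hN : N.Valid) :
    -- decomposition of the outage probability and exact first-hop outage
    N.outage = N.p1 + N.p2 ∧
    N.p1 = (1 + N.lsp * N.xi / (N.lsr * N.psi)) ^ (-(L : ℤ)) ∧
    -- exact expansion of `p₂`
    N.p2 = N.expansion (fun h => N.innerTerm (N.Ps h * h.gainSD)) ∧
    -- closed form after replacing the random argument of the inner term by a constant
    (∀ m : ℝ, N.p2Approx m = N.p2Closed (N.innerTerm m)) ∧
    -- the truncated mean and the corresponding `t`
    N.truncMean = N.Itemp * N.lsp / N.lsd *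
      (Real.log (N.psi * N.lsd / N.lsp + 1) - N.psi * N.lsd / (N.psi * N.lsd + N.lsp)) ∧
    N.innerTerm N.truncMean = 1 - (1 + N.lrd / N.lrp * (N.psi - N.lsp / N.lsd *
      (Real.log (N.psi * N.lsd / N.lsp + 1) - N.psi * N.lsd / (N.psi * N.lsd + N.lsp))))⁻¹ ∧
    -- the conditional mean
    N.condMean = N.Itemp * N.lsp / N.lsd *
      (Real.log (1 + N.c / (N.lsp + N.lsr / N.g))
        + (∑ k ∈ Finset.Icc 1 (L - 1), (N.lsr / N.g) ^ k / k *
            (1 / (N.lsp + N.lsr / N.g) ^ k - 1 / (N.lsp + N.lsr / N.g + N.c) ^ k))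
        - N.c / (N.c + N.lsp) * (1 - (N.lsr / N.B1) ^ L)) /
      (1 - (N.lsr / N.B2) ^ L - N.lsp / (N.c + N.lsp) * (1 - (N.lsr / N.B1) ^ L)) ∧
    -- `λ_rp → ∞`
    (∀ m : ℝ, Tendsto (fun x => ({N with lrp := x} : Network L).innerTerm m) atTop (𝓝 0) ∧
      Tendsto (fun x => ({N with lrp := x} : Network L).p2Closed
        (({N with lrp := x} : Network L).innerTerm m)) atTop (𝓝 N.p2ClosedUnconstrained)) ∧
    Tendsto (fun x => ({N with lrp := x} : Network L).p2) atTop (𝓝 N.p2ClosedUnconstrained) ∧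
    N.p2Unconstrained = N.p2ClosedUnconstrained ∧
    -- `λ_sd → ∞`
    (∀ m : Network L → ℝ, m = Network.truncMean ∨ m = Network.condMean →
      Tendsto (fun x => ({N with lsd := x} : Network L).innerTerm (m {N with lsd := x})) atTop
        (𝓝 N.tNoDirect) ∧
      Tendsto (fun x => ({N with lsd := x} : Network L).p2Closed
        (({N with lsd := x} : Network L).innerTerm (m {N with lsd := x}))) atTop
        (𝓝 N.p2ClosedNoDirect)) ∧
    Tendsto (fun x => ({N with lsd := x} : Network L).p2) atTop (𝓝 N.p2ClosedNoDirect) ∧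
    N.p2NoDirect = N.p2ClosedNoDirect := by

  refine ⟨Network.outage_eq, Network.p1_eq hN, Network.p2_eq_expansion hN, Network.p2Approx_eq hN,
    Network.truncMean_eq hN, ?_, Network.condMean_eq hN,
    fun m => ⟨Network.tendsto_innerTerm_lrp m,
      Network.tendsto_p2Closed_lrp hN (Network.tendsto_innerTerm_lrp m)⟩,
    Network.tendsto_p2_lrp hN, Network.p2Unconstrained_eq hN, fun m hm => ?_,
    Network.tendsto_p2_lsd hN, Network.p2NoDirect_eq hN⟩
  · rw [Network.truncMean_eq hN, mul_div_assoc, mul_assoc, Network.innerTerm_eq hN]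
  -- Both means tend to 0, and the inner term, which does not involve λ_sd, is continuous at 0 with
  -- value t_nd.
  · have h0 : Tendsto (fun x => m {N with lsd := x}) atTop (𝓝 0) := by
      rcases hm with rfl | rfl
      · exact Network.tendsto_truncMean_lsd hN
      · exact Network.tendsto_condMean_lsd hN
    have h1 : Tendsto (fun x => ({N with lsd := x} : Network L).innerTerm (m {N with lsd := x}))
        atTop (𝓝 N.tNoDirect) := by
      rw [← Network.innerTerm_zero hN]
      exact (Network.continuousAt_innerTerm_zero hN).tendsto.comp h0
    exact ⟨h1, Network.tendsto_p2Closed_lsd hN h1⟩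


end
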